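/- Let $M$ be a finite-dimensional smooth Riemannian manifold (without boundary) with metric $\langle\cdot,\cdot\rangle$, norm $\|\cdot\|$, Levi-Civita connection $\nabla$ and curvature tensor $\mathcal R(X,Y)=\nabla_X\nabla_Y-\nabla_Y\nabla_X-\nabla_{[X,Y]}$. For a smooth curve $\gamma:[0,1]\to M$ let $P_\gamma^{t_1,t_2}:T_{\gamma(t_1)}M\to T_{\gamma(t_2)}M$ denote parallel transport along $\gamma$. Let $\mathcal M=\mathrm{Imm}([0,1],M)$ be the space of smooth curves $c:[0,1]\to M$ with $c'(t)\neq 0$ for all $t\in[0,1]$, with the Riemannian metric $$G_c(h,k)=\langle h(0),k(0)\rangle+\int_0^1\Big(\langle\nabla_\ell h^N,\nabla_\ell k^N\rangle+\tfrac14\langle\nabla_\ell h^T,\nabla_\ell k^T\rangle\Big)\|c'(t)\|\,dt$$ for smooth vector fields $h,k$ along $c$, where $v=c'/\|c'\|$, $\nabla_\ell h=\nabla_{c'}h/\|c'\|$, $\nabla_\ell h^T=\langle\nabla_\ell h,v\rangle v$ and $\nabla_\ell h^N=\nabla_\ell h-\nabla_\ell h^T$. For $c_0,c_1\in\mathcal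 M$, a path from $c_0$ to $c_1$ is a smooth map $c:[0,1]\times[0,1]\to M$, $(s,t)\mapsto c(s,t)$, with $c(s,\cdot)\in\mathcal M$ for all $s$, $c(0,\cdot)=c_0$ and $c(1,\cdot)=c_1$; write $c_s,c_t$ for its partial derivatives and $\nabla_s,\nabla_t$ for covariant derivatives in the directions $c_s,c_t$. Let $d(c_0,c_1)\in[0,\infty]$ be the geodesic distance induced by $G$, that is, the infimum over all paths from $c_0$ to $c_1$ of $\int_0^1\sqrt{G_{c(s,\cdot)}(c_s(s,\cdot),c_s(s,\cdot))}\,ds$ (the infimum is $\infty$ if there is no path). For a path $c$ put $$q(s,t)=\frac{c_t(s,t)}{\sqrt{\|c_t(s,t)\|}},\qquad \tilde q(s,t)=P_{c(\cdot,0)}^{s,0}\circ P_{c(s,\cdot)}^{t,0}\big(q(s,t)\big)\in T_{c_0(0)}M,$$ $$\omega^{s,t}(a,\tau)=P_{c(a,\cdot)}^{0,\tau}\circ P_{c(\cdot,0)}^{s,a}\circ P_{c(s,\cdot)}^{t,0}\big(q(s,t)\big)\in T_{c(a,\tau)}M,\qquad \Omega(s,t)=P_{c(\cdot,0)}^{s,0}\circ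 P_{c(s,\cdot)}^{t,0}\big(\nabla_a\omega^{s,t}(s,t)\big)\in T_{c_0(0)}M .$$ Then for all $c_0,c_1\in\mathcal M$, with infima over all paths $c$ from $c_0$ to $c_1$, $$d(c_0,c_1)=\inf_{c}\int_0^1\sqrt{\|c_s(s,0)\|^2+\int_0^1\|\nabla_sq(s,t)\|^2\,dt}\;ds=\inf_{c}\int_0^1\sqrt{\|c_s(s,0)\|^2+\int_0^1\|\tilde q_s(s,t)+\Omega(s,t)\|^2\,dt}\;ds .$$ Moreover, for every such path all the parallel transports, derivatives and integrals above are well defined, and for all $s,t\in[0,1]$ $$\Omega(s,t)=P_{c(\cdot,0)}^{s,0}\left(\int_0^tP_{c(s,\cdot)}^{\tau,0}\Big(\mathcal R\big(c_\tau(s,\tau),c_s(s,\tau)\big)P_{c(s,\cdot)}^{t,\tau}q(s,t)\Big)\,d\tau\right).$$ -/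

import Mathlib

open Set MeasureTheory
open scoped Manifold ContDiff ENNReal

noncomputable section

namespace CurveSpace

variable {E : Type*} [NormedAddCommGroup E] [NormedSpace ℝ E]
  {M : Type*} [TopologicalSpace M] [ChartedSpace E M] [IsManifold 𝓘(ℝ, E) ∞ M]

variable (E M) in
/-- A smooth Riemannian metric on `M`. -/
abbrev RMetric : Type _ :=
  Bundle.ContMDiffRiemannianMetric 𝓘(ℝ, E) ∞ E (fun x : M => TangentSpace 𝓘(ℝ, E) x)

/-- The norm of a tangent vector for the Riemannian metric. -/
def gnorm (g : RMetric E M) {x : M} (v : TangentSpace 𝓘(ℝ, E) x) : ℝ := √(g.inner x v v)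

/-! ### Levi-Civita connection and curvature, in charts -/

/-- The Riemannian metric read in the chart at `x₀`: the bilinear form `g_y(u, v)` on `E` at the
point of `M` whose coordinate is `y`. -/
def chartMetric (g : RMetric E M) (x₀ : M) (y : E) : E →L[ℝ] E →L[ℝ] ℝ :=
  let p : M := (extChartAt 𝓘(ℝ, E) x₀).symm y
  let A : E →L[ℝ] E := tangentCoordChange 𝓘(ℝ, E) x₀ p p
  let B : E →L[ℝ] E →L[ℝ] ℝ := g.inner p
  B.bilinearComp A A

/-- The Christoffel symbols `Γ_y(u, v)` of the Levi-Civita connection in the chart at `x₀`, that is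
`2 g_y(Γ_y(u, v), z) = D_u g(v, z) + D_v g(u, z) - D_z g(u, v)` for all `z`. -/
def christoffel (g : RMetric E M) (x₀ : M) (y u v : E) : E :=
  let Dg : E →L[ℝ] E →L[ℝ] E →L[ℝ] ℝ := fderiv ℝ (chartMetric g x₀) y
  (1 / 2 : ℝ) • (chartMetric g x₀ y).inverse (Dg u v + Dg v u - (Dg.flip u).flip v)

/-- The Riemann curvature tensor `𝓡(u, v) w` at `x`, with the convention
`𝓡(X, Y) = ∇_X ∇_Y - ∇_Y ∇_X - ∇_{[X, Y]}`, computed in the chart at `x`. -/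
def curvature (g : RMetric E M) (x : M) (u v w : TangentSpace 𝓘(ℝ, E) x) :
    TangentSpace 𝓘(ℝ, E) x :=
  let curv (u v w : E) : E :=
    let y₀ : E := extChartAt 𝓘(ℝ, E) x x
    let Γ : E → E → E → E := christoffel g x
    fderiv ℝ (fun y => Γ y v w) y₀ u - fderiv ℝ (fun y => Γ y u w) y₀ v
      + Γ y₀ u (Γ y₀ v w) - Γ y₀ v (Γ y₀ u w)
  curv u v w

/-! ### Curves on `[0, 1]`, covariant derivative and parallel transport along them

A curve on `[0, 1]` is a function on `ℝ` of which only the restriction to `[0, 1]` is used; its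
derivatives are taken within `[0, 1]`. -/

/-- The velocity `γ'(t) ∈ T_{γ(t)} M`. -/
def velocity (γ : ℝ → M) (t : ℝ) : TangentSpace 𝓘(ℝ, E) (γ t) :=
  mfderivWithin 𝓘(ℝ, ℝ) 𝓘(ℝ, E) γ (Icc 0 1) t (1 : ℝ)

/-- A vector field `V` along `γ`, read in the chart at `x₀`. -/
def fieldCoord (γ : ℝ → M) (V : ∀ t, TangentSpace 𝓘(ℝ, E) (γ t)) (x₀ : M) (t : ℝ) : E :=
  (trivializationAt E (TangentSpace 𝓘(ℝ, E) : M → Type _) x₀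
    (⟨γ t, V t⟩ : TangentBundle 𝓘(ℝ, E) M)).2

/-- The vector field `V` along `γ` is differentiable at `t`. -/
def FieldDifferentiableAt (γ : ℝ → M) (V : ∀ t, TangentSpace 𝓘(ℝ, E) (γ t)) (t : ℝ) : Prop :=
  MDifferentiableWithinAt 𝓘(ℝ, ℝ) 𝓘(ℝ, E).tangent
    (fun τ => (⟨γ τ, V τ⟩ : TangentBundle 𝓘(ℝ, E) M)) (Icc 0 1) t

/-- The covariant derivative `∇_{γ'} V` at time `t` of a vector field `V` along `γ`, for the
Levi-Civita connection: `(V^k)' + Γ^k_{ij} (γ^i)' V^j` in the chart at `γ t`. -/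
def covDeriv (g : RMetric E M) (γ : ℝ → M) (V : ∀ t, TangentSpace 𝓘(ℝ, E) (γ t)) (t : ℝ) :
    TangentSpace 𝓘(ℝ, E) (γ t) :=
  (derivWithin (fieldCoord γ V (γ t)) (Icc 0 1) t
    + christoffel g (γ t) (extChartAt 𝓘(ℝ, E) (γ t) (γ t)) (velocity γ t : E) (V t : E) : E)

/-- `V` is a parallel vector field along `γ` on `[0, 1]`. -/
def IsParallel (g : RMetric E M) (γ : ℝ → M) (V : ∀ t, TangentSpace 𝓘(ℝ, E) (γ t)) : Prop :=
  ∀ t ∈ Icc (0 : ℝ) 1, FieldDifferentiableAt γ V t ∧ covDeriv g γ V t = 0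

open Classical in
/-- The parallel transport `P_γ^{t₁, t₂} : T_{γ(t₁)} M → T_{γ(t₂)} M`: the value at `t₂` of the
parallel vector field along `γ` that takes the value `u` at `t₁`. -/
def transport (g : RMetric E M) (γ : ℝ → M) (t₁ t₂ : ℝ) (u : TangentSpace 𝓘(ℝ, E) (γ t₁)) :
    TangentSpace 𝓘(ℝ, E) (γ t₂) :=
  if h : ∃ V : ∀ t, TangentSpace 𝓘(ℝ, E) (γ t), IsParallel g γ V ∧ V t₁ = u then
    h.choose t₂
  else 0

/-- Along `γ`, parallel vector fields exist and are unique on `[0, 1]` for every initial value, so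
that all parallel transports along `γ` are well defined. -/
def HasTransport (g : RMetric E M) (γ : ℝ → M) : Prop :=
  ∀ t₁ ∈ Icc (0 : ℝ) 1,
    (∀ u : TangentSpace 𝓘(ℝ, E) (γ t₁), ∃ V : ∀ t, TangentSpace 𝓘(ℝ, E) (γ t),
      IsParallel g γ V ∧ V t₁ = u) ∧
    (∀ V W : ∀ t, TangentSpace 𝓘(ℝ, E) (γ t), IsParallel g γ V → IsParallel g γ W →
      V t₁ = W t₁ → ∀ t ∈ Icc (0 : ℝ) 1, V t = W t)

/-! ### The space of immersions and its metric -/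

/-- `c` is a smooth immersion `[0, 1] → M`. -/
def IsImm (c : ℝ → M) : Prop :=
  ContMDiffOn 𝓘(ℝ, ℝ) 𝓘(ℝ, E) ∞ c (Icc 0 1) ∧
    ∀ t ∈ Icc (0 : ℝ) 1, velocity (E := E) c t ≠ 0

/-- The unit speed vector field `c' / ‖c'‖`. -/
def unitSpeed (g : RMetric E M) (c : ℝ → M) (t : ℝ) : TangentSpace 𝓘(ℝ, E) (c t) :=
  (gnorm g (velocity c t))⁻¹ • velocity c t

/-- The covariant derivative according to arc length `∇_ℓ h = ∇_{c'} h / ‖c'‖`. -/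
def covArc (g : RMetric E M) (c : ℝ → M) (h : ∀ t, TangentSpace 𝓘(ℝ, E) (c t)) (t : ℝ) :
    TangentSpace 𝓘(ℝ, E) (c t) :=
  (gnorm g (velocity c t))⁻¹ • covDeriv g c h t

/-- The tangential component `∇_ℓ h^T = ⟨∇_ℓ h, v⟩ v`, where `v = c' / ‖c'‖`. -/
def covArcT (g : RMetric E M) (c : ℝ → M) (h : ∀ t, TangentSpace 𝓘(ℝ, E) (c t)) (t : ℝ) :
    TangentSpace 𝓘(ℝ, E) (c t) :=
  g.inner (c t) (covArc g c h t) (unitSpeed g c t) • unitSpeed g c t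

/-- The normal component `∇_ℓ h^N = ∇_ℓ h - ∇_ℓ h^T`. -/
def covArcN (g : RMetric E M) (c : ℝ → M) (h : ∀ t, TangentSpace 𝓘(ℝ, E) (c t)) (t : ℝ) :
    TangentSpace 𝓘(ℝ, E) (c t) :=
  covArc g c h t - covArcT g c h t

/-- The integrand `(⟨∇_ℓ h^N, ∇_ℓ k^N⟩ + ⟨∇_ℓ h^T, ∇_ℓ k^T⟩ / 4) ‖c'‖` of the Sobolev metric. -/
def sobolevIntegrand (g : RMetric E M) (c : ℝ → M) (h k : ∀ t, TangentSpace 𝓘(ℝ, E) (c t))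
    (t : ℝ) : ℝ :=
  (g.inner (c t) (covArcN g c h t) (covArcN g c k t)
    + 1 / 4 * g.inner (c t) (covArcT g c h t) (covArcT g c k t)) * gnorm g (velocity c t)

/-- The first-order Sobolev metric `G_c(h, k)` on the space of immersions. -/
def sobolevMetric (g : RMetric E M) (c : ℝ → M) (h k : ∀ t, TangentSpace 𝓘(ℝ, E) (c t)) : ℝ :=
  g.inner (c 0) (h 0) (k 0) + ∫ t in (0 : ℝ)..1, sobolevIntegrand g c h k t

/-- `c` is a smooth path `s ↦ c(s, ·)` of immersions, `s ∈ [0, 1]`, that joins `c₀` to `c₁`. -/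
structure IsPath (c₀ c₁ : ℝ → M) (c : ℝ → ℝ → M) : Prop where
  smooth : ContMDiffOn 𝓘(ℝ, ℝ × ℝ) 𝓘(ℝ, E) ∞ (fun z : ℝ × ℝ => c z.1 z.2) (Icc 0 1 ×ˢ Icc 0 1)
  imm : ∀ s ∈ Icc (0 : ℝ) 1, IsImm (E := E) (c s)
  source : ∀ t ∈ Icc (0 : ℝ) 1, c 0 t = c₀ t
  target : ∀ t ∈ Icc (0 : ℝ) 1, c 1 t = c₁ t

/-- The derivative `c_s(s, t)`. -/
def derivS (c : ℝ → ℝ → M) (s t : ℝ) : TangentSpace 𝓘(ℝ, E) (c s t) :=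
  velocity (fun σ => c σ t) s

/-- The derivative `c_t(s, t)`. -/
def derivT (c : ℝ → ℝ → M) (s t : ℝ) : TangentSpace 𝓘(ℝ, E) (c s t) :=
  velocity (c s) t

/-- The length of a path of immersions for the Riemannian metric `G`. -/
def pathLength (g : RMetric E M) (c : ℝ → ℝ → M) : ℝ :=
  ∫ s in (0 : ℝ)..1, √(sobolevMetric g (c s) (derivS c s) (derivS c s))

/-- The geodesic distance induced by `G`: the infimum of the lengths of the paths of immersions
that join the two curves (`∞` if there is none). -/
def geodesicDist (g : RMetric E M) (c₀ c₁ : ℝ → M) : ℝ≥0∞ :=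
  ⨅ (c : ℝ → ℝ → M) (_ : IsPath (E := E) c₀ c₁ c), ENNReal.ofReal (pathLength g c)

/-! ### Square root velocity representation, raising, holonomy -/

/-- The square root velocity function `R(c) = c' / √‖c'‖`. -/
def srvf (g : RMetric E M) (c : ℝ → M) (t : ℝ) : TangentSpace 𝓘(ℝ, E) (c t) :=
  (√(gnorm g (velocity c t)))⁻¹ • velocity c t

/-- The covariant derivative `∇_s q(s, t)`, where `q(s, ·) = R(c(s, ·))`. -/
def covSrvf (g : RMetric E M) (c : ℝ → ℝ → M) (s t : ℝ) : TangentSpace 𝓘(ℝ, E) (c s t) :=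
  covDeriv g (fun σ => c σ t) (fun σ => srvf g (c σ) t) s

/-- Transport of `u ∈ T_{c(s, t)} M` along `c(s, ·)` to its origin, then along `c(·, 0)` to
`T_{c(0, 0)} M`. -/
def transportToOrigin (g : RMetric E M) (c : ℝ → ℝ → M) (s t : ℝ)
    (u : TangentSpace 𝓘(ℝ, E) (c s t)) : TangentSpace 𝓘(ℝ, E) (c 0 0) :=
  transport g (fun σ => c σ 0) s 0 (transport g (c s) t 0 u)

/-- The raising `q̃(s, t)` of `q` in the tangent space `T_{c(0, 0)} M`. -/
def raising (g : RMetric E M) (c : ℝ → ℝ → M) (s t : ℝ) : TangentSpace 𝓘(ℝ, E) (c 0 0) :=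
  transportToOrigin g c s t (srvf g (c s) t)

/-- The derivative `q̃_s(s, t)`, in the fixed vector space `T_{c(0, 0)} M = E`. -/
def raisingS (g : RMetric E M) (c : ℝ → ℝ → M) (s t : ℝ) : TangentSpace 𝓘(ℝ, E) (c 0 0) :=
  derivWithin (fun σ => (raising g c σ t : E)) (Icc 0 1) s

/-- The vector field `ω^{s, t}(a, τ)`, which transports `q(s, t)` along `c(s, ·)` to its origin,
then along `c(·, 0)` to `c(a, 0)`, then along `c(a, ·)` to `c(a, τ)`. -/
def omegaField (g : RMetric E M) (c : ℝ → ℝ → M) (s t a τ : ℝ) : TangentSpace 𝓘(ℝ, E) (c a τ) :=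
  transport g (c a) 0 τ
    (transport g (fun σ => c σ 0) s a (transport g (c s) t 0 (srvf g (c s) t)))

/-- The holonomy term `Ω(s, t)`: the transport of `∇_a ω^{s, t}(s, t)` to `T_{c(0, 0)} M`. -/
def holonomy (g : RMetric E M) (c : ℝ → ℝ → M) (s t : ℝ) : TangentSpace 𝓘(ℝ, E) (c 0 0) :=
  transportToOrigin g c s t
    (covDeriv g (fun a => c a t) (fun a => omegaField g c s t a t) s)

/-- The vector `P_{c(s, ·)}^{τ, 0} (𝓡(c_τ, c_s) P_{c(s, ·)}^{t, τ} q(s, t))`, at the point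
`(s, τ)` of the surface, as an element of `T_{c(s, 0)} M = E`. -/
def curvatureIntegrand (g : RMetric E M) (c : ℝ → ℝ → M) (s t τ : ℝ) : E :=
  transport g (c s) τ 0
    (curvature g (c s τ) (derivT c s τ) (derivS c s τ) (transport g (c s) t τ (srvf g (c s) t)))

/-- The speed in `s`, written with `∇_s q`. -/
def speedSrvf (g : RMetric E M) (c : ℝ → ℝ → M) (s : ℝ) : ℝ :=
  √(gnorm g (derivS c s 0) ^ 2 + ∫ t in (0 : ℝ)..1, gnorm g (covSrvf g c s t) ^ 2)

/-- The speed in `s`, written with `q̃_s + Ω`. -/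
def speedRaising (g : RMetric E M) (c : ℝ → ℝ → M) (s : ℝ) : ℝ :=
  √(gnorm g (derivS c s 0) ^ 2 +
    ∫ t in (0 : ℝ)..1, gnorm g (raisingS g c s t + holonomy g c s t) ^ 2)

/-- All the objects attached to a path of curves are well defined: the parallel transports, the
derivatives `∇_t c_s`, `∇_s q`, `q̃_s` and `∇_a ω`, and the integrals. -/
structure WellDefined (g : RMetric E M) (c : ℝ → ℝ → M) : Prop where
  transport_curve : ∀ s ∈ Icc (0 : ℝ) 1, HasTransport g (c s)
  transport_origin : HasTransport g (fun s => c s 0)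
  derivS_diff : ∀ s ∈ Icc (0 : ℝ) 1, ∀ t ∈ Icc (0 : ℝ) 1,
    FieldDifferentiableAt (E := E) (c s) (derivS c s) t
  srvf_diff : ∀ s ∈ Icc (0 : ℝ) 1, ∀ t ∈ Icc (0 : ℝ) 1,
    FieldDifferentiableAt (fun σ => c σ t) (fun σ => srvf g (c σ) t) s
  raising_diff : ∀ s ∈ Icc (0 : ℝ) 1, ∀ t ∈ Icc (0 : ℝ) 1,
    DifferentiableWithinAt ℝ (fun σ => (raising g c σ t : E)) (Icc 0 1) s
  omega_diff : ∀ s ∈ Icc (0 : ℝ) 1, ∀ t ∈ Icc (0 : ℝ) 1,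
    FieldDifferentiableAt (fun a => c a t) (fun a => omegaField g c s t a t) s
  sobolev_int : ∀ s ∈ Icc (0 : ℝ) 1,
    IntervalIntegrable (sobolevIntegrand g (c s) (derivS c s) (derivS c s)) volume 0 1
  length_int : IntervalIntegrable
    (fun s => √(sobolevMetric g (c s) (derivS c s) (derivS c s))) volume 0 1
  srvf_int : ∀ s ∈ Icc (0 : ℝ) 1,
    IntervalIntegrable (fun t => gnorm g (covSrvf g c s t) ^ 2) volume 0 1
  raising_int : ∀ s ∈ Icc (0 : ℝ) 1, IntervalIntegrable
    (fun t => gnorm g (raisingS g c s t + holonomy g c s t) ^ 2) volume 0 1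
  curvature_int : ∀ s ∈ Icc (0 : ℝ) 1, ∀ t ∈ Icc (0 : ℝ) 1,
    IntervalIntegrable (curvatureIntegrand g c s t) volume 0 t
  speedSrvf_int : IntervalIntegrable (speedSrvf g c) volume 0 1
  speedRaising_int : IntervalIntegrable (speedRaising g c) volume 0 1

end CurveSpace

end

set_option maxSynthPendingDepth 3
set_option linter.unusedSectionVars false

open Set MeasureTheory Filter Topology
open scoped Manifold ContDiff ENNReal

noncomputable section

namespace CurveSpace

/-! ### The metric on the model space -/

section


variable {E : Type*} [NormedAddCommGroup E] [NormedSpace ℝ E]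
  {M : Type*} [TopologicalSpace M] [ChartedSpace E M] [IsManifold 𝓘(ℝ, E) ∞ M]

/-! The three lengths agree path by path, and their integrands agree pointwise, before any infimum
is taken. Put `D = ∇_s c_t`, `v = c_t/‖c_t‖`. The connection has no torsion, so `D = ∇_t c_s`
(`SmoothSquare.cov_velT_eq`). The Sobolev integrand counts the normal part of `D` fully and the
tangential part with weight 1/4, so it is `(‖D‖² - (3/4)⟨D, v⟩²)/‖c_t‖`, called `density`.
Differentiating `q = c_t/√‖c_t‖` with a metric connection gives `∇_s q = (D - (1/2)⟨D, v⟩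
v)/√‖c_t‖`, whose squared norm is the same function (`SmoothSquare.sobolevIntegrand_eq`,
`SmoothSquare.cov_srv`).

For the raising, let `F_u(a, τ)` be the field obtained from `u` at the origin by transport along
`c(·, 0)`, then along `c(a, ·)` (`frame`). Transport is adjoint to its inverse, so `⟨q̃, u⟩ = ⟨q,
F_u⟩`, with derivative `⟨∇_s q, F_u⟩ + ⟨q, ∇_s F_u⟩` in `s`. Inner products of these fields are
constant, so `∇_s` acts skew-symmetrically on them and the last term is `-⟨Ω, u⟩`. Hence `q̃_s + Ω`
is the isometric transport of `∇_s q` (`SmoothSquare.hasDerivWithinAt_toOrigin`).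

The field `F_u` is parallel in `τ`, so `∇_τ ∇_a F_u = 𝓡(c_τ, c_a) F_u`, and `∇_a F_u` vanishes at `τ
= 0`. Transporting back to `τ = 0` and integrating gives the formula for `Ω`
(`SmoothSquare.holonomy_integral`).

The analytic burden is that `F_u` is differentiable in `a` and that `∇_a F_u` is differentiable in
`τ`. In a chart this is parameter dependence of a linear differential equation on a short interval
(`exists_hasDerivWithinAt_parameter`), and differentiability then propagates along the curve
(`SmoothSquare.fieldDiff_family`). Passing between charts rests on the transformation law
`christoffelL_transition`. -/

/-- Coordinates, in the chart at `x₀`, of a tangent vector at `p`. -/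
def coordMap (x₀ p : M) : E →L[ℝ] E := tangentCoordChange 𝓘(ℝ, E) p x₀ p

/-- The tangent vector at `p` with given coordinates in the chart at `x₀`. -/
def coordInv (x₀ p : M) : E →L[ℝ] E := tangentCoordChange 𝓘(ℝ, E) x₀ p p

/-- The Riemannian metric at `p`, as a bilinear form on the model space. -/
def innerE (g : RMetric E M) (p : M) : E →L[ℝ] E →L[ℝ] ℝ := g.inner p

theorem innerE_symm (g : RMetric E M) (p : M) (u v : E) : innerE g p u v = innerE g p v u :=
  g.symm p u v

theorem innerE_pos (g : RMetric E M) (p : M) {u : E} (hu : u ≠ 0) : 0 < innerE g p u u :=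
  g.pos p u hu

theorem innerE_self_nonneg (g : RMetric E M) (p : M) (u : E) : 0 ≤ innerE g p u u := by
  by_cases hu : u = 0
  · simp [hu]
  · exact (innerE_pos g p hu).le

theorem coordInv_coordMap {x₀ p : M} (hp : p ∈ (extChartAt 𝓘(ℝ, E) x₀).source) (v : E) :
    coordInv x₀ p (coordMap x₀ p v) = v := by
  unfold coordInv coordMap
  rw [tangentCoordChange_comp ⟨⟨mem_extChartAt_source p, hp⟩, mem_extChartAt_source p⟩,
    tangentCoordChange_self (mem_extChartAt_source p)]

theorem coordMap_coordInv {x₀ p : M} (hp : p ∈ (extChartAt 𝓘(ℝ, E) x₀).source) (v : E) :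
    coordMap x₀ p (coordInv x₀ p v) = v := by
  unfold coordInv coordMap
  rw [tangentCoordChange_comp ⟨⟨hp, mem_extChartAt_source p⟩, hp⟩, tangentCoordChange_self hp]

theorem coordMap_self (p : M) (v : E) : coordMap p p v = v :=
  tangentCoordChange_self (mem_extChartAt_source p)

theorem coordMap_inj {x₀ p : M} (hp : p ∈ (extChartAt 𝓘(ℝ, E) x₀).source) {u v : E}
    (h : coordMap x₀ p u = coordMap x₀ p v) : u = v := by
  rw [← coordInv_coordMap hp u, h, coordInv_coordMap hp]

theorem chartMetric_eq (g : RMetric E M) {x₀ p : M}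
    (hp : p ∈ (extChartAt 𝓘(ℝ, E) x₀).source) (u v : E) :
    chartMetric g x₀ (extChartAt 𝓘(ℝ, E) x₀ p) u v =
      innerE g p (coordInv x₀ p u) (coordInv x₀ p v) := by
  have h : (extChartAt 𝓘(ℝ, E) x₀).symm (extChartAt 𝓘(ℝ, E) x₀ p) = p :=
    (extChartAt 𝓘(ℝ, E) x₀).left_inv hp
  -- The base point of `chartMetric` equals `p` only propositionally and occurs in dependent types;
  -- generalizing it to `q` allows substitution.
  have : ∀ q : M, q = p → ∀ u' v' : E,
      (innerE g q).bilinearComp (tangentCoordChange 𝓘(ℝ, E) x₀ q q)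
      (tangentCoordChange 𝓘(ℝ, E) x₀ q q) u' v' =
        innerE g p (coordInv x₀ p u') (coordInv x₀ p v') := by
    rintro q rfl u' v'; rfl
  exact this _ h _ _

theorem chartMetric_coordMap (g : RMetric E M) {x₀ p : M}
    (hp : p ∈ (extChartAt 𝓘(ℝ, E) x₀).source) (u v : E) :
    chartMetric g x₀ (extChartAt 𝓘(ℝ, E) x₀ p) (coordMap x₀ p u) (coordMap x₀ p v) =
      innerE g p u v := by
  rw [chartMetric_eq g hp, coordInv_coordMap hp, coordInv_coordMap hp]

/-- In finite dimension, smoothness can be tested on fixed arguments. Vectors with constant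
coordinates are smooth local sections of the tangent bundle, so pairing them with the metric gives a
smooth function on the chart domain. -/
theorem contDiffOn_chartMetric [FiniteDimensional ℝ E] (g : RMetric E M) (x₀ : M) :
    ContDiffOn ℝ ∞ (chartMetric g x₀) (extChartAt 𝓘(ℝ, E) x₀).target := by
  rw [contDiffOn_clm_apply]
  intro u
  rw [contDiffOn_clm_apply]
  intro v
  rw [← contMDiffOn_iff_contDiffOn]
  have hs : ∀ w : E, ContMDiffOn 𝓘(ℝ, E) 𝓘(ℝ, E).tangent ∞
      (fun m : M => (⟨m, coordInv (E := E) x₀ m w⟩ : TangentBundle 𝓘(ℝ, E) M))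
      (extChartAt 𝓘(ℝ, E) x₀).source := by
    intro w
    have h1 := (trivializationAt E (TangentSpace 𝓘(ℝ, E) : M → Type _) x₀).contMDiffOn_symm
      (IB := 𝓘(ℝ, E)) (n := ∞)
    have h2 : ContMDiffOn 𝓘(ℝ, E) (𝓘(ℝ, E).prod 𝓘(ℝ, E)) ∞ (fun m : M => (m, w))
      (extChartAt 𝓘(ℝ, E) x₀).source := contMDiffOn_id.prodMk contMDiffOn_const
    refine (h1.comp h2 ?_).congr ?_
    · intro m hm
      simpa using hm
    · intro m hm
      rfl
  have hg : ContMDiffOn 𝓘(ℝ, E) 𝓘(ℝ, ℝ) ∞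
      (fun m : M => innerE g m (coordInv x₀ m u) (coordInv x₀ m v))
      (extChartAt 𝓘(ℝ, E) x₀).source := by
    have h : ContMDiffOn 𝓘(ℝ, E) (𝓘(ℝ, E).prod 𝓘(ℝ, ℝ)) ∞
        (fun m : M => Bundle.TotalSpace.mk' ℝ (E := Bundle.Trivial M ℝ) m
          (innerE g m (coordInv x₀ m u) (coordInv x₀ m v)))
        (extChartAt 𝓘(ℝ, E) x₀).source :=
      ContMDiffOn.clm_bundle_apply₂ (F₁ := E) (F₂ := E)
        (E₁ := fun x : M => TangentSpace 𝓘(ℝ, E) x) (E₂ := fun x : M => TangentSpace 𝓘(ℝ, E) x) g.contMDiff.contMDiffOn (hs u) (hs v)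
    intro m hm
    exact (Bundle.contMDiffWithinAt_totalSpace.1 (h m hm)).2
  refine (hg.comp (contMDiffOn_extChartAt_symm x₀)
    fun _ hy => (extChartAt 𝓘(ℝ, E) x₀).map_target hy).congr ?_
  intro y hy
  have := chartMetric_eq g ((extChartAt 𝓘(ℝ, E) x₀).map_target hy) u v
  rwa [(extChartAt 𝓘(ℝ, E) x₀).right_inv hy] at this

end

/-! ### Christoffel symbols and change of charts -/

section


variable {E : Type*} [NormedAddCommGroup E] [NormedSpace ℝ E]
  {M : Type*} [TopologicalSpace M] [ChartedSpace E M] [IsManifold 𝓘(ℝ, E) ∞ M]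

variable [FiniteDimensional ℝ E]

theorem two_le_infty : (2 : WithTop ℕ∞) ≤ ((⊤ : ℕ∞) : WithTop ℕ∞) :=
  WithTop.coe_le_coe.2 (le_top : (2 : ℕ∞) ≤ ⊤)

theorem contDiffAt_chartMetric (g : RMetric E M) (x₀ : M) {y : E}
    (hy : y ∈ (extChartAt 𝓘(ℝ, E) x₀).target) : ContDiffAt ℝ ∞ (chartMetric g x₀) y :=
  (contDiffOn_chartMetric g x₀).contDiffAt ((isOpen_extChartAt_target x₀).mem_nhds hy)

theorem chartMetric_symm (g : RMetric E M) (x₀ : M) {y : E}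
    (hy : y ∈ (extChartAt 𝓘(ℝ, E) x₀).target) (u v : E) :
    chartMetric g x₀ y u v = chartMetric g x₀ y v u := by
  have h := (extChartAt 𝓘(ℝ, E) x₀).map_target hy
  rw [← (extChartAt 𝓘(ℝ, E) x₀).right_inv hy, chartMetric_eq g h, chartMetric_eq g h, innerE_symm]

theorem chartMetric_pos (g : RMetric E M) (x₀ : M) {y : E}
    (hy : y ∈ (extChartAt 𝓘(ℝ, E) x₀).target) {u : E} (hu : u ≠ 0) :
    0 < chartMetric g x₀ y u u := by
  have h := (extChartAt 𝓘(ℝ, E) x₀).map_target hy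
  rw [← (extChartAt 𝓘(ℝ, E) x₀).right_inv hy, chartMetric_eq g h]
  refine innerE_pos g _ fun h0 => hu ?_
  rw [← coordMap_coordInv h u, h0, map_zero]

/-- A positive definite bilinear form on a finite-dimensional space is invertible as a map to the
dual. -/
theorem isInvertible_of_pos {B : E →L[ℝ] E →L[ℝ] ℝ} (hB : ∀ u, u ≠ 0 → 0 < B u u) :
    B.IsInvertible := by
  have hinj : Function.Injective (B : E →ₗ[ℝ] (E →L[ℝ] ℝ)) := by
    rw [← LinearMap.ker_eq_bot, LinearMap.ker_eq_bot']
    intro u hu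
    by_contra h
    have := hB u h
    have h2 : B u = 0 := hu
    simp [h2] at this
  have hfin : Module.finrank ℝ E = Module.finrank ℝ (E →L[ℝ] ℝ) := by
    rw [← (LinearMap.toContinuousLinearMap (𝕜 := ℝ) (E := E) (F' := ℝ)).finrank_eq]
    exact (Subspace.dual_finrank_eq (K := ℝ) (V := E)).symm
  refine ⟨(LinearEquiv.ofInjectiveOfFinrankEq (B : E →ₗ[ℝ] (E →L[ℝ] ℝ)) hinj
    hfin).toContinuousLinearEquiv, ?_⟩
  ext u v
  rfl

theorem isInvertible_chartMetric (g : RMetric E M) (x₀ : M) {y : E}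
    (hy : y ∈ (extChartAt 𝓘(ℝ, E) x₀).target) : (chartMetric g x₀ y).IsInvertible :=
  isInvertible_of_pos fun _ hu => chartMetric_pos g x₀ hy hu

/-- The Christoffel symbols as a continuous bilinear map. -/
def christoffelL (g : RMetric E M) (x₀ : M) (y : E) : E →L[ℝ] E →L[ℝ] E :=
  let Dg : E →L[ℝ] E →L[ℝ] E →L[ℝ] ℝ := fderiv ℝ (chartMetric g x₀) y
  (1 / 2 : ℝ) • (ContinuousLinearMap.compL ℝ E (E →L[ℝ] ℝ) E (chartMetric g x₀ y).inverse).comp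
    (Dg + Dg.flip - ((ContinuousLinearMap.flipₗᵢ ℝ E E ℝ).toContinuousLinearEquiv :
      (E →L[ℝ] E →L[ℝ] ℝ) →L[ℝ] (E →L[ℝ] E →L[ℝ] ℝ)).comp Dg.flip)

theorem christoffel_eq (g : RMetric E M) (x₀ : M) (y u v : E) :
    christoffel g x₀ y u v = christoffelL g x₀ y u v := by
  simp [christoffel, christoffelL]

/-- Only the metric, its derivative and its inverse enter, and inversion is smooth at invertible
operators. -/
theorem contDiffAt_christoffelL (g : RMetric E M) (x₀ : M) {y : E}
    (hy : y ∈ (extChartAt 𝓘(ℝ, E) x₀).target) : ContDiffAt ℝ ∞ (christoffelL g x₀) y := by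
  have hg := contDiffAt_chartMetric g x₀ hy
  have hD : ContDiffAt ℝ ∞ (fderiv ℝ (chartMetric g x₀)) y := hg.fderiv_right (by simp)
  have hi : ContDiffAt ℝ ∞ (fun y => (chartMetric g x₀ y).inverse) y :=
    ((isInvertible_chartMetric g x₀ hy).contDiffAt_map_inverse).comp y hg
  have hf : ContDiffAt ℝ ∞ (fun y => (fderiv ℝ (chartMetric g x₀) y).flip) y :=
    (ContinuousLinearMap.flipₗᵢ ℝ E E (E →L[ℝ] ℝ)).contDiff.contDiffAt.comp y hD
  have h1 : ContDiffAt ℝ ∞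
      (fun y => ContinuousLinearMap.compL ℝ E (E →L[ℝ] ℝ) E (chartMetric g x₀ y).inverse) y :=
    (ContinuousLinearMap.compL ℝ E (E →L[ℝ] ℝ) E).contDiff.contDiffAt.comp y hi
  have h2 : ContDiffAt ℝ ∞ (fun y => ((ContinuousLinearMap.flipₗᵢ ℝ E E ℝ).toContinuousLinearEquiv :
      (E →L[ℝ] E →L[ℝ] ℝ) →L[ℝ] (E →L[ℝ] E →L[ℝ] ℝ)).comp (fderiv ℝ (chartMetric g x₀) y).flip) y :=
    (contDiffAt_const (c := ((ContinuousLinearMap.flipₗᵢ ℝ E E ℝ).toContinuousLinearEquiv :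
      (E →L[ℝ] E →L[ℝ] ℝ) →L[ℝ] (E →L[ℝ] E →L[ℝ] ℝ)))).clm_comp hf
  exact (contDiffAt_const (c := (1 / 2 : ℝ))).smul (h1.clm_comp ((hD.add hf).sub h2))

theorem fderiv_chartMetric_symm (g : RMetric E M) (x₀ : M) {y : E}
    (hy : y ∈ (extChartAt 𝓘(ℝ, E) x₀).target) (w u v : E) :
    fderiv ℝ (chartMetric g x₀) y w u v = fderiv ℝ (chartMetric g x₀) y w v u := by
  have hg := ((contDiffAt_chartMetric g x₀ hy).differentiableAt (by simp)).hasFDerivAt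
  have h1 : ∀ u v, HasFDerivAt (fun y => chartMetric g x₀ y u v)
      ((fderiv ℝ (chartMetric g x₀) y).flip u |>.flip v) y := by
    intro u v
    have := (hg.clm_apply (hasFDerivAt_const u y)).clm_apply (hasFDerivAt_const v y)
    convert! this using 1
    ext w
    simp
  have h2 : (fun y => chartMetric g x₀ y u v) =ᶠ[𝓝 y] fun y => chartMetric g x₀ y v u := by
    filter_upwards [(isOpen_extChartAt_target x₀).mem_nhds hy] with z hz
    exact chartMetric_symm g x₀ hz u v
  have := (h1 u v).unique ((h1 v u).congr_of_eventuallyEq h2)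
  simpa using DFunLike.congr_fun this w

/-- The Koszul formula. It characterizes the symbols because the metric is nondegenerate;
torsion-freeness, compatibility and the change of charts are all read off from it. -/
theorem chartMetric_christoffelL (g : RMetric E M) (x₀ : M) {y : E}
    (hy : y ∈ (extChartAt 𝓘(ℝ, E) x₀).target) (u v z : E) :
    chartMetric g x₀ y (christoffelL g x₀ y u v) z =
      1 / 2 * (fderiv ℝ (chartMetric g x₀) y u v z + fderiv ℝ (chartMetric g x₀) y v u z
        - fderiv ℝ (chartMetric g x₀) y z u v) := by
  rw [← christoffel_eq]
  unfold christoffel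
  simp only [map_smul]
  rw [(isInvertible_chartMetric g x₀ hy).self_apply_inverse]
  simp

theorem christoffelL_symm (g : RMetric E M) (x₀ : M) {y : E}
    (hy : y ∈ (extChartAt 𝓘(ℝ, E) x₀).target) (u v : E) :
    christoffelL g x₀ y u v = christoffelL g x₀ y v u := by
  apply (isInvertible_chartMetric g x₀ hy).injective
  ext z
  rw [chartMetric_christoffelL g x₀ hy, chartMetric_christoffelL g x₀ hy,
    fderiv_chartMetric_symm g x₀ hy z u v]
  ring

theorem christoffelL_compatible (g : RMetric E M) (x₀ : M) {y : E}
    (hy : y ∈ (extChartAt 𝓘(ℝ, E) x₀).target) (w u v : E) :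
    fderiv ℝ (chartMetric g x₀) y w u v = chartMetric g x₀ y (christoffelL g x₀ y w u) v
      + chartMetric g x₀ y u (christoffelL g x₀ y w v) := by
  rw [chartMetric_symm g x₀ hy u, chartMetric_christoffelL g x₀ hy,
    chartMetric_christoffelL g x₀ hy, fderiv_chartMetric_symm g x₀ hy w v u,
    fderiv_chartMetric_symm g x₀ hy v w u, fderiv_chartMetric_symm g x₀ hy u w v]
  ring

/-- The change of coordinates between two charts. -/
def transition (x₀ x₁ : M) : E → E := extChartAt 𝓘(ℝ, E) x₁ ∘ (extChartAt 𝓘(ℝ, E) x₀).symm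

omit [FiniteDimensional ℝ E] in
theorem contDiffAt_transition {x₀ x₁ p : M} (h₀ : p ∈ (extChartAt 𝓘(ℝ, E) x₀).source)
    (h₁ : p ∈ (extChartAt 𝓘(ℝ, E) x₁).source) :
    ContDiffAt ℝ ∞ (transition (E := E) x₀ x₁) (extChartAt 𝓘(ℝ, E) x₀ p) := by
  have h : extChartAt 𝓘(ℝ, E) x₀ p ∈
      ((extChartAt 𝓘(ℝ, E) x₀).symm ≫ extChartAt 𝓘(ℝ, E) x₁).source := by
    rw [PartialEquiv.trans_source'', PartialEquiv.symm_symm, PartialEquiv.symm_target]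
    exact mem_image_of_mem _ ⟨h₀, h₁⟩
  have := contDiffWithinAt_ext_coord_change (n := ∞) x₁ x₀ h
  rw [modelWithCornersSelf_coe, range_id, contDiffWithinAt_univ] at this
  exact this

omit [FiniteDimensional ℝ E] in
theorem fderiv_transition (x₀ x₁ p : M) :
    fderiv ℝ (transition (E := E) x₀ x₁) (extChartAt 𝓘(ℝ, E) x₀ p) =
      tangentCoordChange 𝓘(ℝ, E) x₀ x₁ p := by
  rw [tangentCoordChange_def]
  simp [transition, fderivWithin_univ]

omit [FiniteDimensional ℝ E] in
theorem fderiv_transition_coordMap {x₀ x₁ p : M} (h₀ : p ∈ (extChartAt 𝓘(ℝ, E) x₀).source)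
    (h₁ : p ∈ (extChartAt 𝓘(ℝ, E) x₁).source) (v : E) :
    fderiv ℝ (transition (E := E) x₀ x₁) (extChartAt 𝓘(ℝ, E) x₀ p) (coordMap x₀ p v) =
      coordMap x₁ p v := by
  rw [fderiv_transition]
  exact tangentCoordChange_comp ⟨⟨mem_extChartAt_source p, h₀⟩, h₁⟩

omit [FiniteDimensional ℝ E] in
theorem transition_apply {x₀ p : M} (x₁ : M) (h₀ : p ∈ (extChartAt 𝓘(ℝ, E) x₀).source) :
    transition (E := E) x₀ x₁ (extChartAt 𝓘(ℝ, E) x₀ p) = extChartAt 𝓘(ℝ, E) x₁ p := by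
  rw [transition, Function.comp_apply, (extChartAt 𝓘(ℝ, E) x₀).left_inv h₀]

theorem chartMetric_transition (g : RMetric E M) {x₀ x₁ p : M}
    (h₀ : p ∈ (extChartAt 𝓘(ℝ, E) x₀).source) (h₁ : p ∈ (extChartAt 𝓘(ℝ, E) x₁).source) (u v : E) :
    chartMetric g x₀ (extChartAt 𝓘(ℝ, E) x₀ p) u v =
      chartMetric g x₁ (transition x₀ x₁ (extChartAt 𝓘(ℝ, E) x₀ p))
        (fderiv ℝ (transition x₀ x₁) (extChartAt 𝓘(ℝ, E) x₀ p) u)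
        (fderiv ℝ (transition x₀ x₁) (extChartAt 𝓘(ℝ, E) x₀ p) v) := by
  rw [transition_apply x₁ h₀, ← coordMap_coordInv h₀ u, ← coordMap_coordInv h₀ v,
    fderiv_transition_coordMap h₀ h₁, fderiv_transition_coordMap h₀ h₁,
    chartMetric_coordMap g h₀, chartMetric_coordMap g h₁]

/-- Transformation law of the Christoffel symbols under a change of charts. -/
theorem christoffelL_transition (g : RMetric E M) {x₀ x₁ p : M}
    (h₀ : p ∈ (extChartAt 𝓘(ℝ, E) x₀).source) (h₁ : p ∈ (extChartAt 𝓘(ℝ, E) x₁).source) (u v : E) :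
    fderiv ℝ (transition x₀ x₁) (extChartAt 𝓘(ℝ, E) x₀ p)
        (christoffelL g x₀ (extChartAt 𝓘(ℝ, E) x₀ p) u v) =
      christoffelL g x₁ (extChartAt 𝓘(ℝ, E) x₁ p)
        (fderiv ℝ (transition x₀ x₁) (extChartAt 𝓘(ℝ, E) x₀ p) u)
        (fderiv ℝ (transition x₀ x₁) (extChartAt 𝓘(ℝ, E) x₀ p) v)
      + fderiv ℝ (fderiv ℝ (transition x₀ x₁)) (extChartAt 𝓘(ℝ, E) x₀ p) u v := by
  set φ := transition (E := E) x₀ x₁ with hφdef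
  set y := extChartAt 𝓘(ℝ, E) x₀ p with hy
  have hy₀ : y ∈ (extChartAt 𝓘(ℝ, E) x₀).target := (extChartAt 𝓘(ℝ, E) x₀).map_source h₀
  have hy₁ : φ y ∈ (extChartAt 𝓘(ℝ, E) x₁).target := by
    rw [hφdef, hy, transition_apply x₁ h₀]
    exact (extChartAt 𝓘(ℝ, E) x₁).map_source h₁
  have hφ : ContDiffAt ℝ ∞ φ y := contDiffAt_transition h₀ h₁
  have hDφ : ContDiffAt ℝ ∞ (fderiv ℝ φ) y := hφ.fderiv_right (by simp)
  have hsymm : ∀ u v, fderiv ℝ (fderiv ℝ φ) y u v = fderiv ℝ (fderiv ℝ φ) y v u :=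
    fun u v => (hφ.isSymmSndFDerivAt (by rw [minSmoothness_of_isRCLikeNormedField]; exact two_le_infty)).eq u v
  have hφ' := (hφ.differentiableAt (by simp)).hasFDerivAt
  have hDφ' := (hDφ.differentiableAt (by simp)).hasFDerivAt
  have hg₀ := ((contDiffAt_chartMetric g x₀ hy₀).differentiableAt (by simp)).hasFDerivAt
  have hg₁ := ((contDiffAt_chartMetric g x₁ hy₁).differentiableAt (by simp)).hasFDerivAt
  -- the derivative of the transformation law of the metric
  have key : ∀ w a b : E, fderiv ℝ (chartMetric g x₀) y w a b =
      fderiv ℝ (chartMetric g x₁) (φ y) (fderiv ℝ φ y w) (fderiv ℝ φ y a) (fderiv ℝ φ y b)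
      + chartMetric g x₁ (φ y) (fderiv ℝ (fderiv ℝ φ) y w a) (fderiv ℝ φ y b)
      + chartMetric g x₁ (φ y) (fderiv ℝ φ y a) (fderiv ℝ (fderiv ℝ φ) y w b) := by
    intro w a b
    have h1 := (hg₀.clm_apply (hasFDerivAt_const a y)).clm_apply (hasFDerivAt_const b y)
    have h2 := ((hg₁.comp y hφ').clm_apply (hDφ'.clm_apply (hasFDerivAt_const a y))).clm_apply
      (hDφ'.clm_apply (hasFDerivAt_const b y))
    have heq : (fun y => chartMetric g x₀ y a b) =ᶠ[𝓝 y]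
        fun y => chartMetric g x₁ (φ y) (fderiv ℝ φ y a) (fderiv ℝ φ y b) := by
      have hnh : ∀ᶠ y' in 𝓝 y, y' ∈ (extChartAt 𝓘(ℝ, E) x₀).target ∧
          (extChartAt 𝓘(ℝ, E) x₀).symm y' ∈ (extChartAt 𝓘(ℝ, E) x₁).source := by
        refine Filter.Eventually.and ((isOpen_extChartAt_target x₀).mem_nhds hy₀) ?_
        refine (continuousAt_extChartAt_symm' h₀).eventually ?_
        rw [(extChartAt 𝓘(ℝ, E) x₀).left_inv h₀]
        exact (isOpen_extChartAt_source x₁).mem_nhds h₁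
      filter_upwards [hnh] with y' hy'
      have := chartMetric_transition g ((extChartAt 𝓘(ℝ, E) x₀).map_target hy'.1) hy'.2 a b
      rwa [(extChartAt 𝓘(ℝ, E) x₀).right_inv hy'.1] at this
    have := h1.unique (h2.congr_of_eventuallyEq heq)
    have := DFunLike.congr_fun this w
    simp at this
    rw [this]
    ring
  rw [← transition_apply x₁ h₀, ← hφdef, ← hy]
  apply (isInvertible_chartMetric g x₁ hy₁).injective
  -- Test vectors may be taken in the image of the differential of `φ`, so that both sides can be
  -- pulled back to the first chart.
  have hsurj : ∀ z : E, ∃ z', fderiv ℝ φ y z' = z := fun z =>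
    ⟨coordMap x₀ p (coordInv x₁ p z), by
      rw [fderiv_transition_coordMap h₀ h₁, coordMap_coordInv h₁]⟩
  ext z
  obtain ⟨z, rfl⟩ := hsurj z
  have e1 := chartMetric_transition g h₀ h₁ (christoffelL g x₀ y u v) z
  rw [← hy, ← hφdef] at e1
  -- The three uses of `key` produce six terms in the second derivative of `φ`. Its symmetry cancels
  -- four of them; the other two are equal and absorb the factor 1/2.
  rw [← e1, map_add, add_apply, chartMetric_christoffelL g x₀ hy₀,
    chartMetric_christoffelL g x₁ hy₁, key, key, key, hsymm z u, hsymm z v, hsymm v u,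
    chartMetric_symm g x₁ hy₁ (fderiv ℝ φ y v) (fderiv ℝ (fderiv ℝ φ) y u z)]
  ring

end

/-! ### Covariant derivatives in charts -/

section


variable {E : Type*} [NormedAddCommGroup E] [NormedSpace ℝ E]
  {M : Type*} [TopologicalSpace M] [ChartedSpace E M] [IsManifold 𝓘(ℝ, E) ∞ M]

/-- The velocity of a curve, as an element of the model space. -/
def vel (γ : ℝ → M) (t : ℝ) : E := velocity (E := E) γ t

/-- A vector field along a curve, given with values in the model space, read in a chart. -/
def coordF (γ : ℝ → M) (V : ℝ → E) (x₀ : M) (t : ℝ) : E := coordMap x₀ (γ t) (V t)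

/-- Differentiability of a vector field along a curve, given with values in the model space. -/
def FieldDiff (γ : ℝ → M) (V : ℝ → E) (t : ℝ) : Prop := FieldDifferentiableAt (E := E) γ V t

/-- The covariant derivative of a vector field given with values in the model space. -/
def cov (g : RMetric E M) (γ : ℝ → M) (V : ℝ → E) (t : ℝ) : E := covDeriv (E := E) g γ V t

variable [FiniteDimensional ℝ E]

/-- A smooth map read in a chart is smooth. -/
theorem contDiffWithinAt_extChartAt_comp {W : Type*} [NormedAddCommGroup W] [NormedSpace ℝ W]
    {f : W → M} {s : Set W} {z : W} {x₀ : M} (hf : ContMDiffWithinAt 𝓘(ℝ, W) 𝓘(ℝ, E) ∞ f s z)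
    (hz : f z ∈ (extChartAt 𝓘(ℝ, E) x₀).source) :
    ContDiffWithinAt ℝ ∞ (fun w => extChartAt 𝓘(ℝ, E) x₀ (f w)) s z := by
  rw [← contMDiffWithinAt_iff_contDiffWithinAt]
  exact (contMDiffAt_extChartAt' (by simpa using hz)).comp_contMDiffWithinAt z hf

theorem hasDerivWithinAt_extChartAt_self {γ : ℝ → M} {t : ℝ}
    (hγ : MDifferentiableWithinAt 𝓘(ℝ, ℝ) 𝓘(ℝ, E) γ (Icc 0 1) t) :
    HasDerivWithinAt (fun τ => extChartAt 𝓘(ℝ, E) (γ t) (γ τ)) (vel γ t : E) (Icc 0 1) t := by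
  have h := hγ.hasMFDerivWithinAt.2
  simp only [writtenInExtChartAt, mfld_simps] at h
  let L : ℝ →L[ℝ] E := mfderivWithin 𝓘(ℝ, ℝ) 𝓘(ℝ, E) γ (Icc 0 1) t
  have h' : HasFDerivWithinAt (fun τ => extChartAt 𝓘(ℝ, E) (γ t) (γ τ)) L (Icc 0 1) t := h
  exact h'.hasDerivWithinAt

theorem eventually_mem_source {W : Type*} [TopologicalSpace W] {f : W → M} {s : Set W} {z : W}
    {x₀ : M} (hf : ContinuousWithinAt f s z) (hz : f z ∈ (extChartAt 𝓘(ℝ, E) x₀).source) :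
    ∀ᶠ w in 𝓝[s] z, f w ∈ (extChartAt 𝓘(ℝ, E) x₀).source :=
  hf.eventually ((isOpen_extChartAt_source x₀).mem_nhds hz)

/-- The velocity of a curve, in an arbitrary chart. -/
theorem hasDerivWithinAt_extChartAt {γ : ℝ → M} {t : ℝ} {x₀ : M} (ht : t ∈ Icc (0 : ℝ) 1)
    (hγ : MDifferentiableWithinAt 𝓘(ℝ, ℝ) 𝓘(ℝ, E) γ (Icc 0 1) t)
    (hx : γ t ∈ (extChartAt 𝓘(ℝ, E) x₀).source) :
    HasDerivWithinAt (fun τ => extChartAt 𝓘(ℝ, E) x₀ (γ τ))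
      (coordMap x₀ (γ t) (vel γ t)) (Icc 0 1) t := by
  have hs := mem_extChartAt_source (I := 𝓘(ℝ, E)) (γ t)
  have h1 := hasDerivWithinAt_extChartAt_self hγ
  have h2 := ((contDiffAt_transition hs hx).differentiableAt (by simp)).hasFDerivAt
  have h3 := h2.comp_hasDerivWithinAt t h1
  have h4 : fderiv ℝ (transition (γ t) x₀) (extChartAt 𝓘(ℝ, E) (γ t) (γ t)) (vel γ t) =
      coordMap x₀ (γ t) (vel γ t) := by
    conv_lhs => rw [← coordMap_self (E := E) (γ t) (vel γ t)]
    exact fderiv_transition_coordMap hs hx _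
  rw [h4] at h3
  refine h3.congr_of_eventuallyEq_of_mem ?_ ht
  filter_upwards [eventually_mem_source hγ.continuousWithinAt hs] with τ hτ
  rw [Function.comp_apply, transition_apply x₀ hτ]

/-- Differentiability into the tangent bundle splits into that of the base curve, which is given,
and that of the fibre coordinate. -/
theorem fieldDiff_iff {γ : ℝ → M} {V : ℝ → E} {t : ℝ}
    (hγ : MDifferentiableWithinAt 𝓘(ℝ, ℝ) 𝓘(ℝ, E) γ (Icc 0 1) t) :
    FieldDiff γ V t ↔ DifferentiableWithinAt ℝ (coordF γ V (γ t)) (Icc 0 1) t := by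
  rw [← mdifferentiableWithinAt_iff_differentiableWithinAt]
  have : FieldDiff γ V t ↔ _ := mdifferentiableWithinAt_totalSpace 𝓘(ℝ, E)
    (fun τ => (⟨γ τ, V τ⟩ : TangentBundle 𝓘(ℝ, E) M)) (s := Icc 0 1) (x₀ := t)
  rw [this]
  exact and_iff_right hγ

/-- Change of charts for the derivative of a vector field along a curve. -/
theorem hasDerivWithinAt_coordF_change {γ : ℝ → M} {V : ℝ → E} {t : ℝ} {x₀ x₁ : M} {v' : E}
    (ht : t ∈ Icc (0 : ℝ) 1) (hγ : MDifferentiableWithinAt 𝓘(ℝ, ℝ) 𝓘(ℝ, E) γ (Icc 0 1) t)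
    (h₀ : γ t ∈ (extChartAt 𝓘(ℝ, E) x₀).source) (h₁ : γ t ∈ (extChartAt 𝓘(ℝ, E) x₁).source)
    (hV : HasDerivWithinAt (coordF γ V x₀) v' (Icc 0 1) t) :
    HasDerivWithinAt (coordF γ V x₁)
      (fderiv ℝ (fderiv ℝ (transition x₀ x₁)) (extChartAt 𝓘(ℝ, E) x₀ (γ t))
          (coordMap x₀ (γ t) (vel γ t)) (coordMap x₀ (γ t) (V t)) +
        fderiv ℝ (transition x₀ x₁) (extChartAt 𝓘(ℝ, E) x₀ (γ t)) v') (Icc 0 1) t := by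
  have hφ := contDiffAt_transition h₀ h₁
  have hDφ : ContDiffAt ℝ ∞ (fderiv ℝ (transition (E := E) x₀ x₁)) _ := hφ.fderiv_right (by simp)
  have hD := (hDφ.differentiableAt (by simp)).hasFDerivAt.comp_hasDerivWithinAt t
    (hasDerivWithinAt_extChartAt ht hγ h₀)
  refine (hD.clm_apply hV).congr_of_eventuallyEq_of_mem ?_ ht
  filter_upwards [eventually_mem_source hγ.continuousWithinAt h₀,
    eventually_mem_source hγ.continuousWithinAt h₁] with τ hτ₀ hτ₁
  exact (fderiv_transition_coordMap hτ₀ hτ₁ (V τ)).symm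

theorem cov_eq (g : RMetric E M) (γ : ℝ → M) (V : ℝ → E) (t : ℝ) :
    cov g γ V t = derivWithin (coordF γ V (γ t)) (Icc 0 1) t +
      christoffelL g (γ t) (extChartAt 𝓘(ℝ, E) (γ t) (γ t)) (vel γ t) (V t) := by
  rw [← christoffel_eq]
  rfl

theorem uniqueDiffWithinAt_unitIcc {t : ℝ} (ht : t ∈ Icc (0 : ℝ) 1) :
    UniqueDiffWithinAt ℝ (Icc (0 : ℝ) 1) t :=
  uniqueDiffOn_Icc zero_lt_one t ht

/-- The covariant derivative along a curve, in an arbitrary chart. -/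
theorem cov_coord (g : RMetric E M) {γ : ℝ → M} {V : ℝ → E} {t : ℝ} {x₀ : M} {v' : E}
    (ht : t ∈ Icc (0 : ℝ) 1) (hγ : MDifferentiableWithinAt 𝓘(ℝ, ℝ) 𝓘(ℝ, E) γ (Icc 0 1) t)
    (h₀ : γ t ∈ (extChartAt 𝓘(ℝ, E) x₀).source)
    (hV : HasDerivWithinAt (coordF γ V x₀) v' (Icc 0 1) t) :
    FieldDiff γ V t ∧ coordMap x₀ (γ t) (cov g γ V t) =
      v' + christoffelL g x₀ (extChartAt 𝓘(ℝ, E) x₀ (γ t)) (coordMap x₀ (γ t) (vel γ t))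
        (coordMap x₀ (γ t) (V t)) := by
  have hs := mem_extChartAt_source (I := 𝓘(ℝ, E)) (γ t)
  have h := hasDerivWithinAt_coordF_change ht hγ h₀ hs hV
  refine ⟨(fieldDiff_iff hγ).2 h.differentiableWithinAt, ?_⟩
  -- `cov` is defined in the chart at `γ t`, so the identity is compared there; injectivity of the
  -- differential makes this sufficient.
  have hinj : ∀ a b : E, fderiv ℝ (transition x₀ (γ t)) (extChartAt 𝓘(ℝ, E) x₀ (γ t)) a =
      fderiv ℝ (transition x₀ (γ t)) (extChartAt 𝓘(ℝ, E) x₀ (γ t)) b → a = b := by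
    intro a b hab
    rw [← coordMap_coordInv h₀ a, ← coordMap_coordInv h₀ b, fderiv_transition_coordMap h₀ hs,
      fderiv_transition_coordMap h₀ hs, coordMap_self, coordMap_self] at hab
    rw [← coordMap_coordInv h₀ a, ← coordMap_coordInv h₀ b, hab]
  apply hinj
  -- The second derivative of the transition map appears on both sides: once from differentiating
  -- the transformed field, once from the law for the Christoffel symbols.
  rw [fderiv_transition_coordMap h₀ hs, coordMap_self, cov_eq,
    h.derivWithin (uniqueDiffWithinAt_unitIcc ht), map_add, christoffelL_transition g h₀ hs,
    fderiv_transition_coordMap h₀ hs, fderiv_transition_coordMap h₀ hs, coordMap_self,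
    coordMap_self]
  abel

/-- This is `cov_coord` solved for the coordinate derivative, the form needed to apply product rules
in a chart. -/
theorem FieldDiff.hasDerivWithinAt (g : RMetric E M) {γ : ℝ → M} {V : ℝ → E} {t : ℝ}
    {x₀ : M} (ht : t ∈ Icc (0 : ℝ) 1)
    (hγ : MDifferentiableWithinAt 𝓘(ℝ, ℝ) 𝓘(ℝ, E) γ (Icc 0 1) t)
    (h₀ : γ t ∈ (extChartAt 𝓘(ℝ, E) x₀).source) (hV : FieldDiff γ V t) :
    HasDerivWithinAt (coordF γ V x₀)
      (coordMap x₀ (γ t) (cov g γ V t) -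
        christoffelL g x₀ (extChartAt 𝓘(ℝ, E) x₀ (γ t)) (coordMap x₀ (γ t) (vel γ t))
        (coordMap x₀ (γ t) (V t))) (Icc 0 1) t := by
  have hs := mem_extChartAt_source (I := 𝓘(ℝ, E)) (γ t)
  have h := hasDerivWithinAt_coordF_change ht hγ hs h₀
    ((fieldDiff_iff hγ).1 hV).hasDerivWithinAt
  rwa [eq_sub_of_add_eq (cov_coord g ht hγ h₀ h).2.symm] at h

/-- The covariant derivative is compatible with the metric. -/
theorem hasDerivWithinAt_innerE (g : RMetric E M) {γ : ℝ → M} {V W : ℝ → E} {t : ℝ}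
    (ht : t ∈ Icc (0 : ℝ) 1) (hγ : MDifferentiableWithinAt 𝓘(ℝ, ℝ) 𝓘(ℝ, E) γ (Icc 0 1) t)
    (hV : FieldDiff γ V t) (hW : FieldDiff γ W t) :
    HasDerivWithinAt (fun τ => innerE g (γ τ) (V τ) (W τ))
      (innerE g (γ t) (cov g γ V t) (W t) + innerE g (γ t) (V t) (cov g γ W t)) (Icc 0 1) t := by
  have hs := mem_extChartAt_source (I := 𝓘(ℝ, E)) (γ t)
  have hy := (extChartAt 𝓘(ℝ, E) (γ t)).map_source hs
  have hv := hV.hasDerivWithinAt g ht hγ hs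
  have hw := hW.hasDerivWithinAt g ht hγ hs
  have hg := ((contDiffAt_chartMetric g (γ t) hy).differentiableAt
    (by simp)).hasFDerivAt.comp_hasDerivWithinAt t (hasDerivWithinAt_extChartAt ht hγ hs)
  have h := ((hg.clm_apply hv).clm_apply hw).congr_of_eventuallyEq_of_mem
    (f₁ := fun τ => innerE g (γ τ) (V τ) (W τ)) (by
      filter_upwards [eventually_mem_source hγ.continuousWithinAt hs] with τ hτ
      exact (chartMetric_coordMap g hτ _ _).symm) ht
  convert! h using 1
  rw [← chartMetric_coordMap g hs, ← chartMetric_coordMap g hs]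
  simp only [Function.comp_apply, add_apply, coordF, map_sub, sub_apply]
  -- The derivative of the metric coefficients supplies exactly the Christoffel terms subtracted in
  -- the two field derivatives.
  rw [christoffelL_compatible g (γ t) hy]
  ring

end

/-! ### Linear differential equations on short intervals -/

section


variable {E : Type*} [NormedAddCommGroup E] [NormedSpace ℝ E]

/-- Grönwall's inequality on a short interval, in both time directions. -/
theorem norm_le_of_norm_deriv_le_short {f f' : ℝ → E} {α β C ε t₀ : ℝ}
    (hf : ∀ t ∈ Icc α β, HasDerivWithinAt f (f' t) (Icc α β) t)
    (hb : ∀ t ∈ Icc α β, ‖f' t‖ ≤ C * ‖f t‖ + ε) (hC : 0 ≤ C) (hs : C * (β - α) ≤ 1 / 2)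
    (hε : 0 ≤ ε) (ht₀ : t₀ ∈ Icc α β) :
    ∀ t ∈ Icc α β, ‖f t‖ ≤ 2 * ‖f t₀‖ + 2 * (β - α) * ε := by
  have hc : ContinuousOn (fun t => ‖f t‖) (Icc α β) :=
    fun t ht => (hf t ht).continuousWithinAt.norm
  -- At a maximum of the norm, the mean value inequality bounds `‖f m‖` by `‖f t₀‖ + ‖f m‖ / 2 + (β
  -- - α) * ε`, and the half is absorbed on the left. No exponential is needed and the sign of time
  -- plays no role.
  obtain ⟨m, hm, hmax⟩ := isCompact_Icc.exists_isMaxOn ⟨t₀, ht₀⟩ hc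
  have hαβ : 0 ≤ β - α := by linarith [ht₀.1, ht₀.2]
  have h1 : ‖f m - f t₀‖ ≤ (C * ‖f m‖ + ε) * ‖m - t₀‖ := by
    refine Convex.norm_image_sub_le_of_norm_hasDerivWithin_le hf (fun t ht => ?_)
      (convex_Icc α β) ht₀ hm
    have : ‖f t‖ ≤ ‖f m‖ := hmax ht
    have := hb t ht
    nlinarith
  have h2 : ‖m - t₀‖ ≤ β - α := by
    rw [Real.norm_eq_abs, abs_le]
    constructor <;> linarith [ht₀.1, ht₀.2, hm.1, hm.2]
  have h3 : ‖f m‖ ≤ ‖f t₀‖ + ‖f m - f t₀‖ := by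
    have := norm_add_le (f t₀) (f m - f t₀)
    simpa using this
  have h4 : (C * ‖f m‖ + ε) * ‖m - t₀‖ ≤ (C * ‖f m‖ + ε) * (β - α) :=
    mul_le_mul_of_nonneg_left h2 (by positivity)
  have h5 : C * (β - α) * ‖f m‖ ≤ 1 / 2 * ‖f m‖ :=
    mul_le_mul_of_nonneg_right hs (norm_nonneg _)
  intro t ht
  have : ‖f t‖ ≤ ‖f m‖ := hmax ht
  nlinarith

/-- Solutions of linear differential equations on a short interval. -/
theorem exists_linear_ode_short [CompleteSpace E] {B : ℝ → E →L[ℝ] E} {b : ℝ → E} {α β C t₀ : ℝ}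
    (hB : ContinuousOn B (Icc α β)) (hb : ContinuousOn b (Icc α β))
    (hC : ∀ t ∈ Icc α β, ‖B t‖ ≤ C) (hs : C * (β - α) ≤ 1 / 2) (ht₀ : t₀ ∈ Icc α β) (x₀ : E) :
    ∃ x : ℝ → E, x t₀ = x₀ ∧
      ∀ t ∈ Icc α β, HasDerivWithinAt x (B t (x t) + b t) (Icc α β) t := by
  obtain ⟨D, hD⟩ : ∃ D, ∀ t ∈ Icc α β, ‖b t‖ ≤ D :=
    isCompact_Icc.exists_bound_of_continuousOn hb
  have hC0 : 0 ≤ C := (norm_nonneg _).trans (hC t₀ ht₀)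
  have hD0 : 0 ≤ D := (norm_nonneg _).trans (hD t₀ ht₀)
  have hαβ : 0 ≤ β - α := by linarith [ht₀.1, ht₀.2]
  have hx₀ : 0 ≤ ‖x₀‖ := norm_nonneg x₀
  -- This radius solves `(‖x₀‖ + a) / 2 + D * (β - α) = a`, so the Picard–Lindelöf ball is not left
  -- during the interval.
  set a : ℝ := ‖x₀‖ + 2 * D * (β - α) with ha
  have ha0 : 0 ≤ a := by positivity
  have hpl : IsPicardLindelof (fun t x => B t x + b t) (⟨t₀, ht₀⟩ : Icc α β) x₀ ⟨a, ha0⟩ 0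
      ⟨C * (‖x₀‖ + a) + D, by positivity⟩ ⟨C, hC0⟩ := by
    constructor
    · intro t ht
      refine LipschitzOnWith.of_dist_le_mul fun x _ y _ => ?_
      rw [dist_add_right, dist_eq_norm, ← map_sub, dist_eq_norm]
      exact (B t).le_of_opNorm_le (hC t ht) _
    · intro x _
      exact (hB.clm_apply continuousOn_const).add hb
    · intro t ht x hx
      have h1 : ‖x‖ ≤ ‖x₀‖ + a := by
        have h2 : ‖x - x₀‖ ≤ a := mem_closedBall_iff_norm.1 hx
        have := norm_add_le x₀ (x - x₀)
        rw [add_sub_cancel] at this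
        linarith
      calc ‖B t x + b t‖ ≤ ‖B t x‖ + ‖b t‖ := norm_add_le _ _
        _ ≤ C * ‖x‖ + D := add_le_add ((B t).le_of_opNorm_le (hC t ht) _) (hD t ht)
        _ ≤ C * (‖x₀‖ + a) + D := by gcongr
    · have h1 : max (β - t₀) (t₀ - α) ≤ β - α := max_le (by linarith [ht₀.1]) (by linarith [ht₀.2])
      have h2 : (C * (‖x₀‖ + a) + D) * max (β - t₀) (t₀ - α) ≤ (C * (‖x₀‖ + a) + D) * (β - α) :=
        mul_le_mul_of_nonneg_left h1 (by positivity)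
      have h3 : C * (β - α) * (‖x₀‖ + a) ≤ 1 / 2 * (‖x₀‖ + a) :=
        mul_le_mul_of_nonneg_right hs (by positivity)
      change (C * (‖x₀‖ + a) + D) * max (β - t₀) (t₀ - α) ≤ a - 0
      nlinarith
  exact hpl.exists_eq_forall_mem_Icc_hasDerivWithinAt₀

/-- Differentiability of the solutions of linear differential equations with respect to a
parameter, on a short interval: it propagates from one time to all times. -/
theorem exists_hasDerivWithinAt_parameter [CompleteSpace E] {A : Set ℝ} {s α β C t₀ : ℝ}
    {B : ℝ → ℝ → E →L[ℝ] E} {B' : ℝ → E →L[ℝ] E} {W : ℝ → ℝ → E} {z₀ : E} (hsA : s ∈ A)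
    (hB : ∀ a ∈ A, ∀ τ ∈ Icc α β, ‖B a τ‖ ≤ C) (hs : C * (β - α) ≤ 1 / 2)
    (hBs : ContinuousOn (B s) (Icc α β)) (hB's : ContinuousOn B' (Icc α β))
    (hdiff : ∀ ε > 0, ∀ᶠ a in 𝓝[A] s, ∀ τ ∈ Icc α β,
      ‖B a τ - B s τ - (a - s) • B' τ‖ ≤ ε * |a - s|)
    (hW : ∀ a ∈ A, ∀ τ ∈ Icc α β, HasDerivWithinAt (W a) (B a τ (W a τ)) (Icc α β) τ)
    (ht₀ : t₀ ∈ Icc α β) (hz₀ : HasDerivWithinAt (fun a => W a t₀) z₀ A s) :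
    ∃ z : ℝ → E, ∀ τ ∈ Icc α β, HasDerivWithinAt (fun a => W a τ) (z τ) A s ∧
      HasDerivWithinAt z (B s τ (z τ) + B' τ (W s τ)) (Icc α β) τ := by
  have hWs : ContinuousOn (W s) (Icc α β) := fun τ hτ => (hW s hsA τ hτ).continuousWithinAt
  -- The candidate derivative is the solution of the formally differentiated equation, started at
  -- `z₀`.
  obtain ⟨z, hzt, hz⟩ := exists_linear_ode_short hBs (hB's.clm_apply hWs) (hB s hsA) hs ht₀ z₀
  refine ⟨z, fun τ hτ => ⟨?_, hz τ hτ⟩⟩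
  obtain ⟨m, hm⟩ : ∃ m, ∀ t ∈ Icc α β, ‖W s t‖ ≤ m := isCompact_Icc.exists_bound_of_continuousOn hWs
  obtain ⟨C', hC'⟩ : ∃ m, ∀ t ∈ Icc α β, ‖B' t‖ ≤ m := isCompact_Icc.exists_bound_of_continuousOn hB's
  have hC0 : 0 ≤ C := (norm_nonneg _).trans (hB s hsA t₀ ht₀)
  have hm0 : 0 ≤ m := (norm_nonneg _).trans (hm t₀ ht₀)
  have hC'0 : 0 ≤ C' := (norm_nonneg _).trans (hC' t₀ ht₀)
  have hαβ : 0 ≤ β - α := by linarith [ht₀.1, ht₀.2]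
  have hA : ∀ᶠ a in 𝓝[A] s, a ∈ A := self_mem_nhdsWithin
  have hlim : Tendsto (fun a => |a - s|) (𝓝[A] s) (𝓝 0) := by
    have : Tendsto (fun a => |a - s|) (𝓝 s) (𝓝 |s - s|) := by
      exact (continuous_abs.comp (continuous_id.sub continuous_const)).tendsto s
    rw [sub_self, abs_zero] at this
    exact this.mono_left nhdsWithin_le_nhds
  -- uniform continuity in the parameter
  have hcont : ∀ η > 0, ∀ᶠ a in 𝓝[A] s, ∀ τ ∈ Icc α β, ‖W a τ - W s τ‖ ≤ η := by
    intro η hη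
    have e1 : ∀ᶠ a in 𝓝[A] s, 2 * ‖W a t₀ - W s t₀‖ +
        2 * (β - α) * ((1 + C') * |a - s| * m) < η := by
      have h1 : Tendsto (fun a => W a t₀ - W s t₀) (𝓝[A] s) (𝓝 (W s t₀ - W s t₀)) :=
        Tendsto.sub hz₀.continuousWithinAt tendsto_const_nhds
      have h2 := (h1.norm.const_mul 2).add
        (((hlim.const_mul (1 + C')).mul_const m).const_mul (2 * (β - α)))
      simp only [sub_self, norm_zero, mul_zero, zero_mul, add_zero] at h2
      exact h2.eventually (gt_mem_nhds hη)
    filter_upwards [hA, hdiff 1 one_pos, e1] with a ha hd he τ hτ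
    refine (norm_le_of_norm_deriv_le_short (f := fun τ => W a τ - W s τ)
      (f' := fun τ => B a τ (W a τ) - B s τ (W s τ)) (C := C) (ε := (1 + C') * |a - s| * m)
      (fun t ht => (hW a ha t ht).sub (hW s hsA t ht)) (fun t ht => ?_) hC0 hs (by positivity) ht₀
      τ hτ).trans he.le
    have e2 : ‖B a t - B s t‖ ≤ (1 + C') * |a - s| := by
      have h3 : B a t - B s t = (B a t - B s t - (a - s) • B' t) + (a - s) • B' t := by abel
      rw [h3]
      refine (norm_add_le _ _).trans ?_
      rw [norm_smul, Real.norm_eq_abs]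
      have := hd t ht
      have := mul_le_mul_of_nonneg_left (hC' t ht) (abs_nonneg (a - s))
      linarith
    have e3 : B a t (W a t) - B s t (W s t) = B a t (W a t - W s t) + (B a t - B s t) (W s t) := by
      simp
    rw [e3]
    refine (norm_add_le _ _).trans (add_le_add ((B a t).le_of_opNorm_le (hB a ha t ht) _) ?_)
    refine ((B a t - B s t).le_of_opNorm_le e2 _).trans ?_
    exact mul_le_mul_of_nonneg_left (hm t ht) (by positivity)
  rw [hasDerivWithinAt_iff_isLittleO, Asymptotics.isLittleO_iff]
  intro c hc
  have hz₀' := hz₀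
  rw [hasDerivWithinAt_iff_isLittleO, Asymptotics.isLittleO_iff] at hz₀'
  -- The left side is what the short Grönwall inequality makes of the error in the equation. The
  -- remaining `c / 2` is for the initial error, bounded by `c / 4` and doubled by that inequality.
  obtain ⟨ε, hε, hεc⟩ : ∃ ε > 0, 2 * (β - α) * (ε * (m + 1) + C' * ε) ≤ c / 2 := by
    refine ⟨c / (4 * (β - α + 1) * (m + 1 + C')), by positivity, ?_⟩
    have h1 : 0 < β - α + 1 := by linarith
    have h2 : 0 < m + 1 + C' := by linarith
    have : 2 * (β - α) * (c / (4 * (β - α + 1) * (m + 1 + C')) * (m + 1) +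
        C' * (c / (4 * (β - α + 1) * (m + 1 + C')))) = c / 2 * ((β - α) / (β - α + 1)) := by
      field_simp
      ring
    rw [this]
    have : (β - α) / (β - α + 1) ≤ 1 := by rw [div_le_one h1]; linarith
    nlinarith
  filter_upwards [hA, hdiff ε hε, hcont ε hε, hcont 1 one_pos,
    hz₀' (show 0 < c / 4 by positivity)] with a ha hd hc1 hc2 hz1
  have key := norm_le_of_norm_deriv_le_short (f := fun τ => W a τ - W s τ - (a - s) • z τ)
      (f' := fun τ => B a τ (W a τ) - B s τ (W s τ) - (a - s) • (B s τ (z τ) + B' τ (W s τ)))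
      (C := C) (ε := |a - s| * (ε * (m + 1) + C' * ε))
      (fun t ht => ((hW a ha t ht).sub (hW s hsA t ht)).sub ((hz t ht).const_smul (a - s)))
      (fun t ht => ?_) hC0 hs (by positivity) ht₀ τ hτ
  · refine key.trans ?_
    rw [hzt]
    rw [Real.norm_eq_abs] at hz1 ⊢
    have := mul_le_mul_of_nonneg_left hεc (abs_nonneg (a - s))
    nlinarith
  -- The first term is linear in the remainder being estimated. The other two are small compared
  -- with `|a - s|`: one by differentiability of the coefficients, one by continuity of the
  -- solutions in the parameter.
  · have e3 : B a t (W a t) - B s t (W s t) - (a - s) • (B s t (z t) + B' t (W s t)) =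
        B s t (W a t - W s t - (a - s) • z t) + ((B a t - B s t - (a - s) • B' t) (W a t)
          + (a - s) • B' t (W a t - W s t)) := by
      simp only [map_sub, map_smul, sub_apply, smul_apply, smul_add, smul_sub]
      abel
    rw [e3]
    refine (norm_add_le _ _).trans (add_le_add ((B s t).le_of_opNorm_le (hB s hsA t ht) _) ?_)
    refine (norm_add_le _ _).trans ?_
    have h1 : ‖W a t‖ ≤ m + 1 := by
      have := norm_add_le (W s t) (W a t - W s t)
      rw [add_sub_cancel] at this
      linarith [hm t ht, hc2 t ht]
    have h2 : ‖(B a t - B s t - (a - s) • B' t) (W a t)‖ ≤ ε * |a - s| * (m + 1) :=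
      ((B a t - B s t - (a - s) • B' t).le_of_opNorm_le (hd t ht) _).trans
        (mul_le_mul_of_nonneg_left h1 (by positivity))
    have h3 : ‖(a - s) • B' t (W a t - W s t)‖ ≤ |a - s| * (C' * ε) := by
      rw [norm_smul, Real.norm_eq_abs]
      refine mul_le_mul_of_nonneg_left ?_ (abs_nonneg _)
      exact ((B' t).le_of_opNorm_le (hC' t ht) _).trans
        (mul_le_mul_of_nonneg_left (hc1 t ht) hC'0)
    nlinarith

end

/-! ### Parallel transport -/

section


variable {E : Type*} [NormedAddCommGroup E] [NormedSpace ℝ E]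
  {M : Type*} [TopologicalSpace M] [ChartedSpace E M] [IsManifold 𝓘(ℝ, E) ∞ M]

variable [FiniteDimensional ℝ E]

/-- The vector field `V` along `γ` is differentiable at `t`, with vanishing covariant
derivative. -/
def ParAt (g : RMetric E M) (γ : ℝ → M) (V : ℝ → E) (t : ℝ) : Prop :=
  FieldDiff γ V t ∧ cov g γ V t = 0

theorem FieldDiff.congr {γ : ℝ → M} {V W : ℝ → E} {t : ℝ} (hV : FieldDiff γ V t)
    (ht : t ∈ Icc (0 : ℝ) 1) (h : V =ᶠ[𝓝[Icc 0 1] t] W) : FieldDiff γ W t := by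
  refine MDifferentiableWithinAt.congr_of_eventuallyEq hV ?_ ?_
  · filter_upwards [h] with τ hτ
    rw [hτ]
  · rw [h.self_of_nhdsWithin ht]

theorem cov_congr (g : RMetric E M) {γ : ℝ → M} {V W : ℝ → E} {t : ℝ}
    (ht : t ∈ Icc (0 : ℝ) 1) (h : V =ᶠ[𝓝[Icc 0 1] t] W) : cov g γ V t = cov g γ W t := by
  rw [cov_eq, cov_eq, h.self_of_nhdsWithin ht]
  congr 1
  refine Filter.EventuallyEq.derivWithin_eq ?_ ?_
  · filter_upwards [h] with τ hτ
    simp [coordF, hτ]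
  · simp [coordF, h.self_of_nhdsWithin ht]

theorem ParAt.congr {g : RMetric E M} {γ : ℝ → M} {V W : ℝ → E} {t : ℝ} (hV : ParAt g γ V t)
    (ht : t ∈ Icc (0 : ℝ) 1) (h : V =ᶠ[𝓝[Icc 0 1] t] W) : ParAt g γ W t :=
  ⟨hV.1.congr ht h, (cov_congr g ht h).symm.trans hV.2⟩

/-! ### Sum and Leibniz rules for the covariant derivative along a curve -/

section linearity

variable {g : RMetric E M} {γ : ℝ → M} {V W : ℝ → E} {t : ℝ}

theorem fieldDiff_cov_add (ht : t ∈ Icc (0 : ℝ) 1)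
    (hγ : MDifferentiableWithinAt 𝓘(ℝ, ℝ) 𝓘(ℝ, E) γ (Icc 0 1) t)
    (hV : FieldDiff γ V t) (hW : FieldDiff γ W t) :
    FieldDiff γ (fun τ => V τ + W τ) t ∧
      cov g γ (fun τ => V τ + W τ) t = cov g γ V t + cov g γ W t := by
  have hs := mem_extChartAt_source (I := 𝓘(ℝ, E)) (γ t)
  have h := (hV.hasDerivWithinAt g ht hγ hs).add (hW.hasDerivWithinAt g ht hγ hs)
  have h' : HasDerivWithinAt (coordF γ (fun τ => V τ + W τ) (γ t)) _ (Icc 0 1) t :=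
    h.congr_of_mem (fun τ _ => by simp [coordF]) ht
  obtain ⟨h1, h2⟩ := cov_coord g ht hγ hs h'
  refine ⟨h1, ?_⟩
  simp only [coordMap_self, map_add] at h2
  rw [h2]
  abel

theorem fieldDiff_cov_smul {f : ℝ → ℝ} {f' : ℝ} (ht : t ∈ Icc (0 : ℝ) 1)
    (hγ : MDifferentiableWithinAt 𝓘(ℝ, ℝ) 𝓘(ℝ, E) γ (Icc 0 1) t)
    (hf : HasDerivWithinAt f f' (Icc 0 1) t) (hV : FieldDiff γ V t) :
    FieldDiff γ (fun τ => f τ • V τ) t ∧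
      cov g γ (fun τ => f τ • V τ) t = f' • V t + f t • cov g γ V t := by
  have hs := mem_extChartAt_source (I := 𝓘(ℝ, E)) (γ t)
  have h := hf.smul (hV.hasDerivWithinAt g ht hγ hs)
  have h' : HasDerivWithinAt (coordF γ (fun τ => f τ • V τ) (γ t)) _ (Icc 0 1) t :=
    h.congr_of_mem (fun τ _ => by simp [coordF]) ht
  obtain ⟨h1, h2⟩ := cov_coord g ht hγ hs h'
  refine ⟨h1, ?_⟩
  simp only [coordMap_self, map_smul, coordF, smul_sub] at h2
  rw [h2]
  abel

theorem ParAt.add (ht : t ∈ Icc (0 : ℝ) 1)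
    (hγ : MDifferentiableWithinAt 𝓘(ℝ, ℝ) 𝓘(ℝ, E) γ (Icc 0 1) t)
    (hV : ParAt g γ V t) (hW : ParAt g γ W t) : ParAt g γ (fun τ => V τ + W τ) t := by
  obtain ⟨h1, h2⟩ := fieldDiff_cov_add (g := g) ht hγ hV.1 hW.1
  exact ⟨h1, by rw [h2, hV.2, hW.2, add_zero]⟩

theorem ParAt.const_smul (r : ℝ) (ht : t ∈ Icc (0 : ℝ) 1)
    (hγ : MDifferentiableWithinAt 𝓘(ℝ, ℝ) 𝓘(ℝ, E) γ (Icc 0 1) t)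
    (hV : ParAt g γ V t) : ParAt g γ (fun τ => r • V τ) t := by
  obtain ⟨h1, h2⟩ := fieldDiff_cov_smul (g := g) ht hγ (hasDerivWithinAt_const t _ r) hV.1
  exact ⟨h1, by rw [h2, hV.2, smul_zero, zero_smul, add_zero]⟩

end linearity

variable {g : RMetric E M} {γ : ℝ → M}

/-- The inner product of two parallel vector fields is constant. -/
theorem innerE_eq_of_parAt {V W : ℝ → E} {K : Set ℝ} (hK : K ⊆ Icc 0 1) (hconv : Convex ℝ K)
    (hγ : ContMDiffOn 𝓘(ℝ, ℝ) 𝓘(ℝ, E) ∞ γ (Icc 0 1)) (hV : ∀ t ∈ K, ParAt g γ V t)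
    (hW : ∀ t ∈ K, ParAt g γ W t) {t₁ t₂ : ℝ} (h₁ : t₁ ∈ K) (h₂ : t₂ ∈ K) :
    innerE g (γ t₂) (V t₂) (W t₂) = innerE g (γ t₁) (V t₁) (W t₁) := by
  have hd : ∀ t ∈ K, HasDerivWithinAt (fun τ => innerE g (γ τ) (V τ) (W τ)) 0 K t := by
    intro t ht
    have h := hasDerivWithinAt_innerE g (hK ht) ((hγ t (hK ht)).mdifferentiableWithinAt (by simp))
      (hV t ht).1 (hW t ht).1
    rw [(hV t ht).2, (hW t ht).2] at h
    simpa using h.mono hK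
  have := Convex.norm_image_sub_le_of_norm_hasDerivWithin_le (C := 0) hd (by simp) hconv h₁ h₂
  rw [zero_mul, norm_le_zero_iff, sub_eq_zero] at this
  exact this

theorem eq_zero_of_innerE_self {p : M} {u : E} (h : innerE g p u u = 0) : u = 0 := by
  by_contra hu
  exact (innerE_pos g p hu).ne' h

/-- The difference of two parallel fields is parallel, so its Riemannian norm is constant; this
replaces uniqueness for differential equations. A general convex `K` is needed to compare fields
that are parallel only on part of the curve. -/
theorem parAt_unique {V W : ℝ → E} {K : Set ℝ} (hK : K ⊆ Icc 0 1) (hconv : Convex ℝ K)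
    (hγ : ContMDiffOn 𝓘(ℝ, ℝ) 𝓘(ℝ, E) ∞ γ (Icc 0 1)) (hV : ∀ t ∈ K, ParAt g γ V t)
    (hW : ∀ t ∈ K, ParAt g γ W t) {t₁ : ℝ} (h₁ : t₁ ∈ K) (h : V t₁ = W t₁) :
    ∀ t ∈ K, V t = W t := by
  intro t ht
  have hmd := fun t (ht : t ∈ K) => (hγ t (hK ht)).mdifferentiableWithinAt (by simp)
  have hD : ∀ t ∈ K, ParAt g γ (fun τ => V τ + (-1 : ℝ) • W τ) t := fun t ht =>
    (hV t ht).add (hK ht) (hmd t ht) ((hW t ht).const_smul (-1) (hK ht) (hmd t ht))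
  have h0 := innerE_eq_of_parAt hK hconv hγ hD hD h₁ ht
  have := eq_zero_of_innerE_self (h0.trans (by simp [h]))
  rw [neg_one_smul, ← sub_eq_add_neg, sub_eq_zero] at this
  exact this

/-- The coordinates of the velocity of a smooth curve are continuous. -/
theorem continuousWithinAt_coordF_vel {t : ℝ} {x₀ : M} (ht : t ∈ Icc (0 : ℝ) 1)
    (hγ : ContMDiffOn 𝓘(ℝ, ℝ) 𝓘(ℝ, E) ∞ γ (Icc 0 1))
    (hx : γ t ∈ (extChartAt 𝓘(ℝ, E) x₀).source) :
    ContinuousWithinAt (coordF (E := E) γ (vel γ) x₀) (Icc 0 1) t := by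
  have h1 := (contDiffWithinAt_extChartAt_comp (hγ t ht) hx).fderivWithin_right (m := 0)
    (uniqueDiffOn_Icc zero_lt_one) (by simp) ht
  have h2 := h1.continuousWithinAt.clm_apply (continuousWithinAt_const (b := (1 : ℝ)))
  refine h2.congr_of_eventuallyEq_of_mem ?_ ht
  filter_upwards [eventually_mem_source (hγ t ht).continuousWithinAt hx, self_mem_nhdsWithin]
    with τ hτ hτ'
  exact ((hasDerivWithinAt_extChartAt hτ' ((hγ τ hτ').mdifferentiableWithinAt (by simp))
    hτ).derivWithin (uniqueDiffWithinAt_unitIcc hτ')).symm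

/-- Local existence of parallel vector fields. -/
theorem exists_parAt_local (g : RMetric E M) {t : ℝ} (ht : t ∈ Icc (0 : ℝ) 1)
    (hγ : ContMDiffOn 𝓘(ℝ, ℝ) 𝓘(ℝ, E) ∞ γ (Icc 0 1)) :
    ∃ ε > 0, ∀ t₀ ∈ Icc (0 : ℝ) 1 ∩ Metric.ball t ε, ∀ w : E, ∃ W : ℝ → E, W t₀ = w ∧
      ∀ τ ∈ Icc (0 : ℝ) 1 ∩ Metric.ball t ε, ParAt g γ W τ := by
  set x₀ := γ t with hx₀
  have hs := mem_extChartAt_source (I := 𝓘(ℝ, E)) (γ t)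
  -- In the chart at `γ t`, a field is parallel exactly when its coordinates solve `x' = B x`.
  set B : ℝ → E →L[ℝ] E := fun τ =>
    -christoffelL g x₀ (extChartAt 𝓘(ℝ, E) x₀ (γ τ)) (coordF γ (vel γ) x₀ τ) with hB
  have hBc : ∀ τ ∈ Icc (0 : ℝ) 1, γ τ ∈ (extChartAt 𝓘(ℝ, E) x₀).source →
      ContinuousWithinAt B (Icc 0 1) τ := by
    intro τ hτ hsτ
    have h1 : ContinuousWithinAt (fun τ => christoffelL g x₀ (extChartAt 𝓘(ℝ, E) x₀ (γ τ)))
        (Icc 0 1) τ :=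
      (contDiffAt_christoffelL g x₀
        ((extChartAt 𝓘(ℝ, E) x₀).map_source hsτ)).continuousAt.comp_continuousWithinAt
        (f := fun τ => extChartAt 𝓘(ℝ, E) x₀ (γ τ))
        (contDiffWithinAt_extChartAt_comp (hγ τ hτ) hsτ).continuousWithinAt
    exact (h1.clm_apply (continuousWithinAt_coordF_vel hτ hγ hsτ)).neg
  set C := ‖B t‖ + 1 with hC
  have hC0 : 0 < C := by positivity
  obtain ⟨r, hr, hrB⟩ : ∃ r > 0, ∀ τ ∈ Icc (0 : ℝ) 1 ∩ Metric.ball t r,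
      γ τ ∈ (extChartAt 𝓘(ℝ, E) x₀).source ∧ ‖B τ‖ ≤ C := by
    have e1 := (eventually_mem_source (hγ t ht).continuousWithinAt hs).and
      ((hBc t ht hs).norm.eventually (Iic_mem_nhds (show ‖B t‖ < C by linarith)))
    obtain ⟨r, hr, h⟩ := Metric.mem_nhdsWithin_iff.1 e1
    exact ⟨r, hr, fun τ hτ => h ⟨hτ.2, hτ.1⟩⟩
  -- The bound `r / 2` keeps the closed interval of radius `ε` inside the ball of radius `r`; `1 /
  -- (4 * C)` makes its length, at most `2 * ε`, short enough for the linear solver.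
  refine ⟨min (r / 2) (1 / (4 * C)), by positivity, ?_⟩
  set ε := min (r / 2) (1 / (4 * C)) with hε
  have hε0 : 0 < ε := by positivity
  have hεr : ε < r := (min_le_left _ _).trans_lt (by linarith)
  have hεC : C * (2 * ε) ≤ 1 / 2 := by
    have : ε ≤ 1 / (4 * C) := min_le_right _ _
    have h2 : C * (2 * (1 / (4 * C))) = 1 / 2 := by field_simp; norm_num
    nlinarith
  set α := max 0 (t - ε)
  set β := min 1 (t + ε)
  have hαβ : ∀ τ, τ ∈ Icc α β ↔ τ ∈ Icc (0 : ℝ) 1 ∧ τ ∈ Icc (t - ε) (t + ε) := by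
    intro τ
    simp only [α, β, mem_Icc, max_le_iff, le_min_iff]
    tauto
  have hsub : ∀ τ ∈ Icc α β, τ ∈ Icc (0 : ℝ) 1 ∩ Metric.ball t r := by
    intro τ hτ
    rw [hαβ] at hτ
    refine ⟨hτ.1, ?_⟩
    rw [Metric.mem_ball, Real.dist_eq, abs_lt]
    constructor <;> linarith [hτ.2.1, hτ.2.2]
  have hball : ∀ τ ∈ Icc (0 : ℝ) 1 ∩ Metric.ball t ε, τ ∈ Icc α β := by
    rintro τ ⟨hτ, hb⟩
    rw [Metric.mem_ball, Real.dist_eq, abs_lt] at hb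
    rw [hαβ]
    exact ⟨hτ, by linarith, by linarith⟩
  have hlen : C * (β - α) ≤ 1 / 2 := by
    have h1 : β ≤ t + ε := min_le_right _ _
    have h2 : t - ε ≤ α := le_max_right _ _
    nlinarith
  intro t₀ ht₀ w
  obtain ⟨x, hx0, hx⟩ := exists_linear_ode_short (B := B) (b := fun _ => 0)
    (fun τ hτ => (hBc τ (hsub τ hτ).1 (hrB τ (hsub τ hτ)).1).mono fun τ' hτ' => (hsub τ' hτ').1)
    continuousOn_const (fun τ hτ => (hrB τ (hsub τ hτ)).2) hlen (hball t₀ ht₀)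
    (coordMap x₀ (γ t₀) w)
  refine ⟨fun τ => coordInv x₀ (γ τ) (x τ), ?_, fun τ hτ => ?_⟩
  · simp only [hx0]
    exact coordInv_coordMap (hrB t₀ (hsub t₀ (hball t₀ ht₀))).1 w
  · have hτ' := hball τ hτ
    have hsτ := (hrB τ (hsub τ hτ')).1
    have hnh : Icc α β ∈ 𝓝[Icc 0 1] τ := by
      filter_upwards [self_mem_nhdsWithin, mem_nhdsWithin_of_mem_nhds
        (Metric.isOpen_ball.mem_nhds hτ.2)] with τ' h1 h2
      exact hball τ' ⟨h1, h2⟩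
    have h1 : HasDerivWithinAt (coordF γ (fun τ => coordInv x₀ (γ τ) (x τ)) x₀)
        (B τ (x τ)) (Icc 0 1) τ := by
      have h2 := (hx τ hτ').mono_of_mem_nhdsWithin hnh
      rw [add_zero] at h2
      refine h2.congr_of_eventuallyEq_of_mem ?_ hτ.1
      filter_upwards [hnh] with τ' h3
      exact coordMap_coordInv (hrB τ' (hsub τ' h3)).1 _
    obtain ⟨h2, h3⟩ := cov_coord g hτ.1 ((hγ τ hτ.1).mdifferentiableWithinAt (by simp)) hsτ h1
    refine ⟨h2, coordMap_inj hsτ ?_⟩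
    rw [h3, map_zero, coordMap_coordInv hsτ]
    simp [hB, coordF]

/-- Existence of parallel vector fields with a given value at the origin of the curve. -/
theorem exists_parAt_of_origin (g : RMetric E M)
    (hγ : ContMDiffOn 𝓘(ℝ, ℝ) 𝓘(ℝ, E) ∞ γ (Icc 0 1)) (u : E) :
    ∃ V : ℝ → E, V 0 = u ∧ ∀ t ∈ Icc (0 : ℝ) 1, ParAt g γ V t := by
  choose! ε hε hloc using fun t (ht : t ∈ Icc (0 : ℝ) 1) => exists_parAt_local g ht hγ
  obtain ⟨δ, hδ, hleb⟩ := lebesgue_number_lemma_of_metric (s := Icc (0 : ℝ) 1)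
    (c := fun t : Icc (0 : ℝ) 1 => Metric.ball (t : ℝ) (ε t)) isCompact_Icc
    (fun _ => Metric.isOpen_ball)
    (fun t ht => mem_iUnion.2 ⟨⟨t, ht⟩, Metric.mem_ball_self (hε t ht)⟩)
  have hLS : ∀ T ∈ Icc (0 : ℝ) 1, ∀ t₀ ∈ Icc (0 : ℝ) 1 ∩ Metric.ball T δ, ∀ w : E,
      ∃ W : ℝ → E, W t₀ = w ∧ ∀ τ ∈ Icc (0 : ℝ) 1 ∩ Metric.ball T δ, ParAt g γ W τ := by
    intro T hT t₀ ht₀ w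
    obtain ⟨i, hi⟩ := hleb T hT
    obtain ⟨W, h1, h2⟩ := hloc i i.2 t₀ ⟨ht₀.1, hi ht₀.2⟩ w
    exact ⟨W, h1, fun τ hτ => h2 τ ⟨hτ.1, hi hτ.2⟩⟩
  have hP : ∀ n : ℕ, ∃ V : ℝ → E, V 0 = u ∧
      ∀ t ∈ Icc (0 : ℝ) 1, t < δ + n * δ → ParAt g γ V t := by
    intro n
    induction n with
    | zero =>
      obtain ⟨W, h1, h2⟩ := hLS 0 (by simp) 0 ⟨by simp, Metric.mem_ball_self hδ⟩ u
      refine ⟨W, h1, fun t ht htδ => h2 t ⟨ht, ?_⟩⟩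
      rw [Metric.mem_ball, Real.dist_eq, abs_lt]
      constructor <;> simp at htδ <;> linarith [ht.1]
    | succ n ih =>
      obtain ⟨V, hV0, hV⟩ := ih
      set T := δ + n * δ with hT
      have hT0 : 0 < T := by positivity
      rcases lt_or_ge 1 T with h1T | hT1
      · exact ⟨V, hV0, fun t ht _ => hV t ht (by linarith [ht.2])⟩
      -- The switch is made strictly before `T`, where `V` is still known to be parallel. The two
      -- fields agree on the overlap, so near every time the glued field coincides with a single
      -- parallel field.
      set t₀ := max 0 (T - δ / 2) with ht₀def
      have ht₀T : t₀ < T := max_lt hT0 (by linarith)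
      have ht₀0 : 0 ≤ t₀ := le_max_left _ _
      have ht₀δ : T - δ / 2 ≤ t₀ := le_max_right _ _
      have ht₀ : t₀ ∈ Icc (0 : ℝ) 1 ∩ Metric.ball T δ := by
        refine ⟨⟨ht₀0, by linarith⟩, ?_⟩
        rw [Metric.mem_ball, Real.dist_eq, abs_lt]
        constructor <;> linarith
      obtain ⟨W, hW0, hW⟩ := hLS T ⟨hT0.le, hT1⟩ t₀ ht₀ (V t₀)
      have hVW : ∀ t ∈ Icc (0 : ℝ) 1 ∩ Metric.ball T δ ∩ Iio T, V t = W t :=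
        parAt_unique (fun t ht => ht.1.1)
          (((convex_Icc _ _).inter (convex_ball _ _)).inter (convex_Iio _)) hγ
          (fun t ht => hV t ht.1.1 ht.2) (fun t ht => hW t ht.1) ⟨ht₀, ht₀T⟩ hW0.symm
      refine ⟨fun t => if t < t₀ then V t else W t, ?_, fun t ht htT => ?_⟩
      · by_cases h : 0 < t₀
        · simp [h, hV0]
        · have : t₀ = 0 := le_antisymm (not_lt.1 h) ht₀0
          simp only [this, lt_irrefl, if_false]
          rw [← this, hW0, this, hV0]
      · rcases lt_or_ge t t₀ with hlt | hge
        · refine (hV t ht (hlt.trans ht₀T)).congr ht ?_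
          filter_upwards [mem_nhdsWithin_of_mem_nhds (Iio_mem_nhds hlt)] with τ hτ
          simp [mem_Iio.1 hτ]
        · have htN : t ∈ Metric.ball T δ := by
            rw [Metric.mem_ball, Real.dist_eq, abs_lt]
            push_cast at htT
            constructor <;> linarith
          refine (hW t ⟨ht, htN⟩).congr ht ?_
          filter_upwards [self_mem_nhdsWithin,
            mem_nhdsWithin_of_mem_nhds (Metric.isOpen_ball.mem_nhds htN)] with τ h1 h2
          by_cases h : τ < t₀
          · simp only [h, if_true]
            exact (hVW τ ⟨⟨h1, h2⟩, h.trans ht₀T⟩).symm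
          · simp [h]
  obtain ⟨n, hn⟩ := exists_nat_gt (1 / δ)
  obtain ⟨V, hV0, hV⟩ := hP n
  refine ⟨V, hV0, fun t ht => hV t ht ?_⟩
  rw [div_lt_iff₀ hδ] at hn
  linarith [ht.2]

/-- Existence of parallel vector fields with a given value at some point of the curve. -/
theorem exists_parAt (g : RMetric E M) (hγ : ContMDiffOn 𝓘(ℝ, ℝ) 𝓘(ℝ, E) ∞ γ (Icc 0 1))
    {t₁ : ℝ} (ht₁ : t₁ ∈ Icc (0 : ℝ) 1) (u : E) :
    ∃ V : ℝ → E, V t₁ = u ∧ ∀ t ∈ Icc (0 : ℝ) 1, ParAt g γ V t := by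
  choose V hV0 hV using exists_parAt_of_origin g hγ
  have hmd := fun t (ht : t ∈ Icc (0 : ℝ) 1) => (hγ t ht).mdifferentiableWithinAt
    (n := ∞) (by simp)
  have h0 : (0 : ℝ) ∈ Icc (0 : ℝ) 1 := by simp
  -- Evaluation at `t₁` of the parallel field started at the origin is linear by uniqueness and
  -- injective by conservation of the norm. Finite dimension makes it surjective, so any value at
  -- `t₁` is attained.
  let L : E →ₗ[ℝ] E :=
    { toFun := fun u => V u t₁
      map_add' := fun u w => parAt_unique Subset.rfl (convex_Icc _ _) hγ (hV (u + w))
        (fun t ht => (hV u t ht).add ht (hmd t ht) (hV w t ht)) h0 (by simp [hV0]) t₁ ht₁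
      map_smul' := fun r u => parAt_unique Subset.rfl (convex_Icc _ _) hγ (hV (r • u))
        (fun t ht => (hV u t ht).const_smul r ht (hmd t ht)) h0 (by simp [hV0]) t₁ ht₁ }
  have hinj : Function.Injective L := by
    rw [← LinearMap.ker_eq_bot, LinearMap.ker_eq_bot']
    intro u hu
    have hu' : V u t₁ = 0 := hu
    have := innerE_eq_of_parAt Subset.rfl (convex_Icc _ _) hγ (hV u) (hV u) ht₁ h0
    rw [hu', hV0] at this
    exact eq_zero_of_innerE_self (this.trans (by simp))
  obtain ⟨w, hw⟩ := (LinearMap.injective_iff_surjective.1 hinj) u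
  exact ⟨V w, hw, hV w⟩

theorem hasTransport (g : RMetric E M) (hγ : ContMDiffOn 𝓘(ℝ, ℝ) 𝓘(ℝ, E) ∞ γ (Icc 0 1)) :
    HasTransport g γ := by
  refine fun t₁ ht₁ => ⟨fun u => ?_, fun V W hV hW h => ?_⟩
  · obtain ⟨V, hV, hV'⟩ := exists_parAt g hγ ht₁ u
    exact ⟨V, hV', hV⟩
  · exact parAt_unique (V := V) (W := W) Subset.rfl (convex_Icc _ _) hγ hV hW ht₁ h

/-- Parallel transport, as a map on the model space. -/
def tr (g : RMetric E M) (γ : ℝ → M) (t₁ t₂ : ℝ) (u : E) : E := transport (E := E) g γ t₁ t₂ u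

/-- `transport` evaluates a field obtained by choice; uniqueness on `[0, 1]` lets any parallel field
with the right value stand in for it. -/
theorem tr_eq_of_parAt (hγ : ContMDiffOn 𝓘(ℝ, ℝ) 𝓘(ℝ, E) ∞ γ (Icc 0 1)) {V : ℝ → E}
    (hV : ∀ t ∈ Icc (0 : ℝ) 1, ParAt g γ V t) {t₁ t₂ : ℝ} (h₁ : t₁ ∈ Icc (0 : ℝ) 1)
    (h₂ : t₂ ∈ Icc (0 : ℝ) 1) : tr g γ t₁ t₂ (V t₁) = V t₂ := by
  have h : ∃ W : ∀ t, TangentSpace 𝓘(ℝ, E) (γ t), IsParallel g γ W ∧ W t₁ = V t₁ := ⟨V, hV, rfl⟩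
  have h3 : tr g γ t₁ t₂ (V t₁) = h.choose t₂ := dif_pos h
  rw [h3]
  exact parAt_unique (V := h.choose) (W := V) Subset.rfl (convex_Icc _ _) hγ h.choose_spec.1 hV h₁
    h.choose_spec.2 t₂ h₂

theorem parAt_tr (hγ : ContMDiffOn 𝓘(ℝ, ℝ) 𝓘(ℝ, E) ∞ γ (Icc 0 1)) {t₁ : ℝ}
    (h₁ : t₁ ∈ Icc (0 : ℝ) 1) (u : E) {t : ℝ} (ht : t ∈ Icc (0 : ℝ) 1) :
    ParAt g γ (fun τ => tr g γ t₁ τ u) t := by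
  obtain ⟨V, rfl, hV⟩ := exists_parAt g hγ h₁ u
  refine (hV t ht).congr ht ?_
  filter_upwards [self_mem_nhdsWithin] with τ hτ
  exact (tr_eq_of_parAt hγ hV h₁ hτ).symm

theorem tr_self (hγ : ContMDiffOn 𝓘(ℝ, ℝ) 𝓘(ℝ, E) ∞ γ (Icc 0 1)) {t₁ : ℝ}
    (h₁ : t₁ ∈ Icc (0 : ℝ) 1) (u : E) : tr g γ t₁ t₁ u = u := by
  obtain ⟨V, rfl, hV⟩ := exists_parAt g hγ h₁ u
  exact tr_eq_of_parAt hγ hV h₁ h₁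

theorem tr_tr (hγ : ContMDiffOn 𝓘(ℝ, ℝ) 𝓘(ℝ, E) ∞ γ (Icc 0 1)) {t₁ t₂ t₃ : ℝ}
    (h₁ : t₁ ∈ Icc (0 : ℝ) 1) (h₂ : t₂ ∈ Icc (0 : ℝ) 1) (h₃ : t₃ ∈ Icc (0 : ℝ) 1) (u : E) :
    tr g γ t₂ t₃ (tr g γ t₁ t₂ u) = tr g γ t₁ t₃ u := by
  obtain ⟨V, rfl, hV⟩ := exists_parAt g hγ h₁ u
  rw [tr_eq_of_parAt hγ hV h₁ h₂, tr_eq_of_parAt hγ hV h₁ h₃, tr_eq_of_parAt hγ hV h₂ h₃]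

/-- Parallel transport is adjoint to the parallel transport in the opposite direction. -/
theorem innerE_tr (hγ : ContMDiffOn 𝓘(ℝ, ℝ) 𝓘(ℝ, E) ∞ γ (Icc 0 1)) {t₁ t₂ : ℝ}
    (h₁ : t₁ ∈ Icc (0 : ℝ) 1) (h₂ : t₂ ∈ Icc (0 : ℝ) 1) (u v : E) :
    innerE g (γ t₂) (tr g γ t₁ t₂ u) v = innerE g (γ t₁) u (tr g γ t₂ t₁ v) := by
  obtain ⟨V, rfl, hV⟩ := exists_parAt g hγ h₁ u
  obtain ⟨W, rfl, hW⟩ := exists_parAt g hγ h₂ v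
  rw [tr_eq_of_parAt hγ hV h₁ h₂, tr_eq_of_parAt hγ hW h₂ h₁]
  exact innerE_eq_of_parAt Subset.rfl (convex_Icc _ _) hγ hV hW h₁ h₂

end

/-! ### Smooth squares -/

section


variable {E : Type*} [NormedAddCommGroup E] [NormedSpace ℝ E]
  {M : Type*} [TopologicalSpace M] [ChartedSpace E M] [IsManifold 𝓘(ℝ, E) ∞ M]

variable [FiniteDimensional ℝ E]

/-- The unit square. -/
def square : Set (ℝ × ℝ) := Icc 0 1 ×ˢ Icc 0 1

theorem uniqueDiffOn_square : UniqueDiffOn ℝ square :=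
  (uniqueDiffOn_Icc zero_lt_one).prod (uniqueDiffOn_Icc zero_lt_one)

/-- This is the condition under which second derivatives within the square are symmetric up to its
boundary. -/
theorem mem_closure_interior_square {z : ℝ × ℝ} (hz : z ∈ square) :
    z ∈ closure (interior square) := by
  rw [square, interior_prod_eq, closure_prod_eq, interior_Icc, closure_Ioo zero_ne_one]
  exact hz

theorem hasDerivWithinAt_fst {F : Type*} [NormedAddCommGroup F] [NormedSpace ℝ F]
    {f : ℝ × ℝ → F} {L : ℝ × ℝ →L[ℝ] F} {s t : ℝ} (ht : t ∈ Icc (0 : ℝ) 1)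
    (hf : HasFDerivWithinAt f L square (s, t)) :
    HasDerivWithinAt (fun σ => f (σ, t)) (L (1, 0)) (Icc 0 1) s := by
  have h : HasDerivWithinAt (fun σ : ℝ => (σ, t)) ((1 : ℝ), (0 : ℝ)) (Icc 0 1) s :=
    (hasDerivWithinAt_id s _).prodMk (hasDerivWithinAt_const s _ t)
  exact hf.comp_hasDerivWithinAt (f := fun σ : ℝ => (σ, t)) s h fun σ hσ => ⟨hσ, ht⟩

theorem hasDerivWithinAt_snd {F : Type*} [NormedAddCommGroup F] [NormedSpace ℝ F]
    {f : ℝ × ℝ → F} {L : ℝ × ℝ →L[ℝ] F} {s t : ℝ} (hs : s ∈ Icc (0 : ℝ) 1)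
    (hf : HasFDerivWithinAt f L square (s, t)) :
    HasDerivWithinAt (fun τ => f (s, τ)) (L (0, 1)) (Icc 0 1) t := by
  have h : HasDerivWithinAt (fun τ : ℝ => (s, τ)) ((0 : ℝ), (1 : ℝ)) (Icc 0 1) t :=
    (hasDerivWithinAt_const t _ s).prodMk (hasDerivWithinAt_id t _)
  exact hf.comp_hasDerivWithinAt (f := fun τ : ℝ => (s, τ)) t h fun τ hτ => ⟨hs, hτ⟩

variable {c : ℝ → ℝ → M}

/-- `c` is a smooth map from the unit square to `M`. -/
def SmoothSquare (E : Type*) [NormedAddCommGroup E] [NormedSpace ℝ E] {M : Type*}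
    [TopologicalSpace M] [ChartedSpace E M] (c : ℝ → ℝ → M) : Prop :=
  ContMDiffOn 𝓘(ℝ, ℝ × ℝ) 𝓘(ℝ, E) ∞ (fun z : ℝ × ℝ => c z.1 z.2) square

theorem SmoothSquare.contMDiffOn_left (hc : SmoothSquare E c) {s : ℝ} (hs : s ∈ Icc (0 : ℝ) 1) :
    ContMDiffOn 𝓘(ℝ, ℝ) 𝓘(ℝ, E) ∞ (c s) (Icc 0 1) := by
  have h : ContMDiffOn 𝓘(ℝ, ℝ) 𝓘(ℝ, ℝ × ℝ) ∞ (fun τ : ℝ => (s, τ)) (Icc 0 1) :=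
    contMDiffOn_iff_contDiffOn.2 (contDiff_const.prodMk contDiff_id).contDiffOn
  exact ContMDiffOn.comp (f := fun τ : ℝ => (s, τ)) hc h fun τ hτ => ⟨hs, hτ⟩

theorem SmoothSquare.contMDiffOn_right (hc : SmoothSquare E c) {t : ℝ} (ht : t ∈ Icc (0 : ℝ) 1) :
    ContMDiffOn 𝓘(ℝ, ℝ) 𝓘(ℝ, E) ∞ (fun σ => c σ t) (Icc 0 1) := by
  have h : ContMDiffOn 𝓘(ℝ, ℝ) 𝓘(ℝ, ℝ × ℝ) ∞ (fun σ : ℝ => (σ, t)) (Icc 0 1) :=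
    contMDiffOn_iff_contDiffOn.2 (contDiff_id.prodMk contDiff_const).contDiffOn
  exact ContMDiffOn.comp (f := fun σ : ℝ => (σ, t)) hc h fun τ hτ => ⟨hτ, ht⟩

theorem SmoothSquare.mdiff_left (hc : SmoothSquare E c) {s t : ℝ} (hs : s ∈ Icc (0 : ℝ) 1)
    (ht : t ∈ Icc (0 : ℝ) 1) : MDifferentiableWithinAt 𝓘(ℝ, ℝ) 𝓘(ℝ, E) (c s) (Icc 0 1) t :=
  (hc.contMDiffOn_left hs t ht).mdifferentiableWithinAt (by simp)

theorem SmoothSquare.mdiff_right (hc : SmoothSquare E c) {s t : ℝ} (hs : s ∈ Icc (0 : ℝ) 1)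
    (ht : t ∈ Icc (0 : ℝ) 1) :
    MDifferentiableWithinAt 𝓘(ℝ, ℝ) 𝓘(ℝ, E) (fun σ => c σ t) (Icc 0 1) s :=
  (hc.contMDiffOn_right ht s hs).mdifferentiableWithinAt (by simp)

theorem SmoothSquare.eventually_mem_source (hc : SmoothSquare E c) {z : ℝ × ℝ} (hz : z ∈ square)
    {x₀ : M} (hx : c z.1 z.2 ∈ (extChartAt 𝓘(ℝ, E) x₀).source) :
    ∀ᶠ w in 𝓝[square] z, c w.1 w.2 ∈ (extChartAt 𝓘(ℝ, E) x₀).source :=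
  CurveSpace.eventually_mem_source (hc z hz).continuousWithinAt hx

variable (E) in
/-- A map from the square to `M`, read in the chart at `x₀`. -/
def chartSq (c : ℝ → ℝ → M) (x₀ : M) (z : ℝ × ℝ) : E := extChartAt 𝓘(ℝ, E) x₀ (c z.1 z.2)

variable (E) in
/-- The differential of a map from the square to `M`, read in the chart at `x₀`. -/
def chartSqD (c : ℝ → ℝ → M) (x₀ : M) (z : ℝ × ℝ) : ℝ × ℝ →L[ℝ] E :=
  fderivWithin ℝ (chartSq E c x₀) square z

variable (E) in
/-- The second differential of a map from the square to `M`, read in the chart at `x₀`. -/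
def chartSqDD (c : ℝ → ℝ → M) (x₀ : M) (z : ℝ × ℝ) : ℝ × ℝ →L[ℝ] ℝ × ℝ →L[ℝ] E :=
  fderivWithin ℝ (chartSqD E c x₀) square z

/-! ### Partial derivatives of a square in a chart, and vanishing torsion -/

section chart

variable {x₀ : M} {z : ℝ × ℝ}

theorem SmoothSquare.contDiffWithinAt (hc : SmoothSquare E c) (hz : z ∈ square)
    (hx : c z.1 z.2 ∈ (extChartAt 𝓘(ℝ, E) x₀).source) :
    ContDiffWithinAt ℝ ∞ (chartSq E c x₀) square z :=
  contDiffWithinAt_extChartAt_comp (hc z hz) hx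

theorem SmoothSquare.contDiffWithinAt_D (hc : SmoothSquare E c) (hz : z ∈ square)
    (hx : c z.1 z.2 ∈ (extChartAt 𝓘(ℝ, E) x₀).source) :
    ContDiffWithinAt ℝ ∞ (chartSqD E c x₀) square z :=
  (hc.contDiffWithinAt hz hx).fderivWithin_right uniqueDiffOn_square (by simp) hz

theorem SmoothSquare.contDiffWithinAt_DD (hc : SmoothSquare E c) (hz : z ∈ square)
    (hx : c z.1 z.2 ∈ (extChartAt 𝓘(ℝ, E) x₀).source) :
    ContDiffWithinAt ℝ ∞ (chartSqDD E c x₀) square z :=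
  (hc.contDiffWithinAt_D hz hx).fderivWithin_right uniqueDiffOn_square (by simp) hz

theorem SmoothSquare.hasFDerivWithinAt (hc : SmoothSquare E c) (hz : z ∈ square)
    (hx : c z.1 z.2 ∈ (extChartAt 𝓘(ℝ, E) x₀).source) :
    HasFDerivWithinAt (chartSq E c x₀) (chartSqD E c x₀ z) square z :=
  ((hc.contDiffWithinAt hz hx).differentiableWithinAt (by simp)).hasFDerivWithinAt

theorem SmoothSquare.hasFDerivWithinAt_D (hc : SmoothSquare E c) (hz : z ∈ square)
    (hx : c z.1 z.2 ∈ (extChartAt 𝓘(ℝ, E) x₀).source) :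
    HasFDerivWithinAt (chartSqD E c x₀) (chartSqDD E c x₀ z) square z :=
  ((hc.contDiffWithinAt_D hz hx).differentiableWithinAt (by simp)).hasFDerivWithinAt

theorem SmoothSquare.chartSqDD_symm (hc : SmoothSquare E c) (hz : z ∈ square)
    (hx : c z.1 z.2 ∈ (extChartAt 𝓘(ℝ, E) x₀).source) (u v : ℝ × ℝ) :
    chartSqDD E c x₀ z u v = chartSqDD E c x₀ z v u :=
  ((hc.contDiffWithinAt hz hx).isSymmSndFDerivWithinAt
    (by rw [minSmoothness_of_isRCLikeNormedField]; exact two_le_infty) uniqueDiffOn_square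
    (mem_closure_interior_square hz) hz).eq u v

theorem SmoothSquare.chartSqD_fst (hc : SmoothSquare E c) (hz : z ∈ square)
    (hx : c z.1 z.2 ∈ (extChartAt 𝓘(ℝ, E) x₀).source) :
    chartSqD E c x₀ z (1, 0) = coordMap x₀ (c z.1 z.2) (vel (fun σ => c σ z.2) z.1) :=
  (uniqueDiffWithinAt_unitIcc hz.1).eq_deriv _
    (hasDerivWithinAt_fst hz.2 (hc.hasFDerivWithinAt hz hx))
    (hasDerivWithinAt_extChartAt hz.1 (hc.mdiff_right hz.1 hz.2) hx)

theorem SmoothSquare.chartSqD_snd (hc : SmoothSquare E c) (hz : z ∈ square)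
    (hx : c z.1 z.2 ∈ (extChartAt 𝓘(ℝ, E) x₀).source) :
    chartSqD E c x₀ z (0, 1) = coordMap x₀ (c z.1 z.2) (vel (c z.1) z.2) :=
  (uniqueDiffWithinAt_unitIcc hz.2).eq_deriv _
    (hasDerivWithinAt_snd hz.1 (hc.hasFDerivWithinAt hz hx))
    (hasDerivWithinAt_extChartAt hz.2 (hc.mdiff_left hz.1 hz.2) hx)

theorem tendsto_left {s t : ℝ} (hs : s ∈ Icc (0 : ℝ) 1) :
    Tendsto (fun τ : ℝ => (s, τ)) (𝓝[Icc 0 1] t) (𝓝[square] (s, t)) :=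
  tendsto_nhdsWithin_of_tendsto_nhds_of_eventually_within _
    ((Continuous.prodMk_right s).tendsto t |>.mono_left nhdsWithin_le_nhds)
    (by filter_upwards [self_mem_nhdsWithin] with τ hτ using ⟨hs, hτ⟩)

theorem tendsto_right {s t : ℝ} (ht : t ∈ Icc (0 : ℝ) 1) :
    Tendsto (fun σ : ℝ => (σ, t)) (𝓝[Icc 0 1] s) (𝓝[square] (s, t)) :=
  tendsto_nhdsWithin_of_tendsto_nhds_of_eventually_within _
    ((Continuous.prodMk_left t).tendsto s |>.mono_left nhdsWithin_le_nhds)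
    (by filter_upwards [self_mem_nhdsWithin] with τ hτ using ⟨hτ, ht⟩)

/-- The derivative `∇_s c_t`, in a chart. -/
theorem SmoothSquare.cov_velT (hc : SmoothSquare E c) (g : RMetric E M) {s t : ℝ}
    (hs : s ∈ Icc (0 : ℝ) 1) (ht : t ∈ Icc (0 : ℝ) 1)
    (hx : c s t ∈ (extChartAt 𝓘(ℝ, E) x₀).source) :
    FieldDiff (fun σ => c σ t) (fun σ => vel (c σ) t : ℝ → E) s ∧
      coordMap x₀ (c s t) (cov g (fun σ => c σ t) (fun σ => vel (c σ) t) s) =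
        chartSqDD E c x₀ (s, t) (1, 0) (0, 1) + christoffelL g x₀ (chartSq E c x₀ (s, t))
          (chartSqD E c x₀ (s, t) (1, 0)) (chartSqD E c x₀ (s, t) (0, 1)) := by
  have hz : (s, t) ∈ square := ⟨hs, ht⟩
  have h1 := hasDerivWithinAt_fst ht (hc.hasFDerivWithinAt_D hz hx)
  have h2 := h1.clm_apply (hasDerivWithinAt_const s _ ((0 : ℝ), (1 : ℝ)))
  rw [map_zero, add_zero] at h2
  have h3 := cov_coord g hs (hc.mdiff_right hs ht) hx
    (h2.congr_of_eventuallyEq_of_mem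
      (f₁ := coordF (fun σ => c σ t) (fun σ => vel (c σ) t : ℝ → E) x₀) (by
        filter_upwards [(tendsto_right ht).eventually (hc.eventually_mem_source hz hx),
          self_mem_nhdsWithin] with σ hσ hσ'
        exact (hc.chartSqD_snd (z := (σ, t)) ⟨hσ', ht⟩ hσ).symm) hs)
  rw [hc.chartSqD_snd hz hx, hc.chartSqD_fst hz hx]
  exact h3

/-- The derivative `∇_t c_s`, in a chart. -/
theorem SmoothSquare.cov_velS (hc : SmoothSquare E c) (g : RMetric E M) {s t : ℝ}
    (hs : s ∈ Icc (0 : ℝ) 1) (ht : t ∈ Icc (0 : ℝ) 1)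
    (hx : c s t ∈ (extChartAt 𝓘(ℝ, E) x₀).source) :
    FieldDiff (c s) (fun τ => vel (fun σ => c σ τ) s : ℝ → E) t ∧
      coordMap x₀ (c s t) (cov g (c s) (fun τ => vel (fun σ => c σ τ) s) t) =
        chartSqDD E c x₀ (s, t) (0, 1) (1, 0) + christoffelL g x₀ (chartSq E c x₀ (s, t))
          (chartSqD E c x₀ (s, t) (0, 1)) (chartSqD E c x₀ (s, t) (1, 0)) := by
  have hz : (s, t) ∈ square := ⟨hs, ht⟩
  have h1 := hasDerivWithinAt_snd hs (hc.hasFDerivWithinAt_D hz hx)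
  have h2 := h1.clm_apply (hasDerivWithinAt_const t _ ((1 : ℝ), (0 : ℝ)))
  rw [map_zero, add_zero] at h2
  have h3 := cov_coord g ht (hc.mdiff_left hs ht) hx
    (h2.congr_of_eventuallyEq_of_mem
      (f₁ := coordF (c s) (fun τ => vel (fun σ => c σ τ) s : ℝ → E) x₀) (by
        filter_upwards [(tendsto_left hs).eventually (hc.eventually_mem_source hz hx),
          self_mem_nhdsWithin] with τ hτ hτ'
        exact (hc.chartSqD_fst (z := (s, τ)) ⟨hs, hτ'⟩ hτ).symm) ht)
  rw [hc.chartSqD_snd hz hx, hc.chartSqD_fst hz hx]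
  exact h3

/-- The Levi-Civita connection has no torsion: `∇_s c_t = ∇_t c_s`. -/
theorem SmoothSquare.cov_velT_eq (hc : SmoothSquare E c) (g : RMetric E M) {s t : ℝ}
    (hs : s ∈ Icc (0 : ℝ) 1) (ht : t ∈ Icc (0 : ℝ) 1) :
    cov g (fun σ => c σ t) (fun σ => vel (c σ) t) s =
      cov g (c s) (fun τ => vel (fun σ => c σ τ) s) t := by
  have hx := mem_extChartAt_source (I := 𝓘(ℝ, E)) (c s t)
  have hz : (s, t) ∈ square := ⟨hs, ht⟩
  apply coordMap_inj hx
  rw [(hc.cov_velT g hs ht hx).2, (hc.cov_velS g hs ht hx).2, hc.chartSqDD_symm hz hx,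
    christoffelL_symm g _ (y := chartSq E c (c s t) (s, t)) ((extChartAt 𝓘(ℝ, E) (c s t)).map_source hx)]

end chart

/-- A field of tangent vectors along the square with continuous coordinates at `z`. -/
def ContField (c : ℝ → ℝ → M) (X : ℝ × ℝ → E) (z : ℝ × ℝ) : Prop :=
  ContinuousWithinAt (fun w => coordMap (c z.1 z.2) (c w.1 w.2) (X w)) square z

/-- `innerE` uses the identification of each tangent space with `E` at its own point, which need not
vary continuously; the inner product is therefore rewritten in the fixed chart at `c z.1 z.2`. -/
theorem ContField.innerE (hc : SmoothSquare E c) (g : RMetric E M) {X Z : ℝ × ℝ → E} {z : ℝ × ℝ}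
    (hz : z ∈ square) (hX : ContField c X z) (hZ : ContField c Z z) :
    ContinuousWithinAt (fun w => innerE g (c w.1 w.2) (X w) (Z w)) square z := by
  have hx := mem_extChartAt_source (I := 𝓘(ℝ, E)) (c z.1 z.2)
  have h1 : ContinuousWithinAt (fun w => chartMetric g (c z.1 z.2) (chartSq E c (c z.1 z.2) w))
      square z :=
    (contDiffAt_chartMetric g (c z.1 z.2)
      ((extChartAt 𝓘(ℝ, E) _).map_source hx)).continuousAt.comp_continuousWithinAt
      (f := chartSq E c (c z.1 z.2)) (hc.contDiffWithinAt hz hx).continuousWithinAt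
  refine ((h1.clm_apply hX).clm_apply hZ).congr_of_eventuallyEq_of_mem ?_ hz
  filter_upwards [hc.eventually_mem_source hz hx] with w hw
  exact (chartMetric_coordMap g hw _ _).symm

theorem SmoothSquare.contField_velT (hc : SmoothSquare E c) {z : ℝ × ℝ} (hz : z ∈ square) :
    ContField c (fun w => vel (c w.1) w.2 : ℝ × ℝ → E) z := by
  have hx := mem_extChartAt_source (I := 𝓘(ℝ, E)) (c z.1 z.2)
  refine ((hc.contDiffWithinAt_D hz hx).continuousWithinAt.clm_apply
    (continuousWithinAt_const (b := ((0 : ℝ), (1 : ℝ))))).congr_of_eventuallyEq_of_mem ?_ hz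
  filter_upwards [hc.eventually_mem_source hz hx, self_mem_nhdsWithin] with w hw hw'
  exact (hc.chartSqD_snd hw' hw).symm

theorem SmoothSquare.contField_velS (hc : SmoothSquare E c) {z : ℝ × ℝ} (hz : z ∈ square) :
    ContField c (fun w => vel (fun σ => c σ w.2) w.1 : ℝ × ℝ → E) z := by
  have hx := mem_extChartAt_source (I := 𝓘(ℝ, E)) (c z.1 z.2)
  refine ((hc.contDiffWithinAt_D hz hx).continuousWithinAt.clm_apply
    (continuousWithinAt_const (b := ((1 : ℝ), (0 : ℝ))))).congr_of_eventuallyEq_of_mem ?_ hz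
  filter_upwards [hc.eventually_mem_source hz hx, self_mem_nhdsWithin] with w hw hw'
  exact (hc.chartSqD_fst hw' hw).symm

theorem SmoothSquare.contDiffWithinAt_christoffelL (hc : SmoothSquare E c) (g : RMetric E M)
    {z : ℝ × ℝ} (hz : z ∈ square) {x₀ : M} (hx : c z.1 z.2 ∈ (extChartAt 𝓘(ℝ, E) x₀).source) :
    ContDiffWithinAt ℝ ∞ (fun w => christoffelL g x₀ (chartSq E c x₀ w)) square z :=
  (contDiffAt_christoffelL g x₀
    ((extChartAt 𝓘(ℝ, E) x₀).map_source hx)).comp_contDiffWithinAt (f := chartSq E c x₀) z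
    (hc.contDiffWithinAt hz hx)

theorem SmoothSquare.contField_cov_velT (hc : SmoothSquare E c) (g : RMetric E M) {z : ℝ × ℝ}
    (hz : z ∈ square) :
    ContField c (fun w => cov g (fun σ => c σ w.2) (fun σ => vel (c σ) w.2) w.1) z := by
  have hx := mem_extChartAt_source (I := 𝓘(ℝ, E)) (c z.1 z.2)
  have hD := (hc.contDiffWithinAt_D hz hx).continuousWithinAt
  have h1 := ((hc.contDiffWithinAt_DD hz hx).continuousWithinAt.clm_apply
    (continuousWithinAt_const (b := ((1 : ℝ), (0 : ℝ))))).clm_apply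
    (continuousWithinAt_const (b := ((0 : ℝ), (1 : ℝ))))
  have h2 := ((hc.contDiffWithinAt_christoffelL g hz hx).continuousWithinAt.clm_apply
    (hD.clm_apply (continuousWithinAt_const (b := ((1 : ℝ), (0 : ℝ)))))).clm_apply
    (hD.clm_apply (continuousWithinAt_const (b := ((0 : ℝ), (1 : ℝ)))))
  refine (h1.add h2).congr_of_eventuallyEq_of_mem ?_ hz
  filter_upwards [hc.eventually_mem_source hz hx, self_mem_nhdsWithin] with w hw hw'
  exact (hc.cov_velT g hw'.1 hw'.2 hw).2

end

/-! ### The square root velocity function and its density -/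

section


variable {E : Type*} [NormedAddCommGroup E] [NormedSpace ℝ E]
  {M : Type*} [TopologicalSpace M] [ChartedSpace E M] [IsManifold 𝓘(ℝ, E) ∞ M]

variable [FiniteDimensional ℝ E] {c : ℝ → ℝ → M}

/-- The Riemannian norm on the model space, at a point of `M`. -/
def normE (g : RMetric E M) (p : M) (u : E) : ℝ := √(innerE g p u u)

theorem normE_sq (g : RMetric E M) (p : M) (u : E) : normE g p u ^ 2 = innerE g p u u :=
  Real.sq_sqrt (innerE_self_nonneg g p u)

theorem normE_pos (g : RMetric E M) (p : M) {u : E} (hu : u ≠ 0) : 0 < normE g p u :=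
  Real.sqrt_pos.2 (innerE_pos g p hu)

/-- The square root velocity function of a curve, with values in the model space. -/
def srv (g : RMetric E M) (γ : ℝ → M) (t : ℝ) : E := (√(normE g (γ t) (vel γ t)))⁻¹ • vel γ t

/-- The density `(‖D‖² - (3/4) ⟨D, v⟩²) / ‖c_t‖`, where `D = ∇_s c_t` and `v = c_t / ‖c_t‖`. -/
def density (g : RMetric E M) (c : ℝ → ℝ → M) (z : ℝ × ℝ) : ℝ :=
  (normE g (c z.1 z.2) (vel (c z.1) z.2))⁻¹ *
    (innerE g (c z.1 z.2) (cov g (fun σ => c σ z.2) (fun σ => vel (c σ) z.2) z.1)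
        (cov g (fun σ => c σ z.2) (fun σ => vel (c σ) z.2) z.1) -
      3 / 4 * innerE g (c z.1 z.2) (cov g (fun σ => c σ z.2) (fun σ => vel (c σ) z.2) z.1)
        (vel (c z.1) z.2) ^ 2 / normE g (c z.1 z.2) (vel (c z.1) z.2) ^ 2)

theorem SmoothSquare.continuousOn_density (hc : SmoothSquare E c) (g : RMetric E M)
    (himm : ∀ s ∈ Icc (0 : ℝ) 1, ∀ t ∈ Icc (0 : ℝ) 1, (vel (c s) t : E) ≠ 0) :
    ContinuousOn (density g c) square := by
  intro z hz
  have hn : normE g (c z.1 z.2) (vel (c z.1) z.2) ≠ 0 :=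
    (normE_pos g _ (himm z.1 hz.1 z.2 hz.2)).ne'
  have h1 : ContinuousWithinAt (fun z : ℝ × ℝ => normE g (c z.1 z.2) (vel (c z.1) z.2)) square z :=
    (ContField.innerE hc g hz (hc.contField_velT hz) (hc.contField_velT hz)).sqrt
  have h2 := ContField.innerE hc g hz (hc.contField_cov_velT g hz) (hc.contField_cov_velT g hz)
  have h3 := ContField.innerE hc g hz (hc.contField_cov_velT g hz) (hc.contField_velT hz)
  exact (h1.inv₀ hn).mul
    (h2.sub ((continuousWithinAt_const.mul (h3.pow 2)).div (h1.pow 2) (pow_ne_zero 2 hn)))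

/-- The factor `‖c_t‖^(-1/2)` is differentiated through metric compatibility. It removes half of the
tangential part of `D`, which leaves a quarter of its square: this is the weight 1/4 in the Sobolev
metric. -/
theorem SmoothSquare.cov_srv (hc : SmoothSquare E c) (g : RMetric E M) {s t : ℝ}
    (hs : s ∈ Icc (0 : ℝ) 1) (ht : t ∈ Icc (0 : ℝ) 1) (h0 : (vel (c s) t : E) ≠ 0) :
    FieldDiff (fun σ => c σ t) (fun σ => srv g (c σ) t) s ∧
      innerE g (c s t) (cov g (fun σ => c σ t) (fun σ => srv g (c σ) t) s)
        (cov g (fun σ => c σ t) (fun σ => srv g (c σ) t) s) = density g c (s, t) := by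
  have hx := mem_extChartAt_source (I := 𝓘(ℝ, E)) (c s t)
  have hmd := hc.mdiff_right hs ht
  obtain ⟨hT, -⟩ := hc.cov_velT g hs ht hx
  have hr := hasDerivWithinAt_innerE g hs hmd hT hT
  unfold density
  dsimp only
  set D := cov g (fun σ => c σ t) (fun σ => vel (c σ) t) s with hD
  set v : E := vel (c s) t with hv
  set n := normE g (c s t) v with hndef
  have hn : 0 < n := normE_pos g _ h0
  have hn' : innerE g (c s t) v v ≠ 0 := (innerE_pos g _ h0).ne'
  have hsqn : 0 < √n := Real.sqrt_pos.2 hn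
  have h1 := ((hr.sqrt hn').sqrt (Real.sqrt_ne_zero'.2 (innerE_pos g _ h0))).inv
    (Real.sqrt_ne_zero'.2 hn)
  obtain ⟨h2, h3⟩ := fieldDiff_cov_smul (g := g) hs hmd h1 hT
  refine ⟨h2, ?_⟩
  have h4 : cov g (fun σ => c σ t) (fun σ => srv g (c σ) t) s =
      (√n)⁻¹ • (D - (innerE g (c s t) D v / (2 * n ^ 2)) • v) := by
    refine h3.trans ?_
    change (_ : ℝ) • v + (√n)⁻¹ • D = _
    rw [smul_sub, sub_eq_neg_add, smul_smul, ← neg_smul]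
    congr 2
    change -((innerE g (c s t) D v + innerE g (c s t) v D) / (2 * n) / (2 * √n)) / (√n) ^ 2 = _
    rw [innerE_symm g _ v D, Real.sq_sqrt hn.le]
    field_simp
    ring
  rw [h4]
  simp only [map_smul, map_sub, smul_apply, sub_apply, smul_eq_mul]
  have h5 : innerE g (c s t) v v = n ^ 2 := (normE_sq g _ _).symm
  rw [innerE_symm g _ v D, h5]
  have h6 : (√n)⁻¹ * (√n)⁻¹ = n⁻¹ := by rw [← mul_inv, Real.mul_self_sqrt hn.le]
  rw [← h6]
  generalize (√n)⁻¹ = e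
  field_simp
  ring

/-- Vanishing torsion turns `∇_t c_s` into `∇_s c_t`; splitting off the tangential part with weight
1/4 then gives the coefficient `-3/4 = -1 + 1/4`. -/
theorem SmoothSquare.sobolevIntegrand_eq (hc : SmoothSquare E c) (g : RMetric E M) {s t : ℝ}
    (hs : s ∈ Icc (0 : ℝ) 1) (ht : t ∈ Icc (0 : ℝ) 1) (h0 : (vel (c s) t : E) ≠ 0) :
    sobolevIntegrand (E := E) g (c s) (derivS c s) (derivS c s) t = density g c (s, t) := by
  have hD := hc.cov_velT_eq g hs ht
  unfold density
  dsimp only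
  rw [hD]
  set D := cov g (c s) (fun τ => vel (fun σ => c σ τ) s) t with hDdef
  set v : E := vel (c s) t with hv
  set n := normE g (c s t) v with hndef
  have hn : 0 < n := normE_pos g _ h0
  have h5 : innerE g (c s t) v v = n ^ 2 := (normE_sq g _ _).symm
  change (innerE g (c s t)
      (n⁻¹ • D - innerE g (c s t) (n⁻¹ • D) (n⁻¹ • v) • (n⁻¹ • v))
      (n⁻¹ • D - innerE g (c s t) (n⁻¹ • D) (n⁻¹ • v) • (n⁻¹ • v)) +
    1 / 4 * innerE g (c s t) (innerE g (c s t) (n⁻¹ • D) (n⁻¹ • v) • (n⁻¹ • v))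
      (innerE g (c s t) (n⁻¹ • D) (n⁻¹ • v) • (n⁻¹ • v))) * n = _
  simp only [map_smul, map_sub, smul_apply, sub_apply, smul_eq_mul]
  rw [innerE_symm g _ v D, h5]
  field_simp
  ring

/-- A function continuous on the unit square is integrable in each variable, and its partial
integral is continuous. -/
theorem continuousOn_integral_square {f : ℝ × ℝ → ℝ} (hf : ContinuousOn f square) :
    ContinuousOn (fun s => ∫ t in (0 : ℝ)..1, f (s, t)) (Icc 0 1) := by
  -- Clamping both variables to `[0, 1]` extends `f` continuously to the plane without changing the
  -- integrals in question.
  set p : ℝ → ℝ := fun s => (projIcc 0 1 zero_le_one s : ℝ)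
  have hp : Continuous p := continuous_subtype_val.comp continuous_projIcc
  have hpm : ∀ s, p s ∈ Icc (0 : ℝ) 1 := fun s => (projIcc 0 1 zero_le_one s).2
  have hpe : ∀ s ∈ Icc (0 : ℝ) 1, p s = s := fun s hs => by
    simp [p, projIcc_of_mem zero_le_one hs]
  have h1 : Continuous (Function.uncurry fun s t => f (p s, p t)) := by
    have := hf.comp_continuous (f := fun z : ℝ × ℝ => (p z.1, p z.2))
      ((hp.comp continuous_fst).prodMk (hp.comp continuous_snd)) fun z => ⟨hpm _, hpm _⟩
    exact this
  have h2 := intervalIntegral.continuous_parametric_intervalIntegral_of_continuous' (μ := volume) h1 0 1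
  refine h2.continuousOn.congr fun s hs => ?_
  refine intervalIntegral.integral_congr fun t ht => ?_
  rw [uIcc_of_le zero_le_one] at ht
  simp only [hpe s hs, hpe t ht]

theorem intervalIntegrable_square {f : ℝ × ℝ → ℝ} (hf : ContinuousOn f square) {s : ℝ}
    (hs : s ∈ Icc (0 : ℝ) 1) : IntervalIntegrable (fun t => f (s, t)) volume 0 1 := by
  refine ContinuousOn.intervalIntegrable ?_
  rw [uIcc_of_le zero_le_one]
  exact hf.comp (by fun_prop) fun t ht => ⟨hs, ht⟩

theorem intervalIntegrable_congr_Icc {f f' : ℝ → ℝ} (h : ∀ t ∈ Icc (0 : ℝ) 1, f t = f' t)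
    (hf : IntervalIntegrable f volume 0 1) : IntervalIntegrable f' volume 0 1 :=
  hf.congr fun t ht => h t (Ioc_subset_Icc_self (by simpa [uIoc_of_le] using ht))

end

/-! ### Curvature and families of parallel fields -/

section


variable {E : Type*} [NormedAddCommGroup E] [NormedSpace ℝ E]
  {M : Type*} [TopologicalSpace M] [ChartedSpace E M] [IsManifold 𝓘(ℝ, E) ∞ M]

variable [FiniteDimensional ℝ E] {c : ℝ → ℝ → M}

/-- Uniform differentiability with respect to a parameter on a compact rectangle. -/
theorem eventually_norm_sub_le_of_continuousOn {F : Type*} [NormedAddCommGroup F] [NormedSpace ℝ F]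
    {f f₁ : ℝ × ℝ → F} {a₀ a₁ α β s : ℝ} (hs : s ∈ Icc a₀ a₁)
    (hf : ∀ a ∈ Icc a₀ a₁, ∀ τ ∈ Icc α β,
      HasDerivWithinAt (fun a => f (a, τ)) (f₁ (a, τ)) (Icc a₀ a₁) a)
    (hf₁ : ContinuousOn f₁ (Icc a₀ a₁ ×ˢ Icc α β)) {ε : ℝ} (hε : 0 < ε) :
    ∀ᶠ a in 𝓝[Icc a₀ a₁] s, ∀ τ ∈ Icc α β,
      ‖f (a, τ) - f (s, τ) - (a - s) • f₁ (s, τ)‖ ≤ ε * |a - s| := by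
  have huc := (isCompact_Icc.prod isCompact_Icc).uniformContinuousOn_of_continuous hf₁
  obtain ⟨δ, hδ, h⟩ := Metric.uniformContinuousOn_iff.1 huc ε hε
  filter_upwards [self_mem_nhdsWithin, mem_nhdsWithin_of_mem_nhds (Metric.ball_mem_nhds s hδ)]
    with a ha hb τ hτ
  -- The first-order remainder has derivative `f₁ (x, τ) - f₁ (s, τ)`. Uniform continuity bounds it
  -- with one `δ` for all `τ`, and the mean value inequality concludes.
  have h1 : ∀ x ∈ Icc a₀ a₁ ∩ Metric.ball s δ,
      HasDerivWithinAt (fun a => f (a, τ) - (a - s) • f₁ (s, τ)) (f₁ (x, τ) - f₁ (s, τ))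
        (Icc a₀ a₁ ∩ Metric.ball s δ) x := by
    intro x hx
    have h2 := (((hasDerivWithinAt_id x (Icc a₀ a₁)).sub_const s).smul_const (f₁ (s, τ)))
    rw [one_smul] at h2
    exact ((hf x hx.1 τ hτ).sub h2).mono inter_subset_left
  have h3 := Convex.norm_image_sub_le_of_norm_hasDerivWithin_le (C := ε) h1
    (fun x hx => by
      rw [← dist_eq_norm]
      refine (h (x, τ) ⟨hx.1, hτ⟩ (s, τ) ⟨hs, hτ⟩ ?_).le
      rw [Prod.dist_eq, dist_self]
      exact max_lt hx.2 hδ)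
    ((convex_Icc _ _).inter (convex_ball _ _)) ⟨hs, Metric.mem_ball_self hδ⟩ ⟨ha, hb⟩
  rw [sub_self, zero_smul, sub_zero, Real.norm_eq_abs] at h3
  rwa [sub_right_comm]

/-- The curvature tensor in the coordinates of the chart at `x₀`. -/
def curvL (g : RMetric E M) (x₀ : M) (y u v w : E) : E :=
  fderiv ℝ (christoffelL g x₀) y u v w - fderiv ℝ (christoffelL g x₀) y v u w
    + christoffelL g x₀ y u (christoffelL g x₀ y v w)
    - christoffelL g x₀ y v (christoffelL g x₀ y u w)

theorem curvature_eq (g : RMetric E M) (x : M) (u v w : E) :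
    (curvature (E := E) g x u v w : E) = curvL g x (extChartAt 𝓘(ℝ, E) x x) u v w := by
  have hy := (extChartAt 𝓘(ℝ, E) x).map_source (mem_extChartAt_source x)
  have hd := ((contDiffAt_christoffelL g x hy).differentiableAt (by simp)).hasFDerivAt
  have h : ∀ a b d : E, fderiv ℝ (fun y => christoffel g x y a b) (extChartAt 𝓘(ℝ, E) x x) d =
      fderiv ℝ (christoffelL g x) (extChartAt 𝓘(ℝ, E) x x) d a b := by
    intro a b d
    simp only [christoffel_eq]
    have := (hd.clm_apply (hasFDerivAt_const a _)).clm_apply (hasFDerivAt_const b _)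
    rw [this.fderiv]
    simp
  unfold curvL
  rw [← h, ← h]
  simp only [← christoffel_eq]
  rfl

/-- A property of points of `[0, 1]` that propagates locally and holds at `0` holds everywhere. -/
theorem forall_unitIcc_of_local {P : ℝ → Prop} (h0 : P 0)
    (hloc : ∀ t ∈ Icc (0 : ℝ) 1, ∃ ε > 0, ∀ t₀ ∈ Icc (0 : ℝ) 1 ∩ Metric.ball t ε, P t₀ →
      ∀ τ ∈ Icc (0 : ℝ) 1 ∩ Metric.ball t ε, P τ) :
    ∀ t ∈ Icc (0 : ℝ) 1, P t := by
  choose! ε hε hloc using hloc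
  obtain ⟨δ, hδ, hleb⟩ := lebesgue_number_lemma_of_metric (s := Icc (0 : ℝ) 1)
    (c := fun t : Icc (0 : ℝ) 1 => Metric.ball (t : ℝ) (ε t)) isCompact_Icc
    (fun _ => Metric.isOpen_ball)
    (fun t ht => mem_iUnion.2 ⟨⟨t, ht⟩, Metric.mem_ball_self (hε t ht)⟩)
  -- Steps of length `δ / 2`, strictly below the Lebesgue number, keep the old and the new time
  -- inside one ball of the cover.
  have hP : ∀ n : ℕ, ∀ t ∈ Icc (0 : ℝ) 1, t < (n + 1) * (δ / 2) → P t := by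
    have step : ∀ t' ∈ Icc (0 : ℝ) 1, ∀ t ∈ Icc (0 : ℝ) 1, |t' - t| < δ → P t' → P t := by
      intro t' ht' t ht hd hP
      obtain ⟨i, hi⟩ := hleb t ht
      exact hloc i i.2 t' ⟨ht', hi (by rwa [Metric.mem_ball, Real.dist_eq])⟩ hP t
        ⟨ht, hi (Metric.mem_ball_self hδ)⟩
    intro n
    induction n with
    | zero =>
      intro t ht h
      refine step 0 (by simp) t ht ?_ h0
      rw [abs_lt]
      simp at h
      constructor <;> linarith [ht.1]
    | succ n ih =>
      intro t ht h
      push_cast at h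
      have h1 : max 0 (t - δ / 2) ∈ Icc (0 : ℝ) 1 :=
        ⟨le_max_left _ _, max_le zero_le_one (by linarith [ht.2])⟩
      have h2 : max 0 (t - δ / 2) < (n + 1) * (δ / 2) :=
        max_lt (by positivity) (by linarith)
      refine step _ h1 t ht ?_ (ih _ h1 h2)
      have h3 : t - δ / 2 ≤ max 0 (t - δ / 2) := le_max_right _ _
      have h4 : max 0 (t - δ / 2) ≤ t := max_le ht.1 (by linarith)
      rw [abs_lt]
      constructor <;> linarith
  intro t ht
  obtain ⟨n, hn⟩ := exists_nat_gt (1 / (δ / 2))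
  refine hP n t ht ?_
  rw [div_lt_iff₀ (by positivity)] at hn
  nlinarith [ht.2]

/-- Local form of the differentiability of families of parallel vector fields. -/
theorem SmoothSquare.fieldDiff_family_local (hc : SmoothSquare E c) (g : RMetric E M)
    {U : ℝ → ℝ → E} (hU : ∀ a ∈ Icc (0 : ℝ) 1, ∀ τ ∈ Icc (0 : ℝ) 1, ParAt g (c a) (U a) τ)
    {s : ℝ} (hs : s ∈ Icc (0 : ℝ) 1) {t : ℝ} (ht : t ∈ Icc (0 : ℝ) 1) :
    ∃ ε > 0, ∀ t₀ ∈ Icc (0 : ℝ) 1 ∩ Metric.ball t ε,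
      FieldDiff (fun a => c a t₀) (fun a => U a t₀) s → ∀ τ ∈ Icc (0 : ℝ) 1 ∩ Metric.ball t ε,
        c s τ ∈ (extChartAt 𝓘(ℝ, E) (c s t)).source ∧
        FieldDiff (fun a => c a τ) (fun a => U a τ) s ∧
        FieldDiff (c s) (fun τ => cov g (fun a => c a τ) (fun a => U a τ) s) τ ∧
        coordMap (c s t) (c s τ)
            (cov g (c s) (fun τ => cov g (fun a => c a τ) (fun a => U a τ) s) τ) =
          curvL g (c s t) (chartSq E c (c s t) (s, τ)) (chartSqD E c (c s t) (s, τ) (0, 1))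
            (chartSqD E c (c s t) (s, τ) (1, 0)) (coordF (c s) (U s) (c s t) τ) := by
  set x₀ := c s t with hx₀
  have hsrc := mem_extChartAt_source (I := 𝓘(ℝ, E)) (c s t)
  have hst : (s, t) ∈ square := ⟨hs, ht⟩
  set Γ : ℝ × ℝ → E →L[ℝ] E →L[ℝ] E := fun z => christoffelL g x₀ (chartSq E c x₀ z) with hΓ
  set Y := chartSqD E c x₀
  set B : ℝ × ℝ → E →L[ℝ] E := fun z => -Γ z (Y z (0, 1)) with hB
  have hBs : ∀ z ∈ square, c z.1 z.2 ∈ (extChartAt 𝓘(ℝ, E) x₀).source →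
      ContDiffWithinAt ℝ ∞ B square z := fun z hz hx =>
    ((hc.contDiffWithinAt_christoffelL g hz hx).clm_apply
      ((hc.contDiffWithinAt_D hz hx).clm_apply contDiffWithinAt_const)).neg
  set C := ‖B (s, t)‖ + 1 with hC
  have hC0 : 0 < C := by positivity
  obtain ⟨r, hr, hrB⟩ : ∃ r > 0, ∀ z ∈ square ∩ Metric.ball (s, t) r,
      c z.1 z.2 ∈ (extChartAt 𝓘(ℝ, E) x₀).source ∧ ‖B z‖ ≤ C := by
    have e1 := (hc.eventually_mem_source hst hsrc).and
      ((hBs _ hst hsrc).continuousWithinAt.norm.eventually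
        (Iic_mem_nhds (show ‖B (s, t)‖ < C by linarith)))
    obtain ⟨r, hr, h⟩ := Metric.mem_nhdsWithin_iff.1 e1
    exact ⟨r, hr, fun τ hτ => h ⟨hτ.2, hτ.1⟩⟩
  refine ⟨min (r / 2) (1 / (4 * C)), by positivity, ?_⟩
  set ε := min (r / 2) (1 / (4 * C)) with hε
  have hε0 : 0 < ε := by positivity
  have hεr : ε < r := (min_le_left _ _).trans_lt (by linarith)
  have hεC : C * (2 * ε) ≤ 1 / 2 := by
    have : ε ≤ 1 / (4 * C) := min_le_right _ _
    have h2 : C * (2 * (1 / (4 * C))) = 1 / 2 := by field_simp; norm_num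
    nlinarith
  set α := max 0 (t - ε)
  set β := min 1 (t + ε)
  set a₀ := max 0 (s - ε)
  set a₁ := min 1 (s + ε)
  have hαβ : ∀ τ, τ ∈ Icc α β ↔ τ ∈ Icc (0 : ℝ) 1 ∧ τ ∈ Icc (t - ε) (t + ε) := by
    intro τ
    simp only [α, β, mem_Icc, max_le_iff, le_min_iff]
    tauto
  have haa : ∀ τ, τ ∈ Icc a₀ a₁ ↔ τ ∈ Icc (0 : ℝ) 1 ∧ τ ∈ Icc (s - ε) (s + ε) := by
    intro τ
    simp only [a₀, a₁, mem_Icc, max_le_iff, le_min_iff]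
    tauto
  have hbox : Icc a₀ a₁ ×ˢ Icc α β ⊆ square ∩ Metric.ball (s, t) r := by
    rintro ⟨a, τ⟩ ⟨ha, hτ⟩
    rw [haa] at ha
    rw [hαβ] at hτ
    refine ⟨⟨ha.1, hτ.1⟩, ?_⟩
    rw [Metric.mem_ball, Prod.dist_eq, max_lt_iff, Real.dist_eq, Real.dist_eq, abs_lt, abs_lt]
    refine ⟨⟨?_, ?_⟩, ?_, ?_⟩ <;> linarith [hτ.2.1, hτ.2.2, ha.2.1, ha.2.2]
  have hsA : s ∈ Icc a₀ a₁ := (haa s).2 ⟨hs, by linarith, by linarith⟩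
  have hAn : Icc a₀ a₁ ∈ 𝓝[Icc 0 1] s := by
    filter_upwards [self_mem_nhdsWithin, mem_nhdsWithin_of_mem_nhds
      (Icc_mem_nhds (show s - ε < s by linarith) (show s < s + ε by linarith))] with τ' h1 h2
    exact (haa τ').2 ⟨h1, h2⟩
  have hAJ : Icc a₀ a₁ ⊆ Icc 0 1 := fun a ha => ((haa a).1 ha).1
  have hTJ : Icc α β ⊆ Icc 0 1 := fun a ha => ((hαβ a).1 ha).1
  have hball : ∀ τ ∈ Icc (0 : ℝ) 1 ∩ Metric.ball t ε, τ ∈ Icc α β := by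
    rintro τ ⟨hτ, hb⟩
    rw [Metric.mem_ball, Real.dist_eq, abs_lt] at hb
    rw [hαβ]
    exact ⟨hτ, by linarith, by linarith⟩
  have hTn : ∀ τ ∈ Icc (0 : ℝ) 1 ∩ Metric.ball t ε, Icc α β ∈ 𝓝[Icc 0 1] τ := by
    intro τ hτ
    filter_upwards [self_mem_nhdsWithin, mem_nhdsWithin_of_mem_nhds
      (Metric.isOpen_ball.mem_nhds hτ.2)] with τ' h1 h2
    exact hball τ' ⟨h1, h2⟩
  have hlen : C * (β - α) ≤ 1 / 2 := by
    have h1 : β ≤ t + ε := min_le_right _ _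
    have h2 : t - ε ≤ α := le_max_right _ _
    nlinarith
  intro t₀ ht₀ hdiff
  have hbx : ∀ a ∈ Icc a₀ a₁, ∀ τ ∈ Icc α β, (a, τ) ∈ square ∧
      c a τ ∈ (extChartAt 𝓘(ℝ, E) x₀).source ∧ ‖B (a, τ)‖ ≤ C := fun a ha τ hτ =>
    ⟨(hbox ⟨ha, hτ⟩).1, hrB (a, τ) (hbox ⟨ha, hτ⟩)⟩
  -- the derivative of the coefficients with respect to the parameter
  set B₁ : ℝ × ℝ → E →L[ℝ] E := fun z => fderivWithin ℝ B square z (1, 0) with hB₁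
  have hB₁c : ContinuousOn B₁ (Icc a₀ a₁ ×ˢ Icc α β) := by
    rintro ⟨a, τ⟩ ⟨ha, hτ⟩
    obtain ⟨h1, h2, -⟩ := hbx a ha τ hτ
    have h3 := (hBs _ h1 h2).fderivWithin_right (m := 0) uniqueDiffOn_square (by simp) h1
    exact (h3.continuousWithinAt.clm_apply continuousWithinAt_const).mono fun z hz => (hbox hz).1
  have hBd : ∀ a ∈ Icc a₀ a₁, ∀ τ ∈ Icc α β,
      HasDerivWithinAt (fun a => B (a, τ)) (B₁ (a, τ)) (Icc a₀ a₁) a := by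
    intro a ha τ hτ
    obtain ⟨h1, h2, -⟩ := hbx a ha τ hτ
    exact (hasDerivWithinAt_fst h1.2
      ((hBs _ h1 h2).differentiableWithinAt (by simp)).hasFDerivWithinAt).mono hAJ
  have hBcont : ContinuousOn B (Icc a₀ a₁ ×ˢ Icc α β) := by
    rintro ⟨a, τ⟩ ⟨ha, hτ⟩
    obtain ⟨h1, h2, -⟩ := hbx a ha τ hτ
    exact (hBs _ h1 h2).continuousWithinAt.mono fun z hz => (hbox hz).1
  have hslice : ∀ {F : Type _} [TopologicalSpace F] {f : ℝ × ℝ → F},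
      ContinuousOn f (Icc a₀ a₁ ×ˢ Icc α β) → ContinuousOn (fun τ => f (s, τ)) (Icc α β) :=
    fun hf => hf.comp (by fun_prop) fun τ hτ => ⟨hsA, hτ⟩
  set W : ℝ → ℝ → E := fun a => coordF (c a) (U a) x₀ with hWdef
  have hWJ : ∀ a ∈ Icc a₀ a₁, ∀ τ ∈ Icc α β,
      HasDerivWithinAt (W a) (B (a, τ) (W a τ)) (Icc 0 1) τ := by
    intro a ha τ hτ
    obtain ⟨h1, h2, -⟩ := hbx a ha τ hτ
    have h3 := (hU a h1.1 τ h1.2).1.hasDerivWithinAt g h1.2 (hc.mdiff_left h1.1 h1.2) h2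
    rw [(hU a h1.1 τ h1.2).2, map_zero, zero_sub, ← hc.chartSqD_snd h1 h2] at h3
    exact h3
  -- `z` is the parameter derivative of the coordinates `W`, and comes with its own linear equation
  -- in `τ`. That equation is what permits a further covariant derivative in `τ`.
  obtain ⟨z, hz⟩ := exists_hasDerivWithinAt_parameter (B := fun a τ => B (a, τ))
    (B' := fun τ => B₁ (s, τ)) (W := W) hsA (fun a ha τ hτ => (hbx a ha τ hτ).2.2) hlen
    (hslice hBcont) (hslice hB₁c)
    (fun η hη => eventually_norm_sub_le_of_continuousOn hsA hBd hB₁c hη)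
    (fun a ha τ hτ => (hWJ a ha τ hτ).mono hTJ) (hball t₀ ht₀)
    ((hdiff.hasDerivWithinAt g hs (hc.mdiff_right hs ht₀.1)
      (hbx s hsA t₀ (hball t₀ ht₀)).2.1).mono hAJ)
  -- the covariant derivative with respect to the parameter
  have hH : ∀ τ ∈ Icc α β, FieldDiff (fun a => c a τ) (fun a => U a τ) s ∧
      coordMap x₀ (c s τ) (cov g (fun a => c a τ) (fun a => U a τ) s) =
        z τ + Γ (s, τ) (Y (s, τ) (1, 0)) (W s τ) := by
    intro τ hτ
    obtain ⟨h1, h2, -⟩ := hbx s hsA τ hτ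
    have h3 := cov_coord g hs (hc.mdiff_right hs h1.2) h2
      (V := fun a => U a τ) ((hz τ hτ).1.mono_of_mem_nhdsWithin hAn)
    rw [← hc.chartSqD_fst h1 h2] at h3
    exact h3
  intro τ hτ
  have hτ' := hball τ hτ
  obtain ⟨hsq, hxτ, -⟩ := hbx s hsA τ hτ'
  refine ⟨hxτ, (hH τ hτ').1, ?_⟩
  have hy := (extChartAt 𝓘(ℝ, E) x₀).map_source hxτ
  have hΓd : HasFDerivWithinAt Γ ((fderiv ℝ (christoffelL g x₀) (chartSq E c x₀ (s, τ))).comp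
      (Y (s, τ))) square (s, τ) :=
    HasFDerivAt.comp_hasFDerivWithinAt (f := chartSq E c x₀) (s, τ)
      ((contDiffAt_christoffelL g x₀ hy).differentiableAt (by simp)).hasFDerivAt
      (hc.hasFDerivWithinAt hsq hxτ)
  have hYd := hc.hasFDerivWithinAt_D hsq hxτ
  -- Uniqueness of one-sided or two-sided derivatives on `[0, 1]` identifies `B₁` with the product
  -- rule applied to `-Γ(c_τ, ·)`.
  have hB₁v : B₁ (s, τ) = -(fderiv ℝ (christoffelL g x₀) (chartSq E c x₀ (s, τ)) (Y (s, τ) (1, 0))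
      (Y (s, τ) (0, 1)) + Γ (s, τ) (chartSqDD E c x₀ (s, τ) (1, 0) (0, 1))) := by
    have h1 := (hasDerivWithinAt_fst hsq.2 hΓd).clm_apply
      ((hasDerivWithinAt_fst hsq.2 hYd).clm_apply
        (hasDerivWithinAt_const s _ ((0 : ℝ), (1 : ℝ))))
    rw [map_zero, add_zero] at h1
    exact (uniqueDiffWithinAt_unitIcc hs).eq_deriv _
      ((hBd s hsA τ hτ').mono_of_mem_nhdsWithin hAn) h1.neg
  have hder := ((hz τ hτ').2.mono_of_mem_nhdsWithin (hTn τ hτ)).add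
    (((hasDerivWithinAt_snd hsq.1 hΓd).clm_apply ((hasDerivWithinAt_snd hsq.1 hYd).clm_apply
        (hasDerivWithinAt_const τ _ ((1 : ℝ), (0 : ℝ))))).clm_apply (hWJ s hsA τ hτ'))
  have hfin := cov_coord g hsq.2 (hc.mdiff_left hs hsq.2) hxτ
    (hder.congr_of_eventuallyEq_of_mem
      (f₁ := coordF (c s) (fun τ => cov g (fun a => c a τ) (fun a => U a τ) s) x₀) (by
        filter_upwards [hTn τ hτ] with τ' hτ'
        exact (hH τ' hτ').2) hsq.2)
  refine ⟨hfin.1, hfin.2.trans ?_⟩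
  -- Once the mixed second derivatives are identified, they cancel, as do the two terms `Γ(c_τ, z)`.
  -- The surviving derivatives and products of Christoffel symbols are the curvature.
  rw [← hc.chartSqD_snd hsq hxτ, (hH τ hτ').2, hB₁v, hc.chartSqDD_symm hsq hxτ (0, 1) (1, 0)]
  unfold curvL
  simp only [hB, hΓ, neg_apply, add_apply, map_add, map_neg, map_zero, add_zero,
    ContinuousLinearMap.comp_apply]
  simp only [hWdef, Y, chartSq]
  abel

end

/-! ### Frames transported from the origin -/

section


variable {E : Type*} [NormedAddCommGroup E] [NormedSpace ℝ E]
  {M : Type*} [TopologicalSpace M] [ChartedSpace E M] [IsManifold 𝓘(ℝ, E) ∞ M]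

variable [FiniteDimensional ℝ E] {c : ℝ → ℝ → M} {g : RMetric E M}

/-- The curvature tensor, on the model space. -/
def curvE (g : RMetric E M) (p : M) (u v w : E) : E := curvature (E := E) g p u v w

theorem curvE_eq (p : M) (u v w : E) :
    curvE g p u v w = curvL g p (extChartAt 𝓘(ℝ, E) p p) u v w := curvature_eq g p u v w

/-- A family of parallel vector fields along the curves `c(a, ·)` that is differentiable with
respect to `a` at time `0` is so at all times, and `∇_τ ∇_a U = 𝓡(c_τ, c_a) U`. -/
theorem SmoothSquare.fieldDiff_family (hc : SmoothSquare E c)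
    {U : ℝ → ℝ → E} (hU : ∀ a ∈ Icc (0 : ℝ) 1, ∀ τ ∈ Icc (0 : ℝ) 1, ParAt g (c a) (U a) τ)
    {s : ℝ} (hs : s ∈ Icc (0 : ℝ) 1) (h0 : FieldDiff (fun a => c a 0) (fun a => U a 0) s) {t : ℝ}
    (ht : t ∈ Icc (0 : ℝ) 1) :
    FieldDiff (fun a => c a t) (fun a => U a t) s ∧
      FieldDiff (c s) (fun τ => cov g (fun a => c a τ) (fun a => U a τ) s) t ∧
      cov g (c s) (fun τ => cov g (fun a => c a τ) (fun a => U a τ) s) t =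
        curvE g (c s t) (vel (c s) t) (vel (fun a => c a t) s) (U s t) ∧
      ContinuousWithinAt (coordF (c s)
        (cov g (c s) (fun τ => cov g (fun a => c a τ) (fun a => U a τ) s)) (c s t)) (Icc 0 1) t := by
  have hall : ∀ τ ∈ Icc (0 : ℝ) 1, FieldDiff (fun a => c a τ) (fun a => U a τ) s := by
    -- Each local statement needs differentiability in `a` at one time only, so the hypothesis at
    -- the origin spreads over the whole curve.
    refine forall_unitIcc_of_local h0 fun τ hτ => ?_
    obtain ⟨ε, hε, h⟩ := hc.fieldDiff_family_local g hU hs hτ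
    exact ⟨ε, hε, fun t₀ ht₀ hP τ' hτ' => (h t₀ ht₀ hP τ' hτ').2.1⟩
  obtain ⟨ε, hε, h⟩ := hc.fieldDiff_family_local g hU hs ht
  have htε : t ∈ Icc (0 : ℝ) 1 ∩ Metric.ball t ε := ⟨ht, Metric.mem_ball_self hε⟩
  replace h := h t htε (hall t ht)
  obtain ⟨hx, h1, h2, h3⟩ := h t htε
  have hst : (s, t) ∈ square := ⟨hs, ht⟩
  refine ⟨h1, h2, ?_, ?_⟩
  · rw [coordMap_self, hc.chartSqD_snd hst hx, hc.chartSqD_fst hst hx, coordF, coordMap_self,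
      coordMap_self, coordMap_self] at h3
    rw [h3, curvE_eq]
    rfl
  · have hy := (extChartAt 𝓘(ℝ, E) (c s t)).map_source hx
    have hY : ContinuousWithinAt (fun τ => chartSq E c (c s t) (s, τ)) (Icc 0 1) t :=
      (hc.contDiffWithinAt hst hx).continuousWithinAt.tendsto.comp (tendsto_left hs)
    have hD : ContinuousWithinAt (fun τ => chartSqD E c (c s t) (s, τ)) (Icc 0 1) t :=
      (hc.contDiffWithinAt_D hst hx).continuousWithinAt.tendsto.comp (tendsto_left hs)
    have hΓ := contDiffAt_christoffelL g (c s t) hy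
    have hΓ1 : ContinuousWithinAt (fun τ => christoffelL g (c s t) (chartSq E c (c s t) (s, τ)))
        (Icc 0 1) t := ContinuousAt.comp_continuousWithinAt
      (f := fun τ => chartSq E c (c s t) (s, τ)) hΓ.continuousAt hY
    have hΓ2 : ContinuousWithinAt
        (fun τ => fderiv ℝ (christoffelL g (c s t)) (chartSq E c (c s t) (s, τ)))
        (Icc 0 1) t := ContinuousAt.comp_continuousWithinAt
      (f := fun τ => chartSq E c (c s t) (s, τ))
      (hΓ.fderiv_right (m := 0) (by simp)).continuousAt hY
    have hW : ContinuousWithinAt (coordF (c s) (U s) (c s t)) (Icc 0 1) t :=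
      ((hU s hs t ht).1.hasDerivWithinAt g ht (hc.mdiff_left hs ht) hx).continuousWithinAt
    have hT := hD.clm_apply (continuousWithinAt_const (b := ((0 : ℝ), (1 : ℝ))))
    have hS := hD.clm_apply (continuousWithinAt_const (b := ((1 : ℝ), (0 : ℝ))))
    have hcurv : ContinuousWithinAt (fun τ => curvL g (c s t) (chartSq E c (c s t) (s, τ))
        (chartSqD E c (c s t) (s, τ) (0, 1)) (chartSqD E c (c s t) (s, τ) (1, 0))
        (coordF (c s) (U s) (c s t) τ)) (Icc 0 1) t :=
      (((((hΓ2.clm_apply hT).clm_apply hS).clm_apply hW).sub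
        (((hΓ2.clm_apply hS).clm_apply hT).clm_apply hW)).add
        ((hΓ1.clm_apply hT).clm_apply ((hΓ1.clm_apply hS).clm_apply hW))).sub
        ((hΓ1.clm_apply hS).clm_apply ((hΓ1.clm_apply hT).clm_apply hW))
    -- The curvature identity holds near `t` in one fixed chart, so the second covariant derivative
    -- inherits the continuity of the explicit expression.
    refine hcurv.congr_of_eventuallyEq_of_mem ?_ ht
    filter_upwards [self_mem_nhdsWithin, mem_nhdsWithin_of_mem_nhds (Metric.ball_mem_nhds t hε)]
      with τ h4 h5
    exact (h τ ⟨h4, h5⟩).2.2.2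

/-- The coordinates of a vector given by its inner products with the vectors of a basis. -/
def pairing (g : RMetric E M) (p : M) : E ≃L[ℝ] (Fin (Module.finrank ℝ E) → ℝ) :=
  (LinearEquiv.ofInjectiveOfFinrankEq
    (LinearMap.pi fun i => ((innerE g p).flip (Module.finBasis ℝ E i) : E →ₗ[ℝ] ℝ))
    (by
      rw [← LinearMap.ker_eq_bot, LinearMap.ker_eq_bot']
      intro u hu
      have h : innerE g p u = 0 := by
        apply ContinuousLinearMap.coe_injective
        refine (Module.finBasis ℝ E).ext fun i => ?_
        simpa using congrFun hu i
      exact eq_zero_of_innerE_self (g := g) (p := p) (by rw [h]; rfl))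
    (by simp)).toContinuousLinearEquiv

/-- A function is differentiable if its inner products with all vectors are. -/
theorem exists_hasDerivWithinAt_of_innerE {p : M} {f : ℝ → E} {t : ℝ} (ht : t ∈ Icc (0 : ℝ) 1)
    {d : E → ℝ} (h : ∀ u, HasDerivWithinAt (fun τ => innerE g p (f τ) u) (d u) (Icc 0 1) t) :
    ∃ f' : E, HasDerivWithinAt f f' (Icc 0 1) t ∧ ∀ u, innerE g p f' u = d u := by
  have h1 : HasDerivWithinAt (fun τ => pairing g p (f τ))
      (fun i => d (Module.finBasis ℝ E i)) (Icc 0 1) t :=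
    hasDerivWithinAt_pi.2 fun i => h _
  have h2 := (pairing g p).symm.hasFDerivAt.comp_hasDerivWithinAt t h1
  have h3 : HasDerivWithinAt f ((pairing g p).symm fun i => d (Module.finBasis ℝ E i))
      (Icc 0 1) t := h2.congr_of_mem (fun τ _ => by simp) ht
  refine ⟨_, h3, fun u => ?_⟩
  refine (uniqueDiffWithinAt_unitIcc ht).eq_deriv _ ?_ (h u)
  exact ((innerE g p).flip u).hasFDerivAt.comp_hasDerivWithinAt t h3

theorem continuousWithinAt_of_innerE {p : M} {f : ℝ → E} {t : ℝ}
    (h : ∀ u, ContinuousWithinAt (fun τ => innerE g p (f τ) u) (Icc 0 1) t) :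
    ContinuousWithinAt f (Icc 0 1) t := by
  have h1 : ContinuousWithinAt (fun τ => pairing g p (f τ)) (Icc 0 1) t :=
    continuousWithinAt_pi.2 fun i => h _
  have h2 := (pairing g p).symm.continuous.continuousAt.comp_continuousWithinAt
    (f := fun τ => pairing g p (f τ)) h1
  exact h2.congr (fun τ _ => by simp) (by simp)

theorem eq_of_innerE {p : M} {u v : E} (h : ∀ w, innerE g p u w = innerE g p v w) : u = v := by
  refine sub_eq_zero.1 (eq_zero_of_innerE_self (g := g) (p := p) ?_)
  rw [(innerE g p).map_sub u v, sub_apply, h, sub_self]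

/-! ### Regularity of fields transported back to the start of a curve -/

section curve

variable {γ : ℝ → M} (hγ : ContMDiffOn 𝓘(ℝ, ℝ) 𝓘(ℝ, E) ∞ γ (Icc 0 1)) {X : ℝ → E} {t : ℝ}
  (ht : t ∈ Icc (0 : ℝ) 1)

include hγ ht

/-- Pairing with a fixed `u` moves the transport onto `u`, which becomes a parallel field; metric
compatibility then leaves only the covariant derivative of `X`. -/
theorem hasDerivWithinAt_tr (hX : FieldDiff γ X t) :
    HasDerivWithinAt (fun τ => tr g γ τ 0 (X τ)) (tr g γ t 0 (cov g γ X t)) (Icc 0 1) t := by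
  have h0 : (0 : ℝ) ∈ Icc (0 : ℝ) 1 := by simp
  obtain ⟨f', h1, h2⟩ := exists_hasDerivWithinAt_of_innerE (g := g) (p := γ 0)
    (f := fun τ => tr g γ τ 0 (X τ)) ht
    (d := fun u => innerE g (γ t) (cov g γ X t) (tr g γ 0 t u)) (fun u => by
      have hp := parAt_tr (g := g) hγ h0 u ht
      have h := hasDerivWithinAt_innerE g ht ((hγ t ht).mdifferentiableWithinAt (by simp)) hX hp.1
      rw [hp.2, map_zero, add_zero] at h
      exact h.congr_of_mem (fun τ hτ => innerE_tr hγ hτ h0 _ _) ht)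
  have : f' = tr g γ t 0 (cov g γ X t) := eq_of_innerE (g := g) (p := γ 0) fun u => by
    rw [h2, innerE_tr hγ ht h0]
  rwa [← this]

/-- The same adjunction reduces continuity to an inner product with a parallel field, computed in
one chart. It is needed to integrate transported curvature. -/
theorem continuousWithinAt_tr
    (hX : ContinuousWithinAt (coordF γ X (γ t)) (Icc 0 1) t) :
    ContinuousWithinAt (fun τ => tr g γ τ 0 (X τ)) (Icc 0 1) t := by
  have h0 : (0 : ℝ) ∈ Icc (0 : ℝ) 1 := by simp
  refine continuousWithinAt_of_innerE (g := g) (p := γ 0) fun u => ?_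
  have hs := mem_extChartAt_source (I := 𝓘(ℝ, E)) (γ t)
  have hmd := (hγ t ht).mdifferentiableWithinAt (n := ∞) (by simp)
  have hp := (parAt_tr (g := g) hγ h0 u ht).1.hasDerivWithinAt g ht hmd hs
  have hg : ContinuousWithinAt (fun τ => chartMetric g (γ t) (extChartAt 𝓘(ℝ, E) (γ t) (γ τ)))
      (Icc 0 1) t :=
    (contDiffAt_chartMetric g (γ t)
      ((extChartAt 𝓘(ℝ, E) (γ t)).map_source hs)).continuousAt.comp_continuousWithinAt
      (f := fun τ => extChartAt 𝓘(ℝ, E) (γ t) (γ τ))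
      (contDiffWithinAt_extChartAt_comp (hγ t ht) hs).continuousWithinAt
  refine ((hg.clm_apply hX).clm_apply hp.continuousWithinAt).congr_of_eventuallyEq_of_mem ?_ ht
  filter_upwards [eventually_mem_source (hγ t ht).continuousWithinAt hs, self_mem_nhdsWithin]
    with τ hτ hτ'
  rw [innerE_tr hγ hτ' h0]
  exact (chartMetric_coordMap g hτ _ _).symm

end curve

/-- The field obtained by transport of `u` from the origin of the square, first along `c(·, 0)` and
then along `c(a, ·)`. -/
def frame (g : RMetric E M) (c : ℝ → ℝ → M) (u : E) (a τ : ℝ) : E :=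
  tr g (c a) 0 τ (tr g (fun σ => c σ 0) 0 a u)

/-- Transport to the origin of the square, on the model space. -/
def toOrigin (g : RMetric E M) (c : ℝ → ℝ → M) (s t : ℝ) (u : E) : E :=
  tr g (fun σ => c σ 0) s 0 (tr g (c s) t 0 u)

/-! ### Frames, transport to the origin of the square, and holonomy -/

section transport

variable (hc : SmoothSquare E c) {s t : ℝ} (hs : s ∈ Icc (0 : ℝ) 1) (ht : t ∈ Icc (0 : ℝ) 1)

include hc hs

theorem SmoothSquare.frame_origin (u : E) : frame g c u s 0 = tr g (fun σ => c σ 0) 0 s u :=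
  tr_self (hc.contMDiffOn_left hs) (by simp) _

theorem SmoothSquare.fieldDiff_frame_origin (u : E) :
    FieldDiff (fun a => c a 0) (fun a => frame g c u a 0) s ∧
      cov g (fun a => c a 0) (fun a => frame g c u a 0) s = 0 := by
  have h0 : (0 : ℝ) ∈ Icc (0 : ℝ) 1 := by simp
  refine (parAt_tr (g := g) (hc.contMDiffOn_right h0) h0 u hs).congr hs ?_
  filter_upwards [self_mem_nhdsWithin] with a ha
  exact (hc.frame_origin ha u).symm

include ht

theorem SmoothSquare.parAt_frame (u : E) : ParAt g (c s) (frame g c u s) t :=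
  parAt_tr (hc.contMDiffOn_left hs) (by simp) _ ht

theorem SmoothSquare.innerE_toOrigin (u v : E) :
    innerE g (c 0 0) (toOrigin g c s t u) v = innerE g (c s t) u (frame g c v s t) := by
  have h0 : (0 : ℝ) ∈ Icc (0 : ℝ) 1 := by simp
  have h1 := innerE_tr (g := g) (hc.contMDiffOn_right h0) hs h0 (tr g (c s) t 0 u) v
  have h2 := innerE_tr (g := g) (hc.contMDiffOn_left hs) ht h0 u (tr g (fun σ => c σ 0) 0 s v)
  exact h1.trans h2

theorem SmoothSquare.frame_toOrigin {τ : ℝ} (hτ : τ ∈ Icc (0 : ℝ) 1) (u : E) :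
    frame g c (toOrigin g c s t u) s τ = tr g (c s) t τ u := by
  have h0 : (0 : ℝ) ∈ Icc (0 : ℝ) 1 := by simp
  unfold frame toOrigin
  rw [tr_tr (hc.contMDiffOn_right h0) hs h0 hs, tr_self (hc.contMDiffOn_right h0) hs,
    tr_tr (hc.contMDiffOn_left hs) ht h0 hτ]

theorem SmoothSquare.frame_toOrigin_self (u : E) :
    frame g c (toOrigin g c s t u) s t = u := by
  rw [hc.frame_toOrigin hs ht ht, tr_self (hc.contMDiffOn_left hs) ht]

theorem SmoothSquare.innerE_toOrigin_self (u : E) :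
    innerE g (c 0 0) (toOrigin g c s t u) (toOrigin g c s t u) = innerE g (c s t) u u := by
  rw [hc.innerE_toOrigin hs ht, hc.frame_toOrigin_self hs ht]

theorem SmoothSquare.toOrigin_frame (u : E) : toOrigin g c s t (frame g c u s t) = u := by
  have h0 : (0 : ℝ) ∈ Icc (0 : ℝ) 1 := by simp
  unfold frame toOrigin
  rw [tr_tr (hc.contMDiffOn_left hs) h0 ht h0, tr_self (hc.contMDiffOn_left hs) h0,
    tr_tr (hc.contMDiffOn_right h0) h0 hs h0, tr_self (hc.contMDiffOn_right h0) h0]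

theorem SmoothSquare.innerE_frame (u v : E) :
    innerE g (c s t) (frame g c u s t) (frame g c v s t) = innerE g (c 0 0) u v := by
  rw [← hc.innerE_toOrigin hs ht, hc.toOrigin_frame hs ht]

theorem SmoothSquare.fieldDiff_frame (u : E) :
    FieldDiff (fun a => c a t) (fun a => frame g c u a t) s :=
  (hc.fieldDiff_family (fun _ ha _ hτ => hc.parAt_frame ha hτ u) hs
    (hc.fieldDiff_frame_origin hs u).1 ht).1

/-- The covariant derivative of the frame with respect to the parameter is skew-symmetric. -/
theorem SmoothSquare.innerE_cov_frame (u v : E) :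
    innerE g (c s t) (cov g (fun a => c a t) (fun a => frame g c u a t) s) (frame g c v s t) =
      -innerE g (c s t) (frame g c u s t)
        (cov g (fun a => c a t) (fun a => frame g c v a t) s) := by
  have h := hasDerivWithinAt_innerE g hs (hc.mdiff_right hs ht) (hc.fieldDiff_frame (g := g) hs ht u)
    (hc.fieldDiff_frame (g := g) hs ht v)
  have h' : HasDerivWithinAt (fun a => innerE g (c a t) (frame g c u a t) (frame g c v a t)) 0
      (Icc 0 1) s := (hasDerivWithinAt_const s _ (innerE g (c 0 0) u v)).congr_of_mem
        (fun a ha => hc.innerE_frame ha ht u v) hs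
  have := (uniqueDiffWithinAt_unitIcc hs).eq_deriv _ h h'
  linarith

/-- The derivative of a field transported to the origin, corrected by the holonomy of the frame, is
the transport of the covariant derivative. -/
theorem SmoothSquare.hasDerivWithinAt_toOrigin {Q : ℝ → E} (hQ : FieldDiff (fun a => c a t) Q s) :
    HasDerivWithinAt (fun σ => toOrigin g c σ t (Q σ))
      (toOrigin g c s t (cov g (fun a => c a t) Q s) - toOrigin g c s t
        (cov g (fun a => c a t) (fun a => frame g c (toOrigin g c s t (Q s)) a t) s))
      (Icc 0 1) s := by
  obtain ⟨f', h1, h2⟩ := exists_hasDerivWithinAt_of_innerE (g := g) (p := c 0 0)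
    (f := fun σ => toOrigin g c σ t (Q σ)) hs
    (d := fun u => innerE g (c s t) (cov g (fun a => c a t) Q s) (frame g c u s t) +
      innerE g (c s t) (Q s) (cov g (fun a => c a t) (fun a => frame g c u a t) s)) (fun u =>
      (hasDerivWithinAt_innerE g hs (hc.mdiff_right hs ht) hQ
        (hc.fieldDiff_frame hs ht u)).congr_of_mem (fun σ hσ => hc.innerE_toOrigin hσ ht _ _) hs)
  convert! h1 using 1
  refine eq_of_innerE (g := g) (p := c 0 0) fun u => ?_
  -- Skew-symmetry moves the derivative from the test frame to the frame extending `Q s`, which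
  -- equals `Q s` at `(s, t)`; this produces the holonomy term with its minus sign.
  rw [h2, map_sub, sub_apply, hc.innerE_toOrigin hs ht, hc.innerE_toOrigin hs ht,
    hc.innerE_cov_frame hs ht, hc.frame_toOrigin_self hs ht]
  ring

/-- The covariant derivative of the frame with respect to the parameter is an integral of the
curvature. -/
theorem SmoothSquare.holonomy_integral (u : E) :
    ContinuousOn (fun τ => tr g (c s) τ 0
      (curvE g (c s τ) (vel (c s) τ) (vel (fun a => c a τ) s) (tr g (c s) t τ u)))
        (Icc 0 1) ∧
    ∫ τ in (0 : ℝ)..t, tr g (c s) τ 0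
      (curvE g (c s τ) (vel (c s) τ) (vel (fun a => c a τ) s) (tr g (c s) t τ u)) =
      tr g (c s) t 0
        (cov g (fun a => c a t) (fun a => frame g c (toOrigin g c s t u) a t) s) := by
  have h0 : (0 : ℝ) ∈ Icc (0 : ℝ) 1 := by simp
  have hγ := hc.contMDiffOn_left hs
  set w := toOrigin g c s t u with hw
  set H : ℝ → E := fun τ => cov g (fun a => c a τ) (fun a => frame g c w a τ) s with hH
  have hfam := fun τ (hτ : τ ∈ Icc (0 : ℝ) 1) => hc.fieldDiff_family (g := g)
    (U := frame g c w) (fun _ ha _ hτ => hc.parAt_frame ha hτ w) hs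
    (hc.fieldDiff_frame_origin hs w).1 hτ
  have heq : ∀ τ ∈ Icc (0 : ℝ) 1, tr g (c s) τ 0
      (curvE g (c s τ) (vel (c s) τ) (vel (fun a => c a τ) s)
        (tr g (c s) t τ u)) = tr g (c s) τ 0 (cov g (c s) H τ) := by
    intro τ hτ
    rw [(hfam τ hτ).2.2.1, hw, hc.frame_toOrigin hs ht hτ]
  have hcont : ContinuousOn (fun τ => tr g (c s) τ 0 (cov g (c s) H τ)) (Icc 0 1) :=
    fun τ hτ => continuousWithinAt_tr hγ hτ (hfam τ hτ).2.2.2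
  have hder : ∀ τ ∈ Icc (0 : ℝ) 1, HasDerivWithinAt (fun τ => tr g (c s) τ 0 (H τ))
      (tr g (c s) τ 0 (cov g (c s) H τ)) (Icc 0 1) τ :=
    fun τ hτ => hasDerivWithinAt_tr hγ hτ (hfam τ hτ).2.1
  refine ⟨hcont.congr heq, ?_⟩
  have hsub : Icc 0 t ⊆ Icc (0 : ℝ) 1 := Icc_subset_Icc_right ht.2
  rw [intervalIntegral.integral_congr (g := fun τ => tr g (c s) τ 0 (cov g (c s) H τ))
    fun τ hτ => heq τ (hsub (by rwa [uIcc_of_le ht.1] at hτ)),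
    intervalIntegral.integral_eq_sub_of_hasDerivAt_of_le (f := fun τ => tr g (c s) τ 0 (H τ)) ht.1
      (fun τ hτ => (hder τ (hsub hτ)).continuousWithinAt.mono hsub)
      (fun τ hτ => (hder τ (hsub (Ioo_subset_Icc_self hτ))).hasDerivAt
        (Icc_mem_nhds hτ.1 (hτ.2.trans_le ht.2)))
      (ContinuousOn.intervalIntegrable
        (by rw [uIcc_of_le ht.1]; exact hcont.mono hsub))]
  -- The lower boundary term disappears because the frame is parallel along `c(·, 0)`.
  have : H 0 = 0 := (hc.fieldDiff_frame_origin hs w).2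
  rw [tr_self hγ h0, this, sub_zero]

end transport

end

/-! ### Raising, holonomy and lengths of paths -/

section


variable {E : Type*} [NormedAddCommGroup E] [NormedSpace ℝ E]
  {M : Type*} [TopologicalSpace M] [ChartedSpace E M] [IsManifold 𝓘(ℝ, E) ∞ M]

variable [FiniteDimensional ℝ E] {c : ℝ → ℝ → M} {g : RMetric E M}

theorem gnorm_sq_eq_innerE (p : M) (u : E) : gnorm (E := E) g (x := p) u ^ 2 = innerE g p u u :=
  normE_sq g p u

section omega

variable (hc : SmoothSquare E c) {s t : ℝ} (hs : s ∈ Icc (0 : ℝ) 1) (ht : t ∈ Icc (0 : ℝ) 1)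

include hc hs ht

/-- Transport from `s` to `a` along `c(·, 0)` factors through `0`, so `ω^{s, t}` is a frame with a
fixed vector at the origin. -/
theorem SmoothSquare.omegaField_eq {a : ℝ} (ha : a ∈ Icc (0 : ℝ) 1) :
    omegaField (E := E) g c s t a t = frame g c (toOrigin g c s t (srv g (c s) t)) a t := by
  have h0 : (0 : ℝ) ∈ Icc (0 : ℝ) 1 := by simp
  exact congrArg (tr g (c a) 0 t)
    (tr_tr (g := g) (hc.contMDiffOn_right h0) hs h0 ha (tr g (c s) t 0 (srv g (c s) t))).symm

theorem SmoothSquare.fieldDiff_omegaField :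
    FieldDifferentiableAt (E := E) (fun a => c a t) (fun a => omegaField g c s t a t) s := by
  refine (hc.fieldDiff_frame (g := g) hs ht (toOrigin g c s t (srv g (c s) t))).congr hs ?_
  filter_upwards [self_mem_nhdsWithin] with a ha
  exact (hc.omegaField_eq hs ht ha).symm

theorem SmoothSquare.holonomy_eq :
    holonomy (E := E) g c s t = toOrigin g c s t (cov g (fun a => c a t)
      (fun a => frame g c (toOrigin g c s t (srv g (c s) t)) a t) s) := by
  refine congrArg (toOrigin g c s t) (cov_congr g hs ?_)
  filter_upwards [self_mem_nhdsWithin] with a ha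
  exact hc.omegaField_eq hs ht ha

/-- The holonomy term cancels the correction in `SmoothSquare.hasDerivWithinAt_toOrigin`, leaving
the transport of `∇_s q`, which preserves norms. -/
theorem SmoothSquare.gnorm_raisingS_add_holonomy (h0 : (vel (c s) t : E) ≠ 0) :
    gnorm (E := E) g (raisingS g c s t + holonomy g c s t) ^ 2 = density g c (s, t) := by
  obtain ⟨hd, he⟩ := hc.cov_srv g hs ht h0
  have h1 : raisingS (E := E) g c s t + holonomy g c s t =
      toOrigin g c s t (cov g (fun a => c a t) (fun σ => srv g (c σ) t) s) := by
    rw [hc.holonomy_eq hs ht]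
    have h2 := (hc.hasDerivWithinAt_toOrigin (g := g) hs ht hd).derivWithin
      (uniqueDiffWithinAt_unitIcc hs)
    exact (congrArg (· + _) h2).trans (sub_add_cancel _ _)
  rw [h1]
  exact (gnorm_sq_eq_innerE _ _).trans ((hc.innerE_toOrigin_self hs ht _).trans he)

end omega

/-- The squared speed of a path of immersions. -/
def speedSq (g : RMetric E M) (c : ℝ → ℝ → M) (s : ℝ) : ℝ :=
  innerE g (c s 0) (vel (fun σ => c σ 0) s) (vel (fun σ => c σ 0) s) +
    ∫ t in (0 : ℝ)..1, density g c (s, t)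

theorem integral_congr_unitIcc {f f' : ℝ → ℝ} (h : ∀ t ∈ Icc (0 : ℝ) 1, f t = f' t) :
    ∫ t in (0 : ℝ)..1, f t = ∫ t in (0 : ℝ)..1, f' t :=
  intervalIntegral.integral_congr fun t ht => h t (by rwa [uIcc_of_le zero_le_one] at ht)

theorem SmoothSquare.continuousOn_innerE_velS (hc : SmoothSquare E c) {t : ℝ}
    (ht : t ∈ Icc (0 : ℝ) 1) :
    ContinuousOn (fun s => innerE g (c s t) (vel (fun σ => c σ t) s) (vel (fun σ => c σ t) s))
      (Icc 0 1) := by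
  have h : ContinuousOn (fun w : ℝ × ℝ => innerE g (c w.1 w.2) (vel (fun σ => c σ w.2) w.1)
      (vel (fun σ => c σ w.2) w.1)) square := fun z hz =>
    ContField.innerE hc g hz (hc.contField_velS hz) (hc.contField_velS hz)
  exact h.comp (f := fun s : ℝ => (s, t)) (by fun_prop) fun s hs => ⟨hs, ht⟩

section immersed

variable (hc : SmoothSquare E c)
  (himm : ∀ s ∈ Icc (0 : ℝ) 1, ∀ t ∈ Icc (0 : ℝ) 1, (vel (c s) t : E) ≠ 0)

include hc himm

theorem SmoothSquare.intervalIntegrable_sqrt_speedSq :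
    IntervalIntegrable (fun s => √(speedSq g c s)) volume 0 1 := by
  have h0 : (0 : ℝ) ∈ Icc (0 : ℝ) 1 := by simp
  have h3 : ContinuousOn (fun s => √(speedSq g c s)) (Icc 0 1) :=
    ((hc.continuousOn_innerE_velS h0).add (continuousOn_integral_square (hc.continuousOn_density g himm))).sqrt
  exact ContinuousOn.intervalIntegrable (by rwa [uIcc_of_le zero_le_one])

variable {s : ℝ} (hs : s ∈ Icc (0 : ℝ) 1)

include hs

theorem SmoothSquare.sobolevMetric_derivS :
    sobolevMetric (E := E) g (c s) (derivS c s) (derivS c s) = speedSq g c s :=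
  congrArg (innerE g (c s 0) (vel (fun σ => c σ 0) s) (vel (fun σ => c σ 0) s) + ·)
    (integral_congr_unitIcc fun t ht => hc.sobolevIntegrand_eq g hs ht (himm s hs t ht))

theorem SmoothSquare.speedSrvf_eq : speedSrvf (E := E) g c s = √(speedSq g c s) := by
  refine congrArg Real.sqrt (congrArg₂ (· + ·) (gnorm_sq_eq_innerE _ _)
    (integral_congr_unitIcc fun t ht => ?_))
  exact (gnorm_sq_eq_innerE _ _).trans (hc.cov_srv g hs ht (himm s hs t ht)).2

theorem SmoothSquare.speedRaising_eq : speedRaising (E := E) g c s = √(speedSq g c s) :=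
  congrArg Real.sqrt (congrArg₂ (· + ·) (gnorm_sq_eq_innerE _ _)
    (integral_congr_unitIcc fun t ht =>
      hc.gnorm_raisingS_add_holonomy hs ht (himm s hs t ht)))

omit hs

theorem SmoothSquare.wellDefined : WellDefined (E := E) g c where
  transport_curve s hs := hasTransport g (hc.contMDiffOn_left hs)
  transport_origin := hasTransport g (hc.contMDiffOn_right (by simp))
  derivS_diff s hs t ht := (hc.cov_velS g hs ht (mem_extChartAt_source (c s t))).1
  srvf_diff s hs t ht := (hc.cov_srv g hs ht (himm s hs t ht)).1
  raising_diff s hs t ht := (hc.hasDerivWithinAt_toOrigin (g := g) hs ht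
    (hc.cov_srv g hs ht (himm s hs t ht)).1).differentiableWithinAt
  omega_diff s hs t ht := hc.fieldDiff_omegaField hs ht
  sobolev_int s hs := intervalIntegrable_congr_Icc
    (fun t ht => (hc.sobolevIntegrand_eq g hs ht (himm s hs t ht)).symm)
    (intervalIntegrable_square (hc.continuousOn_density g himm) hs)
  length_int := intervalIntegrable_congr_Icc
    (fun s hs => congrArg Real.sqrt (hc.sobolevMetric_derivS himm hs).symm)
    (hc.intervalIntegrable_sqrt_speedSq himm)
  srvf_int s hs := intervalIntegrable_congr_Icc
    (fun t ht => ((gnorm_sq_eq_innerE _ _).trans (hc.cov_srv g hs ht (himm s hs t ht)).2).symm)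
    (intervalIntegrable_square (hc.continuousOn_density g himm) hs)
  raising_int s hs := intervalIntegrable_congr_Icc
    (fun t ht => (hc.gnorm_raisingS_add_holonomy hs ht (himm s hs t ht)).symm)
    (intervalIntegrable_square (hc.continuousOn_density g himm) hs)
  curvature_int s hs t ht := by
    refine ContinuousOn.intervalIntegrable ?_
    rw [uIcc_of_le ht.1]
    exact (hc.holonomy_integral hs ht (srv g (c s) t)).1.mono (Icc_subset_Icc_right ht.2)
  speedSrvf_int := intervalIntegrable_congr_Icc
    (fun s hs => (hc.speedSrvf_eq himm hs).symm) (hc.intervalIntegrable_sqrt_speedSq himm)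
  speedRaising_int := intervalIntegrable_congr_Icc
    (fun s hs => (hc.speedRaising_eq himm hs).symm) (hc.intervalIntegrable_sqrt_speedSq himm)

end immersed

end

end CurveSpace

end

open CurveSpace in
theorem proposition3
    {E : Type*} [NormedAddCommGroup E] [NormedSpace ℝ E] [FiniteDimensional ℝ E]
    {M : Type*} [TopologicalSpace M] [T2Space M] [ChartedSpace E M] [IsManifold 𝓘(ℝ, E) ∞ M]
    (g : Bundle.ContMDiffRiemannianMetric 𝓘(ℝ, E) ∞ E (fun x : M => TangentSpace 𝓘(ℝ, E) x))
    (c₀ c₁ : ℝ → M) (hc₀ : IsImm (E := E) c₀) (hc₁ : IsImm (E := E) c₁) :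
    geodesicDist g c₀ c₁ =
        ⨅ (c : ℝ → ℝ → M) (_ : IsPath (E := E) c₀ c₁ c),
          ENNReal.ofReal (∫ s in (0 : ℝ)..1,
            √(gnorm g (derivS c s 0) ^ 2 + ∫ t in (0 : ℝ)..1, gnorm g (covSrvf g c s t) ^ 2)) ∧
      geodesicDist g c₀ c₁ =
        ⨅ (c : ℝ → ℝ → M) (_ : IsPath (E := E) c₀ c₁ c),
          ENNReal.ofReal (∫ s in (0 : ℝ)..1,
            √(gnorm g (derivS c s 0) ^ 2 +
              ∫ t in (0 : ℝ)..1, gnorm g (raisingS g c s t + holonomy g c s t) ^ 2)) ∧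
      ∀ c : ℝ → ℝ → M, IsPath (E := E) c₀ c₁ c →
        WellDefined g c ∧
          ∀ s ∈ Icc (0 : ℝ) 1, ∀ t ∈ Icc (0 : ℝ) 1,
            holonomy g c s t =
              transport g (fun σ => c σ 0) s 0
                (∫ τ in (0 : ℝ)..t, curvatureIntegrand g c s t τ : E) := by
  have himm : ∀ c : ℝ → ℝ → M, IsPath (E := E) c₀ c₁ c →
      ∀ s ∈ Icc (0 : ℝ) 1, ∀ t ∈ Icc (0 : ℝ) 1, (vel (c s) t : E) ≠ 0 :=
    fun c hP s hs t ht => (hP.imm s hs).2 t ht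
  have hsq : ∀ c : ℝ → ℝ → M, IsPath (E := E) c₀ c₁ c → SmoothSquare E c := fun c hP => hP.smooth
  have hlen : ∀ (c : ℝ → ℝ → M) (hP : IsPath (E := E) c₀ c₁ c) (s : ℝ), s ∈ Icc (0 : ℝ) 1 →
      √(sobolevMetric g (c s) (derivS c s) (derivS c s)) = √(speedSq g c s) := fun c hP s hs =>
    congrArg Real.sqrt ((hsq c hP).sobolevMetric_derivS (himm c hP) hs)
  refine ⟨?_, ?_, fun c hP => ⟨(hsq c hP).wellDefined (himm c hP), fun s hs t ht => ?_⟩⟩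
  -- The infima run over the same paths and the speeds agree at every `s ∈ [0, 1]`, so no minimizing
  -- or approximating sequence is involved.
  · refine iInf_congr fun c => iInf_congr fun hP => congrArg ENNReal.ofReal
      (integral_congr_unitIcc fun s hs => ?_)
    exact (hlen c hP s hs).trans ((hsq c hP).speedSrvf_eq (himm c hP) hs).symm
  · refine iInf_congr fun c => iInf_congr fun hP => congrArg ENNReal.ofReal
      (integral_congr_unitIcc fun s hs => ?_)
    exact (hlen c hP s hs).trans ((hsq c hP).speedRaising_eq (himm c hP) hs).symm
  · exact ((hsq c hP).holonomy_eq hs ht).trans (congrArg (tr g (fun σ => c σ 0) s 0)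
      ((hsq c hP).holonomy_integral (g := g) hs ht (srv g (c s) t)).2.symm)
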